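/- Setting. Let $A,B$ be $C^*$-algebras (not necessarily unital), $\rho:A\to B$ an injective $*$-homomorphism, $\mathscr A\subseteq A$ a dense $*$-subalgebra and $\delta:\mathscr A\to B$ a linear map with $\delta(ab)=\delta(a)\rho(b)+\rho(a)\delta(b)$ and $\delta(a^*)=-\delta(a)^*$ for all $a,b\in\mathscr A$, which is closed in the following sense: if $a_n\in\mathscr A$, $a_n\to 0$ and $\delta(a_n)\to b$, then $b=0$. Let $A_\delta\subseteq A$ be the completion of $\mathscr A$ in the norm $\|a\|_\delta=\|a\|+\|\delta(a)\|$, and write again $\delta:A_\delta\to B$ for the extended derivation. Let $X$ be a (right) Hilbert $C^*$-module over $A$ and suppose there is a sequence $(\xi_n)$ in $X$ with $\langle\xi_n,\xi_m\rangle\in\mathscr A$ for all $n,m$ whose $A$-span $\{\sum_n\xi_n a_n\}$ is dense in $X$. Let $H_A$ be the standard Hilbert module of square summable sequences in $A$ (similarly for other $C^*$-algebras), let $H_{A_\delta}=\{(a_n)\in H_A: a_n\in A_\delta,\ (\delta(a_n))\in H_B\}$, let $\mathscr K(H_A)$ be the compact operators on $H_A$, and let $\mathscr K(H_A)_\delta\subseteq\mathscr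 K(H_A)$ be the completion of the finite matrices over $\mathscr A$ in the norm $\|M\|+\|\delta(M)\|$, where $\delta$ is applied entrywise. Let $\Omega_\delta(A)\subseteq B$ be the smallest $C^*$-subalgebra containing $\rho(A_\delta)$ and $\delta(A_\delta)$, on which $A$ acts by left multiplication through $\rho$, and let $X\hat\otimes_A\Omega_\delta(A)$ be the interior tensor product. For $\xi\in X$ let $T_\xi:\Omega_\delta(A)\to X\hat\otimes_A\Omega_\delta(A)$, $T_\xi(\omega)=\xi\otimes\omega$, with adjoint $T_\xi^*(\eta\otimes\omega)=\rho(\langle\xi,\eta\rangle)\,\omega$. Call $(W,K,(\zeta_k))$ an absorption triple if $W:X\to H_A$ is an adjointable isometry, $K:H_A\to H_A$ is a positive selfadjoint bounded operator, and $\zeta_k\in X$ are such that, with $P=WW^*$: $KP=PK$; $W^*KW:X\to X$ has dense image; $PK\in\mathscr K(H_A)$; $PK^2\in\mathscr K(H_A)_\delta$; and $W(\eta)=(\langle\zeta_k,\eta\rangle)_k$ for all $\eta\in X$. Theorem. An absorption triple exists. Moreover, for every absorption triple $(W,K,(\zeta_k))$ the following hold for $\mathscr X:=\mathrm{Im}\big(W^*K^2:H_{A_\delta}\to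 X\big)$. (a) $\mathscr X$ is dense in $X$ and is an $A_\delta$-submodule of $X$; $W(\xi)\in H_{A_\delta}$ and $\langle\xi,\eta\rangle\in A_\delta$ for all $\xi,\eta\in\mathscr X$. (b) The operator $W\otimes 1:X\hat\otimes_A\Omega_\delta(A)\to H_{\Omega_\delta(A)}$, $\xi\otimes\omega\mapsto(\rho(W(\xi)_n)\,\omega)_n$, is well defined, bounded and adjointable, with adjoint denoted $W^*\otimes 1$. Hence the Graßmann connection $\nabla_\delta:=(W^*\otimes1)\,\delta\,W:\mathscr X\to X\hat\otimes_A\Omega_\delta(A)$, where $\delta:H_{A_\delta}\to H_{\Omega_\delta(A)}$ is applied entrywise, is a well-defined $\mathbb C$-linear map. (c) $\nabla_\delta$ is Hermitian: $\delta(\langle\xi,\eta\rangle)=T_\xi^*\nabla_\delta(\eta)-\big(T_\eta^*\nabla_\delta(\xi)\big)^*$ for all $\xi,\eta\in\mathscr X$. (d) $\nabla_\delta$ satisfies the Leibniz rule: $\nabla_\delta(\eta a)=\nabla_\delta(\eta)\,\rho(a)+\eta\otimes\delta(a)$ for all $\eta\in\mathscr X$ and $a\in A_\delta$. -/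

import Mathlib

open Filter Topology
open scoped TensorProduct RightActions

noncomputable section

/-- A *right* inner product module over a C⋆-algebra `A`, with `A`-valued inner product that is
linear in the second variable and the norm `‖x‖ = ‖⟪x, x⟫‖ ^ (1 / 2)`; it is a Hilbert C⋆-module
when `E` is complete. This is the mirror image of Mathlib's `CStarModule`, which has left actions.
The remaining laws of a right module follow from these axioms because the form is definite. -/
class HilbertCMod (A E : Type*) [NonUnitalCStarAlgebra A] [PartialOrder A]
    [NormedAddCommGroup E] [NormedSpace ℂ E] [SMul Aᵐᵒᵖ E] extends Inner A E where
  inner_add_right (x y z : E) : inner x (y + z) = inner x y + inner x z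
  inner_smul_complex (x y : E) (c : ℂ) : inner x (c • y) = c • inner x y
  inner_smul_right (x y : E) (a : A) : inner x (y <• a) = inner x y * a
  star_inner (x y : E) : star (inner x y) = inner y x
  inner_self_nonneg (x : E) : 0 ≤ inner x x
  inner_self_eq_zero (x : E) : inner x x = 0 → x = 0
  norm_eq (x : E) : ‖x‖ = √‖inner x x‖

/-- A positive semidefinite `A`-valued form on a complex vector space with an action of `A`. -/
structure PreHilbertForm (A E : Type*) [NonUnitalCStarAlgebra A] [PartialOrder A]
    [AddCommGroup E] [Module ℂ E] [SMul Aᵐᵒᵖ E] where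
  form : E →ₗ⋆[ℂ] E →ₗ[ℂ] A
  form_smul_right (x y : E) (a : A) : form x (y <• a) = form x y * a
  star_form (x y : E) : star (form x y) = form y x
  nonneg (x : E) : 0 ≤ form x x

namespace PreHilbertForm

variable {A E : Type*} [NonUnitalCStarAlgebra A] [PartialOrder A]
    [AddCommGroup E] [Module ℂ E] [SMul Aᵐᵒᵖ E] (F : PreHilbertForm A E)

theorem form_smul_left (x y : E) (a : A) : F.form (x <• a) y = star a * F.form x y := by
  rw [← F.star_form, F.form_smul_right, star_mul, F.star_form]

variable [StarOrderedRing A]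

/-- The Cauchy–Schwarz inequality. -/
theorem norm_form_sq_le (x y : E) : ‖F.form x y‖ ^ 2 ≤ ‖F.form x x‖ * ‖F.form y y‖ := by
  set a := F.form x y with ha
  have key : ∀ t : ℝ, 0 < t → (2 * t - t ^ 2 * ‖F.form x x‖) * ‖a‖ ^ 2 ≤ ‖F.form y y‖ := by
    intro t ht
    have hst : star a = F.form y x := F.star_form x y
    have h0 := F.nonneg ((x <• (t • a)) - y)
    have h1 : F.form ((x <• (t • a)) - y) ((x <• (t • a)) - y)
        = (t ^ 2) • (star a * F.form x x * a) - (2 * t) • (star a * a) + F.form y y := by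
      simp only [map_sub, LinearMap.sub_apply, F.form_smul_left, F.form_smul_right, ← ha, ← hst,
        star_smul, smul_mul_assoc, mul_smul_comm, star_trivial, mul_assoc]
      module
    have h2 : star a * F.form x x * a ≤ ‖F.form x x‖ • (star a * a) :=
      CStarAlgebra.star_left_conjugate_le_norm_smul (hb := F.star_form x x)
    rw [h1] at h0
    have h3 : (2 * t - t ^ 2 * ‖F.form x x‖) • (star a * a) ≤ F.form y y := by
      have h4 : (t ^ 2) • (star a * F.form x x * a)
          ≤ (t ^ 2) • (‖F.form x x‖ • (star a * a)) :=
        smul_le_smul_of_nonneg_left h2 (by positivity)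
      rw [← sub_nonneg] at h4 ⊢
      have := add_nonneg h0 h4
      convert this using 1
      module
    by_cases hs : 0 ≤ 2 * t - t ^ 2 * ‖F.form x x‖
    · have := CStarAlgebra.norm_le_norm_of_nonneg_of_le
        (smul_nonneg hs (star_mul_self_nonneg a)) h3
      rwa [norm_smul, Real.norm_of_nonneg hs, CStarRing.norm_star_mul_self, ← pow_two] at this
    · have : (2 * t - t ^ 2 * ‖F.form x x‖) * ‖a‖ ^ 2 ≤ 0 :=
        mul_nonpos_of_nonpos_of_nonneg (le_of_not_ge hs) (by positivity)
      exact this.trans (norm_nonneg _)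
  rcases (norm_nonneg (F.form x x)).eq_or_lt with h | h
  · rw [← h, zero_mul]
    by_contra! hc
    have hc0 : ‖a‖ ≠ 0 := by rintro h0; simp [h0] at hc
    have := key ((‖F.form y y‖ + 1) / (2 * ‖a‖ ^ 2)) (by positivity)
    rw [← h, mul_zero, sub_zero, show 2 * ((‖F.form y y‖ + 1) / (2 * ‖a‖ ^ 2)) * ‖a‖ ^ 2
      = ‖F.form y y‖ + 1 by field_simp] at this
    linarith
  · have := key (1 / ‖F.form x x‖) (by positivity)
    field_simp at this
    linarith

/-- The seminorm of a positive semidefinite form. -/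
def seminorm : Seminorm ℂ E :=
  Seminorm.of (fun x => √‖F.form x x‖)
    (fun x y => by
      apply Real.sqrt_le_iff.2 ⟨by positivity, ?_⟩
      have h1 : ‖F.form x y‖ ≤ √‖F.form x x‖ * √‖F.form y y‖ := by
        rw [← Real.sqrt_mul (norm_nonneg _)]
        exact Real.le_sqrt_of_sq_le (F.norm_form_sq_le x y)
      have h2 : ‖F.form y x‖ = ‖F.form x y‖ := by rw [← F.star_form x y, norm_star]
      have h3 : ‖F.form (x + y) (x + y)‖
          ≤ ‖F.form x x‖ + ‖F.form x y‖ + (‖F.form y x‖ + ‖F.form y y‖) := by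
        simp only [map_add, LinearMap.add_apply]
        refine (norm_add_le _ _).trans ?_
        have := norm_add_le (F.form x x) (F.form y x)
        have := norm_add_le (F.form x y) (F.form y y)
        linarith
      have h4 := Real.sq_sqrt (norm_nonneg (F.form x x))
      have h5 := Real.sq_sqrt (norm_nonneg (F.form y y))
      nlinarith)
    (fun c x => by
      simp only [LinearMap.map_smulₛₗ, LinearMap.smul_apply, norm_smul, RingHom.id_apply,
        RCLike.norm_conj]
      rw [← mul_assoc, Real.sqrt_mul (by positivity), Real.sqrt_mul_self (norm_nonneg _)])

theorem seminorm_apply (x : E) : F.seminorm x = √‖F.form x x‖ := rfl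

theorem norm_form_le (x y : E) : ‖F.form x y‖ ≤ F.seminorm x * F.seminorm y := by
  rw [seminorm_apply, seminorm_apply, ← Real.sqrt_mul (norm_nonneg _)]
  exact Real.le_sqrt_of_sq_le (F.norm_form_sq_le x y)

theorem seminorm_smul_le (x : E) (a : A) : F.seminorm (x <• a) ≤ ‖a‖ * F.seminorm x := by
  rw [seminorm_apply, seminorm_apply, F.form_smul_left, F.form_smul_right]
  apply Real.sqrt_le_iff.2 ⟨by positivity, ?_⟩
  rw [mul_pow, Real.sq_sqrt (norm_nonneg _)]
  calc ‖star a * (F.form x x * a)‖ ≤ ‖star a‖ * (‖F.form x x‖ * ‖a‖) :=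
        (norm_mul_le _ _).trans (by gcongr; exact norm_mul_le _ _)
    _ = ‖a‖ ^ 2 * ‖F.form x x‖ := by rw [norm_star]; ring

end PreHilbertForm

namespace HilbertCMod

variable {A E : Type*} [NonUnitalCStarAlgebra A] [PartialOrder A]
    [NormedAddCommGroup E] [NormedSpace ℂ E] [SMul Aᵐᵒᵖ E] [HilbertCMod A E]

variable (A E) in
/-- The inner product of a Hilbert C⋆-module as a positive form. -/
def toForm : PreHilbertForm A E where
  form := LinearMap.mk₂'ₛₗ (starRingEnd ℂ) (RingHom.id ℂ) (fun x y : E => inner A x y)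
    (fun x y z => by
      rw [← star_inner, inner_add_right, star_add, star_inner, star_inner])
    (fun c x y => by
      rw [← star_inner, inner_smul_complex, star_smul, star_inner]; rfl)
    (fun x y z => inner_add_right x y z)
    (fun c x y => inner_smul_complex x y c)
  form_smul_right := inner_smul_right
  star_form := star_inner
  nonneg := inner_self_nonneg

theorem toForm_apply (x y : E) : (toForm A E).form x y = inner A x y := rfl

theorem ext_inner {x y : E} (h : ∀ z : E, inner A z x = inner A z y) : x = y := by
  rw [← sub_eq_zero]
  apply inner_self_eq_zero (A := A)
  rw [← toForm_apply, map_sub, toForm_apply, toForm_apply, h, sub_self]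

variable [StarOrderedRing A]

theorem norm_inner_le (x y : E) : ‖(inner A x y : A)‖ ≤ ‖x‖ * ‖y‖ := by
  rw [norm_eq (A := A) x, norm_eq (A := A) y]
  exact (toForm A E).norm_form_le x y

theorem norm_smul_le' (x : E) (a : A) : ‖x <• a‖ ≤ ‖a‖ * ‖x‖ := by
  rw [norm_eq (A := A) x, norm_eq (A := A) (x <• a)]
  exact (toForm A E).seminorm_smul_le x a

end HilbertCMod

/-- A C⋆-algebra as a Hilbert C⋆-module over itself, with `⟪a, b⟫ = a⋆ b`. -/
instance HilbertCMod.self (A : Type*) [NonUnitalCStarAlgebra A] [PartialOrder A]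
    [StarOrderedRing A] : HilbertCMod A A where
  inner a b := star a * b
  inner_add_right a b c := mul_add _ _ _
  inner_smul_complex a b c := mul_smul_comm _ _ _
  inner_smul_right a b c := (mul_assoc _ _ _).symm
  star_inner a b := by simp
  inner_self_nonneg a := star_mul_self_nonneg a
  inner_self_eq_zero a h := CStarRing.star_mul_self_eq_zero_iff a |>.1 h
  norm_eq a := by rw [CStarRing.norm_star_mul_self, Real.sqrt_mul_self (norm_nonneg _)]

/-! ### The standard module -/

theorem summable_of_nonneg_of_le_cstar {ι A : Type*} [NonUnitalCStarAlgebra A] [PartialOrder A]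
    [StarOrderedRing A] {f g : ι → A} (h0 : ∀ n, 0 ≤ f n) (h : ∀ n, f n ≤ g n)
    (hg : Summable g) : Summable f := by
  rw [summable_iff_vanishing_norm] at hg ⊢
  intro ε hε
  obtain ⟨s, hs⟩ := hg ε hε
  refine ⟨s, fun t ht => lt_of_le_of_lt ?_ (hs t ht)⟩
  exact CStarAlgebra.norm_le_norm_of_nonneg_of_le (Finset.sum_nonneg fun i _ => h0 i)
    (Finset.sum_le_sum fun i _ => h i)

section Std

variable (A : Type*) [NonUnitalCStarAlgebra A] [PartialOrder A] [StarOrderedRing A]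

/-- The sequences `(aₙ)` in `A` for which `∑ aₙ⋆ aₙ` converges in norm. (For a series with positive
terms in a C⋆-algebra, convergence of the partial sums is the same as unconditional
convergence.) -/
def stdSubmodule : Submodule ℂ (ℕ → A) where
  carrier := {a | Summable fun n => star (a n) * a n}
  zero_mem' := by simp
  add_mem' {a b} ha hb := by
    refine summable_of_nonneg_of_le_cstar (fun n => star_mul_self_nonneg _) (fun n => ?_)
      ((Summable.add ha hb).const_smul (2 : ℝ))
    rw [← sub_nonneg]
    refine (star_mul_self_nonneg (a n - b n)).trans_eq ?_
    simp only [Pi.add_apply, star_add, star_sub, add_mul, mul_add, sub_mul, mul_sub]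
    module
  smul_mem' c a ha := by
    refine (Summable.const_smul (c * star c) ha).congr fun n => ?_
    simp only [Pi.smul_apply, star_smul, smul_mul_assoc, mul_smul_comm, smul_smul]

variable {A} in
theorem mem_stdSubmodule {a : ℕ → A} :
    a ∈ stdSubmodule A ↔ Summable fun n => star (a n) * a n := Iff.rfl

variable {A} in
theorem summable_star_mul {a b : ℕ → A} (ha : a ∈ stdSubmodule A) (hb : b ∈ stdSubmodule A) :
    Summable fun n => star (a n) * b n := by
  have h (c : ℂ) : Summable fun n => star ((a + c • b) n) * (a + c • b) n :=
    mem_stdSubmodule.1 (add_mem ha (Submodule.smul_mem _ c hb))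
  refine (((((h 1).sub (h (-1))).add ((h Complex.I).const_smul (-Complex.I))).add
    ((h (-Complex.I)).const_smul Complex.I)).const_smul (1 / 4 : ℂ)).congr fun n => ?_
  simp only [Pi.add_apply, Pi.smul_apply, star_add, star_smul, add_mul, mul_add, smul_mul_assoc,
    mul_smul_comm, smul_add, smul_sub, smul_smul, RCLike.star_def, map_one, map_neg,
    Complex.conj_I]
  have hI : Complex.I * Complex.I = -1 := Complex.I_mul_I
  match_scalars <;>
    first | ring1 | linear_combination (1 / 2 : ℂ) * hI | linear_combination (-1 / 2 : ℂ) * hI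

/-- The standard module `H_A` of square summable sequences in `A`. -/
def StdModule : Type _ := stdSubmodule A

namespace StdModule

variable {A}

instance : AddCommGroup (StdModule A) := inferInstanceAs (AddCommGroup (stdSubmodule A))
instance : Module ℂ (StdModule A) := inferInstanceAs (Module ℂ (stdSubmodule A))

instance : CoeFun (StdModule A) (fun _ => ℕ → A) := ⟨fun x => x.1⟩

@[ext] theorem ext {x y : StdModule A} (h : ∀ n, x n = y n) : x = y := Subtype.ext (funext h)

theorem add_apply (x y : StdModule A) (n : ℕ) : (x + y) n = x n + y n := rfl
theorem smul_apply (c : ℂ) (x : StdModule A) (n : ℕ) : (c • x) n = c • x n := rfl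

theorem summable (x y : StdModule A) : Summable fun n => star (x n) * y n :=
  summable_star_mul x.2 y.2

instance : SMul Aᵐᵒᵖ (StdModule A) where
  smul a x := ⟨fun n => x n * a.unop, by
    refine (((summable x x).mul_left (star a.unop)).mul_right a.unop).congr fun n => ?_
    simp only [star_mul, mul_assoc]⟩

theorem op_smul_apply (x : StdModule A) (a : A) (n : ℕ) : (x <• a) n = x n * a := rfl

variable (A) in
/-- The form `⟪x, y⟫ = ∑ xₙ⋆ yₙ` on the standard module. -/
def preForm : PreHilbertForm A (StdModule A) where
  form := LinearMap.mk₂'ₛₗ (starRingEnd ℂ) (RingHom.id ℂ)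
    (fun x y => ∑' n, star (x n) * y n)
    (fun x y z => by
      rw [← (summable x z).tsum_add (summable y z)]
      simp only [add_apply, star_add, add_mul])
    (fun c x y => by
      rw [← (summable x y).tsum_const_smul]
      simp only [smul_apply, star_smul, smul_mul_assoc]; rfl)
    (fun x y z => by
      rw [← (summable x y).tsum_add (summable x z)]
      simp only [add_apply, mul_add])
    (fun c x y => by
      rw [← (summable x y).tsum_const_smul]
      simp only [smul_apply, mul_smul_comm]; rfl)
  form_smul_right x y a := by
    simp only [LinearMap.mk₂'ₛₗ_apply, op_smul_apply, ← mul_assoc]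
    exact (summable x y).tsum_mul_right a
  star_form x y := by
    simp only [LinearMap.mk₂'ₛₗ_apply, tsum_star, star_mul, star_star]
  nonneg x := tsum_nonneg fun n => star_mul_self_nonneg _

theorem preForm_apply (x y : StdModule A) :
    (preForm A).form x y = ∑' n, star (x n) * y n := rfl

instance : Norm (StdModule A) := ⟨fun x => (preForm A).seminorm x⟩

theorem norm_def (x : StdModule A) : ‖x‖ = (preForm A).seminorm x := rfl

theorem norm_apply_le (x : StdModule A) (n : ℕ) : ‖x n‖ ≤ ‖x‖ := by
  rw [norm_def, PreHilbertForm.seminorm_apply]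
  apply Real.le_sqrt_of_sq_le
  rw [pow_two, ← CStarRing.norm_star_mul_self, preForm_apply]
  exact CStarAlgebra.norm_le_norm_of_nonneg_of_le (star_mul_self_nonneg _)
    ((summable x x).le_tsum n fun _ _ => star_mul_self_nonneg _)

theorem normCore : NormedSpace.Core ℂ (StdModule A) where
  norm_nonneg x := apply_nonneg (preForm A).seminorm x
  norm_smul c x := map_smul_eq_mul (preForm A).seminorm c x
  norm_triangle x y := map_add_le_add (preForm A).seminorm x y
  norm_eq_zero_iff x := by
    refine ⟨fun h => ?_, fun h => by rw [h]; exact map_zero (preForm A).seminorm⟩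
    ext n
    have := norm_apply_le x n
    rw [h, norm_le_zero_iff] at this
    exact this

instance : NormedAddCommGroup (StdModule A) := NormedAddCommGroup.ofCore normCore
instance : NormedSpace ℂ (StdModule A) := NormedSpace.ofCore normCore

instance : HilbertCMod A (StdModule A) where
  inner x y := ∑' n, star (x n) * y n
  inner_add_right x y z := map_add ((preForm A).form x) y z
  inner_smul_complex x y c := map_smul ((preForm A).form x) c y
  inner_smul_right := (preForm A).form_smul_right
  star_inner := (preForm A).star_form
  inner_self_nonneg := (preForm A).nonneg
  inner_self_eq_zero x h := by
    have h1 : ‖x‖ = 0 := by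
      rw [norm_def, PreHilbertForm.seminorm_apply, preForm_apply]
      rw [h, norm_zero, Real.sqrt_zero]
    exact norm_eq_zero.1 h1
  norm_eq x := rfl

end StdModule

end Std

/-! ### Adjointable operators -/

section Operators

/-- An adjointable operator between Hilbert C⋆-modules, together with its (unique) adjoint. -/
structure Adjointable (A E F : Type*) [NonUnitalCStarAlgebra A] [PartialOrder A]
    [NormedAddCommGroup E] [NormedSpace ℂ E] [SMul Aᵐᵒᵖ E] [HilbertCMod A E]
    [NormedAddCommGroup F] [NormedSpace ℂ F] [SMul Aᵐᵒᵖ F] [HilbertCMod A F] where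
  toCLM : E →L[ℂ] F
  adj : F →L[ℂ] E
  inner_adj (x : E) (y : F) : inner A (toCLM x) y = inner A x (adj y)

variable (A : Type*) {E F : Type*} [NonUnitalCStarAlgebra A] [PartialOrder A] [StarOrderedRing A]
    [NormedAddCommGroup E] [NormedSpace ℂ E] [SMul Aᵐᵒᵖ E] [HilbertCMod A E]
    [NormedAddCommGroup F] [NormedSpace ℂ F] [SMul Aᵐᵒᵖ F] [HilbertCMod A F]

/-- The operator `z ↦ x ⟪y, z⟫`. -/
def rankOne (x : F) (y : E) : E →L[ℂ] F :=
  LinearMap.mkContinuous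
    { toFun := fun z => x <• (inner A y z : A)
      map_add' := fun z w => HilbertCMod.ext_inner (A := A) fun v => by
        simp only [HilbertCMod.inner_smul_right, HilbertCMod.inner_add_right, mul_add]
      map_smul' := fun c z => HilbertCMod.ext_inner (A := A) fun v => by
        simp only [HilbertCMod.inner_smul_right, HilbertCMod.inner_smul_complex,
          mul_smul_comm, RingHom.id_apply] }
    (‖x‖ * ‖y‖) fun z => by
      calc ‖x <• (inner A y z : A)‖ ≤ ‖(inner A y z : A)‖ * ‖x‖ :=
            HilbertCMod.norm_smul_le' x _
        _ ≤ (‖y‖ * ‖z‖) * ‖x‖ := by gcongr; exact HilbertCMod.norm_inner_le y z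
        _ = ‖x‖ * ‖y‖ * ‖z‖ := by ring

/-- The compact operators `𝒦(E, F)`: the closed linear span of the operators `z ↦ x ⟪y, z⟫`. -/
def compactOperators (E F : Type*)
    [NormedAddCommGroup E] [NormedSpace ℂ E] [SMul Aᵐᵒᵖ E] [HilbertCMod A E]
    [NormedAddCommGroup F] [NormedSpace ℂ F] [SMul Aᵐᵒᵖ F] [HilbertCMod A F] :
    Submodule ℂ (E →L[ℂ] F) :=
  (Submodule.span ℂ {T | ∃ (x : F) (y : E), T = rankOne A x y}).topologicalClosure

variable {A}

/-- The sequence with `a` in position `i` and zeroes elsewhere. -/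
def StdModule.single (i : ℕ) (a : A) : StdModule A :=
  ⟨Pi.single i a, summable_of_ne_finset_zero (s := {i}) fun n hn => by
    have hn : n ≠ i := by simpa using hn
    simp [hn]⟩

theorem StdModule.single_apply (i : ℕ) (a : A) (n : ℕ) :
    StdModule.single i a n = if n = i then a else 0 := by
  simp [StdModule.single, Pi.single_apply]

theorem StdModule.norm_single (i : ℕ) (a : A) : ‖StdModule.single i a‖ = ‖a‖ := by
  rw [StdModule.norm_def, PreHilbertForm.seminorm_apply, StdModule.preForm_apply,
    tsum_eq_single i (fun n hn => by simp [StdModule.single_apply, hn])]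
  simp only [StdModule.single_apply, if_true]
  rw [CStarRing.norm_star_mul_self, Real.sqrt_mul_self (norm_nonneg _)]

/-- The operator on the standard module given by the matrix with the single entry `a` in position
`(i, j)`, that is `x ↦ eᵢ (a xⱼ)`. -/
def matrixUnit (i j : ℕ) (a : A) : StdModule A →L[ℂ] StdModule A :=
  LinearMap.mkContinuous
    { toFun := fun x => StdModule.single i (a * x j)
      map_add' := fun x y => by
        ext n
        simp only [StdModule.add_apply, StdModule.single_apply, mul_add]
        split_ifs <;> simp
      map_smul' := fun c x => by
        ext n
        simp only [StdModule.smul_apply, StdModule.single_apply, mul_smul_comm, RingHom.id_apply]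
        split_ifs <;> simp }
    ‖a‖ fun x => by
      refine (StdModule.norm_single i _).trans_le ((norm_mul_le _ _).trans ?_)
      gcongr
      exact StdModule.norm_apply_le x j

end Operators

/-! ### Interior tensor products -/

section Tensor

variable {A C : Type*} [NonUnitalCStarAlgebra A] [PartialOrder A] [StarOrderedRing A]
    [NonUnitalCStarAlgebra C] [PartialOrder C] [StarOrderedRing C]

theorem exists_sub_nonneg {D : Type*} [NonUnitalCStarAlgebra D] [PartialOrder D]
    [StarOrderedRing D] (m : D) (hm : IsSelfAdjoint m) :
    ∃ p n : D, 0 ≤ p ∧ 0 ≤ n ∧ n * p = 0 ∧ p - n = m :=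
  ⟨m⁺, m⁻, CFC.posPart_nonneg m, CFC.negPart_nonneg m, CFC.negPart_mul_posPart m,
    CFC.posPart_sub_negPart m hm⟩

theorem exists_eq_star_mul_self {D : Type*} [NonUnitalCStarAlgebra D] [PartialOrder D]
    [StarOrderedRing D] (d : D) (hd : 0 ≤ d) : ∃ s, d = star s * s :=
  CStarAlgebra.nonneg_iff_eq_star_mul_self.1 hd

/-- A Gram matrix in a Hilbert C⋆-module is positive. -/
theorem gram_nonneg {ι X : Type*} [Fintype ι] [DecidableEq ι]
    [NormedAddCommGroup X] [NormedSpace ℂ X] [SMul Aᵐᵒᵖ X] [HilbertCMod A X] (ξ : ι → X) :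
    0 ≤ (CStarMatrix.ofMatrix (Matrix.of fun i j => (inner A (ξ i) (ξ j) : A)) :
      CStarMatrix ι ι A) := by
  set M : CStarMatrix ι ι A := CStarMatrix.ofMatrix (Matrix.of fun i j => inner A (ξ i) (ξ j))
    with hM
  have hsa : IsSelfAdjoint M := by
    ext i j
    exact HilbertCMod.star_inner (ξ j) (ξ i)
  obtain ⟨R, T, hR0, hT0, hTR, hRT⟩ := exists_sub_nonneg M hsa
  have hTsa : star T = T := (IsSelfAdjoint.of_nonneg hT0).star_eq
  have hM' : T * M * T = -(T * T * T) := by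
    rw [← hRT, mul_sub, hTR, zero_sub, neg_mul]
  have hT3 : 0 ≤ T * T * T := by
    have := star_left_conjugate_nonneg hT0 T
    rwa [hTsa] at this
  obtain ⟨S, hS⟩ := exists_eq_star_mul_self _ hT3
  have hdiag (k : ι) : (T * M * T) k k
      = inner A (∑ i, ξ i <• (T i k)) (∑ i, ξ i <• (T i k)) := by
    rw [← HilbertCMod.toForm_apply]
    simp only [map_sum, LinearMap.sum_apply, PreHilbertForm.form_smul_left,
      PreHilbertForm.form_smul_right, HilbertCMod.toForm_apply]
    rw [CStarMatrix.mul_apply]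
    simp only [CStarMatrix.mul_apply, Finset.sum_mul]
    refine Finset.sum_congr rfl fun i _ => Finset.sum_congr rfl fun j _ => ?_
    have h1 : T k j = star (T j k) := by
      conv_lhs => rw [← hTsa]
      rfl
    rw [h1]
    rfl
  have hS0 : S = 0 := by
    ext i k
    have h1 : 0 ≤ (T * M * T) k k := by
      rw [hdiag]; exact HilbertCMod.inner_self_nonneg _
    rw [hM', hS] at h1
    have h2 : ∑ i, star (S i k) * S i k = (star S * S) k k := by
      rw [CStarMatrix.mul_apply]; rfl
    have h3 : ∑ i, star (S i k) * S i k = 0 := by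
      refine le_antisymm ?_ (Finset.sum_nonneg fun i _ => star_mul_self_nonneg _)
      rw [h2]
      exact neg_nonneg.1 h1
    have h4 := (Finset.sum_eq_zero_iff_of_nonneg fun i _ => star_mul_self_nonneg (S i k)).1 h3 i
      (Finset.mem_univ i)
    exact (CStarRing.star_mul_self_eq_zero_iff _).1 h4
  rw [hS0, mul_zero] at hS
  have hT2 : T * T = 0 := by
    rw [← CStarRing.star_mul_self_eq_zero_iff, star_mul, hTsa, ← mul_assoc, hS, zero_mul]
  have hT : T = 0 := by
    rw [← CStarRing.star_mul_self_eq_zero_iff, hTsa, hT2]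
  rw [hT, sub_zero] at hRT
  rwa [← hRT]

theorem gram_form_nonneg {ι X : Type*} [Fintype ι] [DecidableEq ι]
    [NormedAddCommGroup X] [NormedSpace ℂ X] [SMul Aᵐᵒᵖ X] [HilbertCMod A X]
    (φ : A →⋆ₙₐ[ℂ] C) (ξ : ι → X) (ω : ι → C) :
    0 ≤ ∑ i, ∑ j, star (ω i) * φ (inner A (ξ i) (ξ j)) * ω j := by
  obtain ⟨S, hS⟩ := exists_eq_star_mul_self _ (gram_nonneg (A := A) ξ)
  have h1 (i j : ι) : (inner A (ξ i) (ξ j) : A) = ∑ k, star (S k i) * S k j := by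
    have := congrFun (congrFun hS i) j
    rw [CStarMatrix.mul_apply] at this
    exact this
  have h2 : ∑ i, ∑ j, star (ω i) * φ (inner A (ξ i) (ξ j)) * ω j
      = ∑ k, star (∑ i, φ (S k i) * ω i) * ∑ j, φ (S k j) * ω j := by
    simp only [h1, map_sum, map_mul, map_star, Finset.mul_sum, Finset.sum_mul, star_sum, star_mul]
    rw [Finset.sum_comm' (t' := Finset.univ) (s' := fun _ => Finset.univ) (by simp)]
    conv_rhs => rw [Finset.sum_comm]
    refine Finset.sum_congr rfl fun y _ => ?_
    conv_rhs => rw [Finset.sum_comm]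
    simp only [mul_assoc]
  rw [h2]
  exact Finset.sum_nonneg fun k _ => star_mul_self_nonneg _

variable (X : Type*) [NormedAddCommGroup X] [NormedSpace ℂ X] [SMul Aᵐᵒᵖ X] [HilbertCMod A X]

/-- The algebraic tensor product of `X` and `C`, to be equipped with the form
`⟪ξ ⊗ ω, η ⊗ θ⟫ = ω⋆ φ(⟪ξ, η⟫) θ`. -/
def PreTensor (_φ : A →⋆ₙₐ[ℂ] C) : Type _ := X ⊗[ℂ] C

namespace PreTensor

variable {X} (φ : A →⋆ₙₐ[ℂ] C)

instance : AddCommGroup (PreTensor X φ) := inferInstanceAs (AddCommGroup (X ⊗[ℂ] C))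
instance : Module ℂ (PreTensor X φ) := inferInstanceAs (Module ℂ (X ⊗[ℂ] C))

/-- The elementary tensor `ξ ⊗ ω`. -/
def tmul (ξ : X) (ω : C) : PreTensor X φ := TensorProduct.tmul ℂ ξ ω

/-- The right action `(ξ ⊗ ω) c = ξ ⊗ (ω c)`. -/
instance : SMul Cᵐᵒᵖ (PreTensor X φ) where
  smul c := TensorProduct.map (LinearMap.id : X →ₗ[ℂ] X) (LinearMap.mulRight ℂ c.unop)

theorem tmul_smul (ξ : X) (ω c : C) : tmul φ ξ ω <• c = tmul φ ξ (ω * c) := rfl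

theorem add_op_smul (x y : PreTensor X φ) (c : C) : (x + y) <• c = x <• c + y <• c :=
  map_add (TensorProduct.map (LinearMap.id : X →ₗ[ℂ] X) (LinearMap.mulRight ℂ c)) x y

theorem zero_op_smul (c : C) : (0 : PreTensor X φ) <• c = 0 :=
  map_zero (TensorProduct.map (LinearMap.id : X →ₗ[ℂ] X) (LinearMap.mulRight ℂ c))

/-- The map `T_ξ⋆ : η ⊗ θ ↦ φ(⟪ξ, η⟫) θ`. -/
def contract (ξ : X) : PreTensor X φ →ₗ[ℂ] C :=
  TensorProduct.lift (LinearMap.mk₂ ℂ (fun η θ => φ (inner A ξ η) * θ)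
    (fun η η' θ => by rw [HilbertCMod.inner_add_right, map_add, add_mul])
    (fun c η θ => by rw [HilbertCMod.inner_smul_complex, map_smul, smul_mul_assoc])
    (fun η θ θ' => mul_add _ _ _)
    (fun c η θ => mul_smul_comm _ _ _))

theorem contract_tmul (ξ η : X) (θ : C) :
    contract φ ξ (tmul φ η θ) = φ (inner A ξ η) * θ := rfl

theorem contract_add (ξ ξ' : X) : contract φ (ξ + ξ') = contract φ ξ + contract φ ξ' := by
  refine TensorProduct.ext' fun η θ => ?_
  change contract φ (ξ + ξ') (tmul φ η θ) = contract φ ξ (tmul φ η θ) + contract φ ξ' (tmul φ η θ)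
  simp only [contract_tmul, ← add_mul, ← map_add]
  rw [← HilbertCMod.star_inner, HilbertCMod.inner_add_right, star_add, HilbertCMod.star_inner,
    HilbertCMod.star_inner]

theorem contract_smul (c : ℂ) (ξ : X) :
    contract φ (c • ξ) = (starRingEnd ℂ c) • contract φ ξ := by
  refine TensorProduct.ext' fun η θ => ?_
  change contract φ (c • ξ) (tmul φ η θ) = (starRingEnd ℂ c) • contract φ ξ (tmul φ η θ)
  simp only [contract_tmul]
  rw [← HilbertCMod.star_inner, HilbertCMod.inner_smul_complex, star_smul, HilbertCMod.star_inner,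
    map_smul, smul_mul_assoc]
  rfl

/-- The sesquilinear map determined by `(ξ ⊗ ω, η ⊗ θ) ↦ ω⋆ φ(⟪ξ, η⟫) θ`. -/
def sesq : PreTensor X φ →ₗ⋆[ℂ] PreTensor X φ →ₗ[ℂ] C :=
  TensorProduct.lift (LinearMap.mk₂'ₛₗ (starRingEnd ℂ) (starRingEnd ℂ)
    (fun (ξ : X) (ω : C) => LinearMap.mulLeft ℂ (star ω) ∘ₗ contract φ ξ)
    (fun ξ ξ' ω => by rw [contract_add, LinearMap.comp_add])
    (fun c ξ ω => by rw [contract_smul, LinearMap.comp_smul])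
    (fun ξ ω ω' => by ext z; simp [add_mul])
    (fun c ξ ω => by ext z; simp [smul_mul_assoc]))

theorem sesq_tmul_left (ξ : X) (ω : C) (z : PreTensor X φ) :
    sesq φ (tmul φ ξ ω) z = star ω * contract φ ξ z := rfl

theorem sesq_tmul (ξ η : X) (ω θ : C) :
    sesq φ (tmul φ ξ ω) (tmul φ η θ) = star ω * (φ (inner A ξ η) * θ) := rfl

theorem induction_on {p : PreTensor X φ → Prop} (z : PreTensor X φ) (zero : p 0)
    (tmul : ∀ ξ ω, p (tmul φ ξ ω)) (add : ∀ x y, p x → p y → p (x + y)) : p z :=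
  TensorProduct.induction_on z zero tmul add

theorem exists_sum (z : PreTensor X φ) :
    ∃ (n : ℕ) (ξ : Fin n → X) (ω : Fin n → C), z = ∑ i, tmul φ (ξ i) (ω i) := by
  induction z using induction_on with
  | zero => exact ⟨0, Fin.elim0, Fin.elim0, by simp⟩
  | tmul ξ ω => exact ⟨1, fun _ => ξ, fun _ => ω, by simp⟩
  | add x y hx hy =>
    obtain ⟨n, ξ, ω, rfl⟩ := hx
    obtain ⟨m, η, θ, rfl⟩ := hy
    exact ⟨n + m, Fin.append ξ η, Fin.append ω θ, by simp [Fin.sum_univ_add]⟩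

/-- The positive form on the algebraic tensor product. -/
def preForm : PreHilbertForm C (PreTensor X φ) where
  form := sesq φ
  form_smul_right x y c := by
    induction x using induction_on with
    | zero => simp
    | add x x' hx hx' => simp only [map_add, LinearMap.add_apply, hx, hx', add_mul]
    | tmul ξ ω =>
      induction y using induction_on with
      | zero => simp [zero_op_smul]
      | add y y' hy hy' => simp only [add_op_smul, map_add, hy, hy', add_mul]
      | tmul η θ => simp only [tmul_smul, sesq_tmul, mul_assoc]
  star_form x y := by
    induction x using induction_on with
    | zero => simp
    | add x x' hx hx' => simp only [map_add, LinearMap.add_apply, star_add, hx, hx']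
    | tmul ξ ω =>
      induction y using induction_on with
      | zero => simp
      | add y y' hy hy' => simp only [LinearMap.add_apply, map_add, star_add, hy, hy']
      | tmul η θ =>
        simp only [sesq_tmul, star_mul, star_star, ← map_star, HilbertCMod.star_inner, mul_assoc]
  nonneg x := by
    obtain ⟨n, ξ, ω, rfl⟩ := exists_sum φ x
    refine (gram_form_nonneg φ ξ ω).trans_eq ?_
    simp only [map_sum, LinearMap.sum_apply, sesq_tmul, mul_assoc]
    rw [Finset.sum_comm]

instance : SeminormedAddCommGroup (PreTensor X φ) :=
  (preForm φ).seminorm.toSeminormedAddCommGroup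

theorem norm_def (z : PreTensor X φ) : ‖z‖ = (preForm φ).seminorm z := rfl

instance : NormedSpace ℂ (PreTensor X φ) where
  norm_smul_le c z := (map_smul_eq_mul (preForm φ).seminorm c z).le

theorem norm_sesq_le (x y : PreTensor X φ) : ‖sesq φ x y‖ ≤ ‖x‖ * ‖y‖ :=
  (preForm φ).norm_form_le x y

theorem norm_op_smul_le (x : PreTensor X φ) (c : C) : ‖x <• c‖ ≤ ‖c‖ * ‖x‖ :=
  (preForm φ).seminorm_smul_le x c

theorem norm_tmul_le (ξ : X) (ω : C) : ‖tmul φ ξ ω‖ ≤ ‖ξ‖ * ‖ω‖ := by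
  have h : (preForm φ).form (tmul φ ξ ω) (tmul φ ξ ω) = star ω * (φ (inner A ξ ξ) * ω) := rfl
  rw [norm_def, PreHilbertForm.seminorm_apply, h]
  refine Real.sqrt_le_iff.2 ⟨by positivity, ?_⟩
  calc ‖star ω * (φ (inner A ξ ξ) * ω)‖ ≤ ‖star ω‖ * (‖φ (inner A ξ ξ)‖ * ‖ω‖) :=
        (norm_mul_le _ _).trans (by gcongr; exact norm_mul_le _ _)
    _ ≤ ‖ω‖ * ((‖ξ‖ * ‖ξ‖) * ‖ω‖) := by
        rw [norm_star]
        gcongr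
        exact (NonUnitalStarAlgHom.norm_apply_le φ _).trans (HilbertCMod.norm_inner_le ξ ξ)
    _ = (‖ξ‖ * ‖ω‖) ^ 2 := by ring

theorem norm_contract_le (ξ : X) (z : PreTensor X φ) : ‖contract φ ξ z‖ ≤ ‖ξ‖ * ‖z‖ := by
  set b := contract φ ξ z with hb
  have h1 : ‖b‖ * ‖b‖ ≤ (‖ξ‖ * ‖b‖) * ‖z‖ := by
    rw [← CStarRing.norm_star_mul_self, hb, ← sesq_tmul_left, ← hb]
    exact (norm_sesq_le φ _ _).trans (by gcongr; exact norm_tmul_le φ ξ b)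
  rcases (norm_nonneg b).eq_or_lt with h | h
  · rw [← h]; positivity
  · refine le_of_mul_le_mul_right ?_ h
    linarith

end PreTensor

/-- The interior tensor product `X ⊗̂_A C` of the Hilbert `A`-module `X` with the C⋆-algebra `C`,
on which `A` acts from the left through `φ`: the Hausdorff completion of the algebraic tensor
product with respect to the form `⟪ξ ⊗ ω, η ⊗ θ⟫ = ω⋆ φ(⟪ξ, η⟫) θ`. -/
def InteriorTensor (φ : A →⋆ₙₐ[ℂ] C) : Type _ := UniformSpace.Completion (PreTensor X φ)

namespace InteriorTensor

open UniformSpace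

variable {X} (φ : A →⋆ₙₐ[ℂ] C)

instance : NormedAddCommGroup (InteriorTensor X φ) :=
  inferInstanceAs (NormedAddCommGroup (Completion (PreTensor X φ)))
instance : NormedSpace ℂ (InteriorTensor X φ) :=
  inferInstanceAs (NormedSpace ℂ (Completion (PreTensor X φ)))
instance : CompleteSpace (InteriorTensor X φ) :=
  inferInstanceAs (CompleteSpace (Completion (PreTensor X φ)))

/-- The canonical map from the algebraic tensor product. -/
def ι : PreTensor X φ →L[ℂ] InteriorTensor X φ := Completion.toComplL

theorem denseRange_ι : DenseRange (ι (X := X) φ) := Completion.denseRange_coe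

theorem norm_ι (z : PreTensor X φ) : ‖ι φ z‖ = ‖z‖ := Completion.norm_coe z

theorem isUniformInducing_ι : IsUniformInducing (ι (X := X) φ) :=
  Completion.isUniformInducing_coe _

/-- The elementary tensor `ξ ⊗ ω`. -/
def tmul (ξ : X) (ω : C) : InteriorTensor X φ := ι φ (PreTensor.tmul φ ξ ω)

/-- The operator `z ↦ z c` on the algebraic tensor product. -/
def actPre (c : C) : PreTensor X φ →L[ℂ] PreTensor X φ :=
  LinearMap.mkContinuous
    (TensorProduct.map (LinearMap.id : X →ₗ[ℂ] X) (LinearMap.mulRight ℂ c)) ‖c‖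
    (fun z => PreTensor.norm_op_smul_le φ z c)

/-- The right action of `C`, the continuous extension of `(ξ ⊗ ω) c = ξ ⊗ (ω c)`. -/
instance : SMul Cᵐᵒᵖ (InteriorTensor X φ) where
  smul c := ((ι φ).comp (actPre φ c.unop)).extend (ι φ)

theorem ι_op_smul (z : PreTensor X φ) (c : C) : ι φ z <• c = ι φ (z <• c) :=
  ((ι φ).comp (actPre φ c)).extend_eq (denseRange_ι φ) (isUniformInducing_ι φ) z

theorem continuous_op_smul (c : C) : Continuous fun z : InteriorTensor X φ => z <• c :=
  (((ι φ).comp (actPre φ c)).extend (ι φ)).continuous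

/-- The form on the algebraic tensor product as a bounded sesquilinear map. -/
def sesqPre : PreTensor X φ →L⋆[ℂ] PreTensor X φ →L[ℂ] C :=
  LinearMap.mkContinuous₂ (PreTensor.sesq φ) 1 fun x y => by
    rw [one_mul]; exact PreTensor.norm_sesq_le φ x y

/-- The continuous extension of the form to the completion, one variable at a time. -/
def sesqL : InteriorTensor X φ →L⋆[ℂ] InteriorTensor X φ →L[ℂ] C :=
  ((((sesqPre φ).extend (ι φ)).flip).extend (ι φ)).flip

/-- The inner product, the continuous extension of the form on the algebraic tensor product. -/
instance : Inner C (InteriorTensor X φ) where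
  inner x y := sesqL φ x y

theorem inner_def (x y : InteriorTensor X φ) : (inner C x y : C) = sesqL φ x y := rfl

theorem inner_ι (x y : PreTensor X φ) : (inner C (ι φ x) (ι φ y) : C) = PreTensor.sesq φ x y := by
  rw [inner_def, sesqL, ContinuousLinearMap.flip_apply,
    ContinuousLinearMap.extend_eq _ (denseRange_ι φ) (isUniformInducing_ι φ),
    ContinuousLinearMap.flip_apply,
    ContinuousLinearMap.extend_eq _ (denseRange_ι φ) (isUniformInducing_ι φ)]
  rfl

theorem continuous_inner :
    Continuous fun p : InteriorTensor X φ × InteriorTensor X φ => (inner C p.1 p.2 : C) := by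
  simp only [inner_def]
  exact ((sesqL φ).continuous.comp continuous_fst).clm_apply continuous_snd

@[elab_as_elim]
theorem induction_ι {p : InteriorTensor X φ → Prop} (z : InteriorTensor X φ)
    (hc : IsClosed {z | p z}) (h : ∀ z, p (ι φ z)) : p z :=
  Completion.induction_on z hc h

theorem norm_eq' (z : InteriorTensor X φ) : ‖z‖ = √‖(inner C z z : C)‖ := by
  induction z using induction_ι with
  | hc =>
    have := continuous_inner (X := X) φ
    exact isClosed_eq continuous_norm
      ((this.comp (continuous_id.prodMk continuous_id)).norm.sqrt)
  | h z => rw [norm_ι, inner_ι]; rfl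

instance : HilbertCMod C (InteriorTensor X φ) where
  inner_add_right x y z := by simp only [inner_def, map_add]
  inner_smul_complex x y c := by simp only [inner_def, map_smul]
  inner_smul_right x y c := by
    have hc := continuous_inner (X := X) φ
    have hs := continuous_op_smul (X := X) φ c
    induction x using induction_ι with
    | hc =>
      exact isClosed_eq (hc.comp (continuous_id.prodMk continuous_const))
        ((hc.comp (continuous_id.prodMk continuous_const)).mul continuous_const)
    | h x =>
      induction y using induction_ι with
      | hc =>
        exact isClosed_eq (hc.comp (continuous_const.prodMk hs))
          ((hc.comp (continuous_const.prodMk continuous_id)).mul continuous_const)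
      | h y =>
        rw [ι_op_smul, inner_ι, inner_ι]
        exact (PreTensor.preForm φ).form_smul_right x y c
  star_inner x y := by
    have hc := continuous_inner (X := X) φ
    induction x using induction_ι with
    | hc =>
      exact isClosed_eq (hc.comp (continuous_id.prodMk continuous_const)).star
        (hc.comp (continuous_const.prodMk continuous_id))
    | h x =>
      induction y using induction_ι with
      | hc =>
        exact isClosed_eq (hc.comp (continuous_const.prodMk continuous_id)).star
          (hc.comp (continuous_id.prodMk continuous_const))
      | h y =>
        rw [inner_ι, inner_ι]
        exact (PreTensor.preForm φ).star_form x y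
  inner_self_nonneg x := by
    have hc := continuous_inner (X := X) φ
    induction x using induction_ι with
    | hc =>
      exact CStarAlgebra.isClosed_nonneg.preimage (hc.comp (continuous_id.prodMk continuous_id))
    | h x =>
      rw [inner_ι]
      exact (PreTensor.preForm φ).nonneg x
  inner_self_eq_zero x h := by
    have := norm_eq' φ x
    rw [h, norm_zero, Real.sqrt_zero] at this
    exact norm_eq_zero.1 this
  norm_eq := norm_eq' φ

/-- The adjointable operator `T_ξ : C → X ⊗̂_A C`, `ω ↦ ξ ⊗ ω`, whose adjoint is the continuous
extension of `η ⊗ ω ↦ φ(⟪ξ, η⟫) ω`. -/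
def creation (ξ : X) : Adjointable C C (InteriorTensor X φ) where
  toCLM := (ι φ).comp (LinearMap.mkContinuous (TensorProduct.mk ℂ X C ξ) ‖ξ‖
    fun ω => PreTensor.norm_tmul_le φ ξ ω)
  adj := ((PreTensor.contract φ ξ).mkContinuous ‖ξ‖ (PreTensor.norm_contract_le φ ξ)).extend (ι φ)
  inner_adj ω z := by
    have hc := continuous_inner (X := X) φ
    induction z using induction_ι with
    | hc =>
      exact isClosed_eq (hc.comp (continuous_const.prodMk continuous_id))
        (continuous_const.mul (ContinuousLinearMap.continuous _))
    | h z =>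
      rw [ContinuousLinearMap.extend_eq _ (denseRange_ι φ) (isUniformInducing_ι φ)]
      exact inner_ι φ (PreTensor.tmul φ ξ ω) z

theorem creation_apply (ξ : X) (ω : C) : (creation φ ξ).toCLM ω = tmul φ ξ ω := rfl

theorem creation_adj_tmul (ξ η : X) (ω : C) :
    (creation φ ξ).adj (tmul φ η ω) = φ (inner A ξ η) * ω :=
  ContinuousLinearMap.extend_eq _ (denseRange_ι φ) (isUniformInducing_ι φ) _

end InteriorTensor

end Tensor

/-! ### Closed derivations and differentiable structure -/

/-- A densely defined closed derivation `δ : 𝒜 → B` relative to `ρ : A → B`, compatible with the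
adjoint, on a dense ⋆-subalgebra `𝒜 = dom` of `A`. -/
structure ClosedStarDerivation {A B : Type*} [NonUnitalCStarAlgebra A] [NonUnitalCStarAlgebra B]
    (ρ : A →⋆ₙₐ[ℂ] B) where
  dom : NonUnitalStarSubalgebra ℂ A
  dense_dom : Dense (dom : Set A)
  δ : dom →ₗ[ℂ] B
  map_mul (a b : dom) : δ (a * b) = δ a * ρ b + ρ a * δ b
  map_star (a : dom) : δ (star a) = -star (δ a)
  closed (u : ℕ → dom) (b : B) : Tendsto (fun n => (u n : A)) atTop (𝓝 0) →
    Tendsto (fun n => δ (u n)) atTop (𝓝 b) → b = 0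

namespace ClosedStarDerivation

variable {A B : Type*} [NonUnitalCStarAlgebra A] [PartialOrder A] [StarOrderedRing A]
    [NonUnitalCStarAlgebra B] [PartialOrder B] [StarOrderedRing B]
    {ρ : A →⋆ₙₐ[ℂ] B} (D : ClosedStarDerivation ρ)

/-- The derivation as a partially defined operator from `A` to `B`. -/
def pmap : A →ₗ.[ℂ] B where
  domain := D.dom.toNonUnitalSubalgebra.toSubmodule
  toFun := D.δ

theorem isClosable_pmap : D.pmap.IsClosable := by
  refine ⟨D.pmap.graph.topologicalClosure.toLinearPMap, ?_⟩
  rw [Submodule.toLinearPMap_graph_eq]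
  rintro ⟨a, b⟩ hx (h0 : a = 0)
  subst h0
  obtain ⟨u, hu, hlim⟩ := mem_closure_iff_seq_limit.1 hx
  have h (n : ℕ) : ∃ v : D.dom, ((v : A), D.δ v) = u n := by
    obtain ⟨v, hv⟩ := (LinearPMap.mem_graph_iff' _).1 (hu n)
    exact ⟨v, hv⟩
  choose v hv using h
  have h1 : u = fun n => ((v n : A), D.δ (v n)) := funext fun n => (hv n).symm
  rw [h1] at hlim
  exact D.closed v b ((continuous_fst.tendsto _).comp hlim) ((continuous_snd.tendsto _).comp hlim)

/-- The extension of `δ` to the completion `A_δ` of `𝒜` in the norm `‖a‖ + ‖δ(a)‖`. Since `δ` is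
closed this completion is a subspace of `A`, namely the domain of the closure of `δ`. -/
def ext : A →ₗ.[ℂ] B := D.pmap.closure

/-- The subspace `A_δ` of `A`. -/
def diffAlg : Submodule ℂ A := D.ext.domain

/-- The extended derivation `δ : A_δ → B`. -/
def dExt : D.diffAlg →ₗ[ℂ] B := D.ext.toFun

theorem dom_le : ∀ a ∈ D.dom, a ∈ D.diffAlg := fun _ ha => D.pmap.le_closure.1 ha

/-- The smallest C⋆-subalgebra of `B` that contains `ρ(a₀)` and `δ(a₁)` for all `a₀, a₁ ∈ A_δ`. -/
def formAlg : NonUnitalStarSubalgebra ℂ B :=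
  (NonUnitalStarAlgebra.adjoin ℂ
    ({b | ∃ a ∈ D.diffAlg, b = ρ a} ∪ Set.range D.dExt)).topologicalClosure

theorem isClosed_formAlg : IsClosed (D.formAlg : Set B) :=
  NonUnitalStarSubalgebra.isClosed_topologicalClosure _

/-- The C⋆-algebra `Ω_δ(A)` of continuous forms. -/
def Forms : Type _ := D.formAlg

instance : NonUnitalCStarAlgebra D.Forms :=
  NonUnitalStarSubalgebra.nonUnitalCStarAlgebra D.formAlg (h_closed := D.isClosed_formAlg)
instance : PartialOrder D.Forms := CStarAlgebra.spectralOrder D.Forms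
instance : StarOrderedRing D.Forms := CStarAlgebra.spectralOrderedRing D.Forms

/-- The inclusion of `Ω_δ(A)` in `B`. -/
def incl : D.Forms →⋆ₙₐ[ℂ] B := NonUnitalStarSubalgebraClass.subtype D.formAlg

theorem norm_incl (ω : D.Forms) : ‖D.incl ω‖ = ‖ω‖ := rfl

theorem rho_mem (a : A) : ρ a ∈ D.formAlg := by
  have h1 : IsClosed {a : A | ρ a ∈ D.formAlg} :=
    D.isClosed_formAlg.preimage (map_continuous ρ)
  have h2 : (D.dom : Set A) ⊆ {a : A | ρ a ∈ D.formAlg} := fun a ha =>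
    NonUnitalStarSubalgebra.le_topologicalClosure _
      (NonUnitalStarAlgebra.subset_adjoin ℂ _ (Or.inl ⟨a, D.dom_le a ha, rfl⟩))
  have h3 := h1.closure_subset_iff.2 h2
  rw [D.dense_dom.closure_eq] at h3
  exact h3 (Set.mem_univ a)

theorem dExt_mem (a : D.diffAlg) : D.dExt a ∈ D.formAlg :=
  NonUnitalStarSubalgebra.le_topologicalClosure _
    (NonUnitalStarAlgebra.subset_adjoin ℂ _ (Or.inr ⟨a, rfl⟩))

/-- The ⋆-homomorphism `ρ` with values in `Ω_δ(A)`; `A` acts on `Ω_δ(A)` by `ω ↦ ρ(a) ω`. -/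
def rho : A →⋆ₙₐ[ℂ] D.Forms := NonUnitalStarAlgHom.codRestrict ρ D.formAlg D.rho_mem

/-- The derivation `δ : A_δ → Ω_δ(A)`. -/
def d : D.diffAlg →ₗ[ℂ] D.Forms :=
  LinearMap.codRestrict D.formAlg.toNonUnitalSubalgebra.toSubmodule D.dExt D.dExt_mem

/-- The standard module `H_{A_δ}`: the sequences `(aₙ) ∈ H_A` in `A_δ` with `(δ(aₙ)) ∈ H_B`. -/
def diffStd : Submodule ℂ (StdModule A) where
  carrier := {x | ∃ h : ∀ n, x n ∈ D.diffAlg, (fun n => D.dExt ⟨x n, h n⟩) ∈ stdSubmodule B}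
  zero_mem' := by
    refine ⟨fun n => zero_mem _, ?_⟩
    have : (fun n => D.dExt ⟨(0 : StdModule A) n, zero_mem _⟩) = 0 :=
      funext fun n => map_zero D.dExt
    rw [this]
    exact zero_mem _
  add_mem' {x y} := by
    rintro ⟨hx, hx'⟩ ⟨hy, hy'⟩
    refine ⟨fun n => add_mem (hx n) (hy n), ?_⟩
    convert add_mem hx' hy' using 1
    exact funext fun n => map_add D.dExt ⟨x n, hx n⟩ ⟨y n, hy n⟩
  smul_mem' c x := by
    rintro ⟨hx, hx'⟩
    refine ⟨fun n => Submodule.smul_mem _ c (hx n), ?_⟩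
    convert Submodule.smul_mem _ c hx' using 1
    exact funext fun n => map_smul D.dExt c ⟨x n, hx n⟩

theorem mem_stdSubmodule_of_incl {w : ℕ → D.Forms}
    (h : (fun n => D.incl (w n)) ∈ stdSubmodule B) : w ∈ stdSubmodule D.Forms := by
  rw [mem_stdSubmodule, summable_iff_vanishing_norm] at h ⊢
  intro ε hε
  obtain ⟨s, hs⟩ := h ε hε
  refine ⟨s, fun t ht => ?_⟩
  rw [← D.norm_incl, map_sum]
  exact hs t ht

/-- The map `δ : H_{A_δ} → H_{Ω_δ(A)}`, `(aₙ) ↦ (δ(aₙ))`. -/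
def dStd : D.diffStd →ₗ[ℂ] StdModule D.Forms where
  toFun x := ⟨fun n => D.d ⟨x.1 n, x.2.choose n⟩, D.mem_stdSubmodule_of_incl x.2.choose_spec⟩
  map_add' x y := StdModule.ext fun n =>
    map_add D.d ⟨x.1 n, x.2.choose n⟩ ⟨y.1 n, y.2.choose n⟩
  map_smul' c x := StdModule.ext fun n => map_smul D.d c ⟨x.1 n, x.2.choose n⟩

/-- The operator on `H_A` of a finite matrix over `𝒜`. -/
def matOp (M : (ℕ × ℕ) →₀ D.dom) : StdModule A →L[ℂ] StdModule A :=
  M.sum fun p a => matrixUnit p.1 p.2 (a : A)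

/-- The operator on `H_B` of the matrix `δ(M)` obtained by applying `δ` to the entries of `M`. -/
def matOpD (M : (ℕ × ℕ) →₀ D.dom) : StdModule B →L[ℂ] StdModule B :=
  M.sum fun p a => matrixUnit p.1 p.2 (D.δ a)

/-- `T ∈ 𝒦(H_A)_δ`: the operator `T` is the limit of a sequence of finite matrices over `𝒜` that
is Cauchy for the norm `‖M‖ + ‖δ(M)‖`. -/
def IsDiffCompact (T : StdModule A →L[ℂ] StdModule A) : Prop :=
  ∃ M : ℕ → ((ℕ × ℕ) →₀ D.dom),
    Tendsto (fun k => D.matOp (M k)) atTop (𝓝 T) ∧ CauchySeq (fun k => D.matOpD (M k))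

variable {X : Type*} [NormedAddCommGroup X] [NormedSpace ℂ X] [SMul Aᵐᵒᵖ X] [HilbertCMod A X]

/-- The conclusions of differentiable absorption for `W : X → H_A` and `K : H_A → H_A`, together
with a sequence `(ζₖ)` in `X` that implements `W`, in the sense that `W(η) = (⟪ζₖ, η⟫)ₖ`. The
projection `W W⋆` is denoted by `P`. -/
structure IsAbsorption (W : Adjointable A X (StdModule A))
    (K : Adjointable A (StdModule A) (StdModule A)) (ζ : ℕ → X) : Prop where
  isometry : W.adj ∘L W.toCLM = ContinuousLinearMap.id ℂ X
  selfAdjoint : K.adj = K.toCLM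
  positive (x : StdModule A) : 0 ≤ (inner A x (K.toCLM x) : A)
  /-- `K P = P K` -/
  commute : K.toCLM ∘L (W.toCLM ∘L W.adj) = (W.toCLM ∘L W.adj) ∘L K.toCLM
  /-- `W⋆ K W` has dense image -/
  dense : DenseRange (W.adj ∘L K.toCLM ∘L W.toCLM)
  /-- `P K` is compact -/
  compact : (W.toCLM ∘L W.adj) ∘L K.toCLM ∈ compactOperators A (StdModule A) (StdModule A)
  /-- `P K² ∈ 𝒦(H_A)_δ` -/
  diffCompact : D.IsDiffCompact ((W.toCLM ∘L W.adj) ∘L K.toCLM ∘L K.toCLM)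
  frame (η : X) (n : ℕ) : W.toCLM η n = inner A (ζ n) η

/-- The subspace `𝒳 = Im(W⋆ K² : H_{A_δ} → X)` of `X`. -/
def grassmannDomain (W : Adjointable A X (StdModule A))
    (K : Adjointable A (StdModule A) (StdModule A)) : Submodule ℂ X :=
  D.diffStd.map (W.adj ∘L K.toCLM ∘L K.toCLM).toLinearMap

end ClosedStarDerivation

end

/-!
After rescaling the generators `ξₙ` so that `‖⟨ξₙ, ξₘ⟩‖ + ‖δ⟨ξₙ, ξₘ⟩‖ ≤ 2^{-(n+1)} 2^{-(m+1)}`, the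
analysis operator `Φ η = (⟨ξₙ, η⟩)ₙ` is an adjointable contraction `X → H_A` whose adjoint has dense
range. Put `G = Φ⋆Φ` and `R = √(2 - G)`. The blocks `Φ (1 - G)ᵐ R`, placed side by side with the
pairing `ℕ × ℕ ≃ ℕ`, form an isometry `W`, because
`∑ m < M, R (1 - G)ᵐ G (1 - G)ᵐ R = 1 - (1 - G)^{2M}` tends strongly to `1`.
For `K = W G⁵ W⋆` the `(m, k)` block of `P K²` is `T⁵ (1 - T)^{m + k} T⁵ (2T - T²)`, where
`T = ΦΦ⋆` is the Gram matrix `(⟨ξₙ, ξₘ⟩)`. The entrywise image of `T` under `ρ` is again a positive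
contraction, so the spectral estimate `tˢ (1 - t)ᴺ ≤ C / (N + 1)ˢ` applies to it as well, and it
makes these blocks and their derivatives summable; hence `P K² ∈ 𝒦(H_A)_δ`.

For an arbitrary absorption triple, operators in `𝒦(H_A)_δ` map `H_{A_δ}` to `H_{A_δ}`, and
`W W⋆ K² = P K²`, so `W` maps `𝒳` into `H_{A_δ}`. Both properties of the Graßmann connection then
follow from the entrywise Leibniz rule of `δ` together with `W⋆ W = 1` and
`(W⋆ ⊗ 1) (W ⊗ 1) = 1`.
-/

noncomputable section

/-! ### Hilbert modules -/

namespace HilbertCMod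

variable {A E : Type*} [NonUnitalCStarAlgebra A] [PartialOrder A]
    [NormedAddCommGroup E] [NormedSpace ℂ E] [SMul Aᵐᵒᵖ E] [HilbertCMod A E]

theorem inner_add_left (x y z : E) : (inner A (x + y) z : A) = inner A x z + inner A y z := by
  simp only [← toForm_apply, map_add, LinearMap.add_apply]

theorem inner_sub_left (x y z : E) : (inner A (x - y) z : A) = inner A x z - inner A y z := by
  simp only [← toForm_apply, map_sub, LinearMap.sub_apply]

theorem inner_sub_right (x y z : E) : (inner A x (y - z) : A) = inner A x y - inner A x z := by
  simp only [← toForm_apply, map_sub]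

theorem inner_neg_right (x y : E) : (inner A x (-y) : A) = -inner A x y := by
  simp only [← toForm_apply, map_neg]

theorem inner_zero_left (x : E) : (inner A 0 x : A) = 0 := by
  simp only [← toForm_apply, map_zero, LinearMap.zero_apply]

theorem inner_zero_right (x : E) : (inner A x 0 : A) = 0 := by
  simp only [← toForm_apply, map_zero]

theorem inner_sum_left {ι : Type*} (s : Finset ι) (f : ι → E) (x : E) :
    (inner A (∑ i ∈ s, f i) x : A) = ∑ i ∈ s, inner A (f i) x := by
  simp only [← toForm_apply, map_sum, LinearMap.sum_apply]

theorem inner_sum_right {ι : Type*} (s : Finset ι) (f : ι → E) (x : E) :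
    (inner A x (∑ i ∈ s, f i) : A) = ∑ i ∈ s, inner A x (f i) := by
  simp only [← toForm_apply, map_sum]

theorem inner_smul_complex_left (c : ℂ) (x y : E) :
    (inner A (c • x) y : A) = star c • inner A x y := by
  rw [← star_inner, inner_smul_complex, star_smul, star_inner]

theorem inner_smul_left (x y : E) (a : A) : (inner A (x <• a) y : A) = star a * inner A x y :=
  (toForm A E).form_smul_left x y a

theorem add_op_smul (x y : E) (a : A) : (x + y) <• a = x <• a + y <• a :=
  ext_inner (A := A) fun z => by
    simp only [inner_smul_right, inner_add_right, add_mul]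

theorem op_smul_add (x : E) (a b : A) : x <• (a + b) = x <• a + x <• b :=
  ext_inner (A := A) fun z => by
    simp only [inner_smul_right, inner_add_right, mul_add]

theorem op_smul_smul (x : E) (c : ℂ) (a : A) : x <• (c • a) = c • (x <• a) :=
  ext_inner (A := A) fun z => by
    simp only [inner_smul_right, inner_smul_complex, mul_smul_comm]

theorem smul_op_smul (x : E) (c : ℂ) (a : A) : (c • x) <• a = c • (x <• a) :=
  ext_inner (A := A) fun z => by
    simp only [inner_smul_right, inner_smul_complex, smul_mul_assoc]

theorem norm_sq_eq (x : E) : ‖x‖ ^ 2 = ‖(inner A x x : A)‖ := by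
  rw [norm_eq (A := A) x, Real.sq_sqrt (norm_nonneg _)]

variable [StarOrderedRing A]

variable (A) in
/-- The functional `⟪x, ·⟫`. -/
def innerCLM (x : E) : E →L[ℂ] A :=
  ((toForm A E).form x).mkContinuous ‖x‖ fun y => norm_inner_le x y

theorem innerCLM_apply (x y : E) : innerCLM A x y = inner A x y := rfl

/-- The operator `a ↦ x a`. -/
def opSMulCLM (x : E) : A →L[ℂ] E :=
  LinearMap.mkContinuous
    { toFun := fun a => x <• a
      map_add' := op_smul_add x
      map_smul' := fun c a => op_smul_smul x c a } ‖x‖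
    fun a => (norm_smul_le' x a).trans_eq (mul_comm _ _)

theorem continuous_inner_right (x : E) : Continuous fun y : E => (inner A x y : A) :=
  (innerCLM A x).continuous

theorem continuous_inner_left (y : E) : Continuous fun x : E => (inner A x y : A) := by
  simp only [← star_inner (A := A) y]
  exact (continuous_inner_right y).star

theorem tendsto_inner {ι : Type*} {l : Filter ι} {f g : ι → E} {x y : E}
    (hf : Tendsto f l (𝓝 x)) (hg : Tendsto g l (𝓝 y)) :
    Tendsto (fun i => (inner A (f i) (g i) : A)) l (𝓝 (inner A x y)) := by
  have hbound : Tendsto (fun i => ‖f i - x‖ * ‖g i‖) l (𝓝 0) := by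
    simpa only [sub_self, norm_zero, zero_mul] using (hf.sub_const x).norm.mul hg.norm
  have hleft : Tendsto (fun i => (inner A (f i - x) (g i) : A)) l (𝓝 0) :=
    squeeze_zero_norm (fun i => norm_inner_le _ _) hbound
  have hright : Tendsto (fun i => (inner A x (g i) : A)) l (𝓝 (inner A x y)) :=
    ((continuous_inner_right x).tendsto y).comp hg
  simpa only [inner_sub_left, sub_add_cancel, zero_add] using hleft.add hright

end HilbertCMod

/-! ### The standard module -/

namespace StdModule

open HilbertCMod

variable {A : Type*} [NonUnitalCStarAlgebra A] [PartialOrder A] [StarOrderedRing A]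

theorem inner_def (x y : StdModule A) : (inner A x y : A) = ∑' n, star (x n) * y n := rfl

theorem hasSum_inner (x y : StdModule A) :
    HasSum (fun n => star (x n) * y n) (inner A x y : A) := (summable x y).hasSum

variable (A) in
/-- The `n`-th coordinate as a bounded operator `H_A → A`. -/
def evalCLM (n : ℕ) : StdModule A →L[ℂ] A :=
  LinearMap.mkContinuous
    { toFun := fun x => x n
      map_add' := fun x y => add_apply x y n
      map_smul' := fun c x => smul_apply c x n } 1
    fun x => by rw [one_mul]; exact norm_apply_le x n

theorem evalCLM_apply (n : ℕ) (x : StdModule A) : evalCLM A n x = x n := rfl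

theorem continuous_eval (n : ℕ) : Continuous fun x : StdModule A => x n := (evalCLM A n).continuous

theorem zero_apply (n : ℕ) : (0 : StdModule A) n = 0 := map_zero (evalCLM A n)

theorem sum_apply {ι : Type*} (s : Finset ι) (f : ι → StdModule A) (n : ℕ) :
    (∑ i ∈ s, f i) n = ∑ i ∈ s, f i n := map_sum (evalCLM A n) f s

variable (A) in
/-- The embedding of `A` in `H_A` as the `n`-th coordinate. -/
def singleCLM (n : ℕ) : A →L[ℂ] StdModule A :=
  LinearMap.mkContinuous
    { toFun := single n
      map_add' := fun a b => by ext k; simp only [add_apply, single_apply]; split_ifs <;> simp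
      map_smul' := fun c a => by
        ext k; simp only [smul_apply, single_apply, RingHom.id_apply]; split_ifs <;> simp } 1
    fun a => by rw [one_mul]; exact (norm_single n a).le

theorem singleCLM_apply (n : ℕ) (a : A) : singleCLM A n a = single n a := rfl

theorem inner_single_right (x : StdModule A) (n : ℕ) (a : A) :
    (inner A x (single n a) : A) = star (x n) * a := by
  rw [inner_def, tsum_eq_single n fun k hk => by rw [single_apply, if_neg hk, mul_zero],
    single_apply, if_pos rfl]

theorem inner_single_left (x : StdModule A) (n : ℕ) (a : A) :
    (inner A (single n a) x : A) = star a * x n := by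
  rw [← star_inner, inner_single_right, star_mul, star_star]

/-- The truncation of an arbitrary sequence to a finite set of indices. -/
def trunc (s : Finset ℕ) (y : ℕ → A) : StdModule A := ∑ n ∈ s, single n (y n)

theorem trunc_apply (s : Finset ℕ) (y : ℕ → A) (n : ℕ) :
    trunc s y n = if n ∈ s then y n else 0 := by
  simp only [trunc, sum_apply, single_apply, Finset.sum_ite_eq]

theorem inner_trunc_left (s : Finset ℕ) (y : ℕ → A) (z : StdModule A) :
    (inner A (trunc s y) z : A) = ∑ n ∈ s, star (y n) * z n := by
  simp only [trunc, inner_sum_left, inner_single_left]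

theorem norm_trunc_sq (s : Finset ℕ) (y : ℕ → A) :
    ‖trunc s y‖ ^ 2 = ‖∑ n ∈ s, star (y n) * y n‖ := by
  rw [norm_sq_eq (A := A), inner_trunc_left]
  congr 1
  refine Finset.sum_congr rfl fun n hn => ?_
  rw [trunc_apply, if_pos hn]

theorem norm_trunc_le (s : Finset ℕ) (y : StdModule A) : ‖trunc s y‖ ≤ ‖y‖ := by
  refine le_of_sq_le_sq ?_ (norm_nonneg _)
  rw [norm_trunc_sq, norm_sq_eq (A := A)]
  exact CStarAlgebra.norm_le_norm_of_nonneg_of_le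
    (Finset.sum_nonneg fun i _ => star_mul_self_nonneg _)
    ((summable y y).sum_le_tsum s fun _ _ => star_mul_self_nonneg _)

theorem norm_le_of_forall_norm_trunc_le {y : StdModule A} {c : ℝ} (hc : 0 ≤ c)
    (h : ∀ s, ‖trunc s y‖ ≤ c) : ‖y‖ ≤ c := by
  refine le_of_sq_le_sq ?_ hc
  rw [norm_sq_eq (A := A)]
  refine le_of_tendsto (hasSum_inner y y).norm (Eventually.of_forall fun s => ?_)
  rw [← norm_trunc_sq]
  exact pow_le_pow_left₀ (norm_nonneg _) (h s) 2

theorem trunc_sub (s : Finset ℕ) (y z : ℕ → A) : trunc s (y - z) = trunc s y - trunc s z := by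
  simp only [trunc, ← singleCLM_apply, Pi.sub_apply, map_sub, Finset.sum_sub_distrib]

theorem continuous_trunc (s : Finset ℕ) : Continuous (trunc s : (ℕ → A) → StdModule A) :=
  continuous_finsetSum _ fun n _ => (singleCLM A n).continuous.comp (continuous_apply n)

theorem mem_stdSubmodule_iff_trunc {y : ℕ → A} : y ∈ stdSubmodule A ↔
    ∀ ε > 0, ∃ s : Finset ℕ, ∀ t : Finset ℕ, Disjoint t s → ‖trunc t y‖ < ε := by
  rw [mem_stdSubmodule, summable_iff_vanishing_norm]
  constructor
  · intro h ε hε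
    obtain ⟨s, hs⟩ := h (ε ^ 2) (by positivity)
    refine ⟨s, fun t ht => lt_of_pow_lt_pow_left₀ 2 hε.le ?_⟩
    rw [norm_trunc_sq]
    exact hs t ht
  · intro h ε hε
    obtain ⟨s, hs⟩ := h (√ε) (by positivity)
    refine ⟨s, fun t ht => ?_⟩
    rw [← norm_trunc_sq, ← Real.sq_sqrt hε.le]
    exact pow_lt_pow_left₀ (hs t ht) (norm_nonneg _) two_ne_zero

theorem mem_stdSubmodule_of_norm_trunc_sub_le {y : ℕ → A}
    (h : ∀ ε > 0, ∃ x : StdModule A, ∀ s, ‖trunc s (x.1 - y)‖ ≤ ε) : y ∈ stdSubmodule A := by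
  rw [mem_stdSubmodule_iff_trunc]
  intro ε hε
  obtain ⟨x, hx⟩ := h (ε / 2) (by positivity)
  obtain ⟨s, hs⟩ := mem_stdSubmodule_iff_trunc.1 x.2 (ε / 2) (by positivity)
  refine ⟨s, fun t ht => ?_⟩
  have hdiff := hx t
  rw [trunc_sub, norm_sub_rev] at hdiff
  linarith [hs t ht, norm_sub_norm_le (trunc t y) (trunc t x.1)]

theorem eventually_norm_trunc_sub_le {u : ℕ → StdModule A} (hu : CauchySeq u) {y : ℕ → A}
    (hy : ∀ n, Tendsto (fun k => u k n) atTop (𝓝 (y n))) {ε : ℝ} (hε : 0 < ε) :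
    ∀ᶠ k in atTop, ∀ s, ‖trunc s ((u k).1 - y)‖ ≤ ε := by
  obtain ⟨N, hN⟩ := Metric.cauchySeq_iff.1 hu ε hε
  refine (eventually_ge_atTop N).mono fun k hk s => ?_
  have hlim : Tendsto (fun l => ‖trunc s ((u k).1 - (u l).1)‖) atTop
      (𝓝 ‖trunc s ((u k).1 - y)‖) :=
    (((continuous_trunc s).tendsto _).comp
      (tendsto_const_nhds.sub (tendsto_pi_nhds.2 hy))).norm
  refine le_of_tendsto hlim ((eventually_ge_atTop N).mono fun l hl => ?_)
  refine (norm_trunc_le s (u k - u l)).trans ?_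
  rw [← dist_eq_norm]
  exact (hN k hk l hl).le

instance : CompleteSpace (StdModule A) := by
  refine Metric.complete_of_cauchySeq_tendsto fun u hu => ?_
  have hcoord (n : ℕ) : ∃ a, Tendsto (fun k => u k n) atTop (𝓝 a) :=
    cauchySeq_tendsto_of_complete (hu.map (evalCLM A n).uniformContinuous)
  choose y hy using hcoord
  have hmem : y ∈ stdSubmodule A := mem_stdSubmodule_of_norm_trunc_sub_le fun ε hε => by
    obtain ⟨k, hk⟩ := (eventually_norm_trunc_sub_le hu hy hε).exists
    exact ⟨u k, hk⟩
  obtain ⟨x, rfl⟩ : ∃ x : StdModule A, x.1 = y := ⟨⟨y, hmem⟩, rfl⟩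
  refine ⟨x, Metric.tendsto_nhds.2 fun ε hε => ?_⟩
  refine (eventually_norm_trunc_sub_le hu hy (half_pos hε)).mono fun k hk => ?_
  have hnorm : ‖u k - x‖ ≤ ε / 2 :=
    norm_le_of_forall_norm_trunc_le (half_pos hε).le fun s => hk s
  rw [dist_eq_norm]
  exact hnorm.trans_lt (half_lt_self hε)

theorem hasSum_single (x : StdModule A) : HasSum (fun n => single n (x n)) x := by
  have hsummable : Summable fun n => single n (x n) := by
    rw [summable_iff_vanishing_norm]
    exact mem_stdSubmodule_iff_trunc.1 x.2
  convert hsummable.hasSum using 1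
  ext n
  rw [← evalCLM_apply, ← evalCLM_apply, (evalCLM A n).map_tsum hsummable,
    tsum_eq_single n fun k hk => by rw [evalCLM_apply, single_apply, if_neg hk.symm],
    evalCLM_apply, evalCLM_apply, single_apply, if_pos rfl]

end StdModule

/-! ### Adjointable operators -/

namespace Adjointable

open HilbertCMod

section Basic

variable {A E F : Type*} [NonUnitalCStarAlgebra A] [PartialOrder A]
    [NormedAddCommGroup E] [NormedSpace ℂ E] [SMul Aᵐᵒᵖ E] [HilbertCMod A E]
    [NormedAddCommGroup F] [NormedSpace ℂ F] [SMul Aᵐᵒᵖ F] [HilbertCMod A F]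

theorem inner_adj_left (T : Adjointable A E F) (x : E) (y : F) :
    (inner A (T.adj y) x : A) = inner A y (T.toCLM x) := by
  rw [← star_inner, ← T.inner_adj, star_inner]

/-- The adjoint operator. -/
def flip (T : Adjointable A E F) : Adjointable A F E :=
  ⟨T.adj, T.toCLM, fun x y => T.inner_adj_left y x⟩

theorem map_op_smul (T : Adjointable A E F) (x : E) (a : A) :
    T.toCLM (x <• a) = T.toCLM x <• a :=
  ext_inner (A := A) fun z => by
    simp only [HilbertCMod.inner_smul_right, ← T.inner_adj_left]

theorem adj_op_smul (T : Adjointable A E F) (x : F) (a : A) :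
    T.adj (x <• a) = T.adj x <• a :=
  T.flip.map_op_smul x a

end Basic

section OfCoords

variable {A E : Type*} [NonUnitalCStarAlgebra A] [PartialOrder A] [StarOrderedRing A]
    [NormedAddCommGroup E] [NormedSpace ℂ E] [SMul Aᵐᵒᵖ E] [HilbertCMod A E]
    (V : E →L[ℂ] StdModule A) (k : ℕ → A →ₗ[ℂ] E)

theorem norm_sum_coords_le (h : ∀ n a z, (inner A (k n a) z : A) = star a * V z n)
    (y : ℕ → A) (s : Finset ℕ) : ‖∑ n ∈ s, k n (y n)‖ ≤ ‖V‖ * ‖StdModule.trunc s y‖ := by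
  set v := ∑ n ∈ s, k n (y n) with hv
  have hinner : (inner A v v : A) = inner A (StdModule.trunc s y) (V v) := by
    rw [StdModule.inner_trunc_left]
    conv_lhs => rw [hv, inner_sum_left]
    exact Finset.sum_congr rfl fun n _ => h n (y n) v
  have hsq : ‖v‖ ^ 2 ≤ ‖StdModule.trunc s y‖ * (‖V‖ * ‖v‖) := by
    rw [norm_sq_eq (A := A), hinner]
    exact (norm_inner_le _ _).trans (by gcongr; exact V.le_opNorm v)
  rcases (norm_nonneg v).eq_or_lt with hzero | hpos
  · rw [← hzero]; positivity
  · refine le_of_mul_le_mul_right ?_ hpos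
    linarith

variable [CompleteSpace E]

theorem summable_coords (h : ∀ n a z, (inner A (k n a) z : A) = star a * V z n)
    (y : StdModule A) : Summable fun n => k n (y n) := by
  rw [summable_iff_vanishing_norm]
  intro ε hε
  obtain ⟨s, hs⟩ := StdModule.mem_stdSubmodule_iff_trunc.1 y.2 (ε / (‖V‖ + 1)) (by positivity)
  refine ⟨s, fun t ht => (norm_sum_coords_le V k h y t).trans_lt ?_⟩
  have htail := hs t ht
  rw [lt_div_iff₀ (by positivity)] at htail
  nlinarith [norm_nonneg (StdModule.trunc t y)]

/-- A bounded operator `V` into the standard module with adjointable coordinates is adjointable: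
if `k n` is the adjoint of the `n`-th coordinate of `V`, then the adjoint of `V` is
`y ↦ ∑ₙ k n (yₙ)`. -/
def ofCoords (h : ∀ n a z, (inner A (k n a) z : A) = star a * V z n) :
    Adjointable A E (StdModule A) where
  toCLM := V
  adj := LinearMap.mkContinuous
    { toFun := fun y => ∑' n, k n (y n)
      map_add' := fun y z => by
        rw [← (summable_coords V k h y).tsum_add (summable_coords V k h z)]
        simp only [StdModule.add_apply, map_add]
      map_smul' := fun c y => by
        rw [RingHom.id_apply, ← (summable_coords V k h y).tsum_const_smul]
        simp only [StdModule.smul_apply, map_smul] } ‖V‖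
    fun y => le_of_tendsto (summable_coords V k h y).hasSum.norm (Eventually.of_forall fun s =>
      (norm_sum_coords_le V k h y s).trans (by gcongr; exact StdModule.norm_trunc_le s y))
  inner_adj x y := by
    have hsum := (summable_coords V k h y).hasSum.map (innerCLM A x) (innerCLM A x).continuous
    refine (StdModule.hasSum_inner (V x) y).unique (hsum.congr_fun fun n => ?_)
    rw [Function.comp_apply, innerCLM_apply, ← star_inner, h, star_mul, star_star]

theorem hasSum_ofCoords_adj (h : ∀ n a z, (inner A (k n a) z : A) = star a * V z n)
    (y : StdModule A) : HasSum (fun n => k n (y n)) ((ofCoords V k h).adj y) :=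
  (summable_coords V k h y).hasSum

end OfCoords

end Adjointable

section AdjPair

open HilbertCMod

variable (A : Type*) {E F H : Type*} [NonUnitalCStarAlgebra A] [PartialOrder A]
    [NormedAddCommGroup E] [NormedSpace ℂ E] [SMul Aᵐᵒᵖ E] [HilbertCMod A E]
    [NormedAddCommGroup F] [NormedSpace ℂ F] [SMul Aᵐᵒᵖ F] [HilbertCMod A F]
    [NormedAddCommGroup H] [NormedSpace ℂ H] [SMul Aᵐᵒᵖ H] [HilbertCMod A H]

/-- The operators `S` and `S'` are adjoint to each other. The predicate form of `Adjointable`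
leaves the two operators as explicit terms, so that it is stable under algebraic operations. -/
def IsAdjPair (S : E →L[ℂ] F) (S' : F →L[ℂ] E) : Prop :=
  ∀ x y, (inner A (S x) y : A) = inner A x (S' y)

namespace IsAdjPair

variable {A} {S T : E →L[ℂ] F} {S' T' : F →L[ℂ] E}

theorem symm (h : IsAdjPair A S S') : IsAdjPair A S' S := fun x y => by
  rw [← star_inner, ← h, star_inner]

theorem add (hS : IsAdjPair A S S') (hT : IsAdjPair A T T') : IsAdjPair A (S + T) (S' + T') :=
  fun x y => by
    rw [_root_.add_apply, _root_.add_apply, HilbertCMod.inner_add_left,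
      HilbertCMod.inner_add_right, hS, hT]

theorem sub (hS : IsAdjPair A S S') (hT : IsAdjPair A T T') : IsAdjPair A (S - T) (S' - T') :=
  fun x y => by
    rw [_root_.sub_apply, _root_.sub_apply, HilbertCMod.inner_sub_left,
      HilbertCMod.inner_sub_right, hS, hT]

theorem smul (h : IsAdjPair A S S') (c : ℂ) : IsAdjPair A (c • S) (star c • S') :=
  fun x y => by
    rw [_root_.smul_apply, _root_.smul_apply, inner_smul_complex_left, inner_smul_complex, h]

theorem sum {ι : Type*} (s : Finset ι) {U : ι → E →L[ℂ] F} {U' : ι → F →L[ℂ] E}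
    (h : ∀ i ∈ s, IsAdjPair A (U i) (U' i)) : IsAdjPair A (∑ i ∈ s, U i) (∑ i ∈ s, U' i) :=
  fun x y => by
    rw [_root_.sum_apply, _root_.sum_apply, inner_sum_left, inner_sum_right]
    exact Finset.sum_congr rfl fun i hi => h i hi x y

theorem comp {U : F →L[ℂ] H} {U' : H →L[ℂ] F} (hU : IsAdjPair A U U') (hS : IsAdjPair A S S') :
    IsAdjPair A (U ∘L S) (S' ∘L U') := fun x y => by
  rw [ContinuousLinearMap.comp_apply, ContinuousLinearMap.comp_apply, hU, hS]

theorem unique (h : IsAdjPair A S S') (h' : IsAdjPair A S T') : S' = T' :=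
  ContinuousLinearMap.ext fun y => ext_inner (A := A) fun x => by rw [← h, ← h']

theorem of_adjointable (T : Adjointable A E F) : IsAdjPair A T.toCLM T.adj := T.inner_adj

variable [StarOrderedRing A]

theorem norm_apply_sq_le (h : IsAdjPair A S S') (x : E) : ‖S x‖ ^ 2 ≤ ‖x‖ * ‖S' (S x)‖ := by
  rw [norm_sq_eq (A := A), h]
  exact norm_inner_le _ _

theorem norm_le (h : IsAdjPair A S S') : ‖S‖ ≤ ‖S'‖ := by
  refine S.opNorm_le_bound (norm_nonneg _) fun x => ?_
  have hsq : ‖S x‖ * ‖S x‖ ≤ ‖S'‖ * ‖x‖ * ‖S x‖ :=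
    calc ‖S x‖ * ‖S x‖ = ‖S x‖ ^ 2 := (sq _).symm
      _ ≤ ‖x‖ * ‖S' (S x)‖ := h.norm_apply_sq_le x
      _ ≤ ‖x‖ * (‖S'‖ * ‖S x‖) := by gcongr; exact S'.le_opNorm _
      _ = ‖S'‖ * ‖x‖ * ‖S x‖ := by ring
  rcases (norm_nonneg (S x)).eq_or_lt with hzero | hpos
  · rw [← hzero]; positivity
  · exact le_of_mul_le_mul_right hsq hpos

theorem norm_eq (h : IsAdjPair A S S') : ‖S‖ = ‖S'‖ := h.norm_le.antisymm h.symm.norm_le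

theorem norm_sq_le (h : IsAdjPair A S S') : ‖S‖ ^ 2 ≤ ‖S' ∘L S‖ := by
  refine (Real.le_sqrt (norm_nonneg _) (norm_nonneg _)).1
    (S.opNorm_le_bound (Real.sqrt_nonneg _) fun x => ?_)
  refine le_of_sq_le_sq ?_ (by positivity)
  calc ‖S x‖ ^ 2 ≤ ‖x‖ * ‖(S' ∘L S) x‖ := h.norm_apply_sq_le x
    _ ≤ ‖x‖ * (‖S' ∘L S‖ * ‖x‖) := by gcongr; exact (S' ∘L S).le_opNorm x
    _ = (√‖S' ∘L S‖ * ‖x‖) ^ 2 := by rw [mul_pow, Real.sq_sqrt (norm_nonneg _)]; ring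

theorem tendsto {ι : Type*} {l : Filter ι} [l.NeBot] {U : ι → E →L[ℂ] F} {U' : ι → F →L[ℂ] E}
    (h : ∀ i, IsAdjPair A (U i) (U' i)) (hU : ∀ x, Tendsto (fun i => U i x) l (𝓝 (S x)))
    (hU' : ∀ x, Tendsto (fun i => U' i x) l (𝓝 (S' x))) : IsAdjPair A S S' := fun x y =>
  tendsto_nhds_unique (tendsto_inner (hU x) tendsto_const_nhds)
    ((tendsto_inner tendsto_const_nhds (hU' y)).congr fun i => (h i x y).symm)

end IsAdjPair

/-! ### The C⋆-algebra of adjointable operators -/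

variable (E) in
/-- The adjointable operators on `E`, as a subalgebra of the bounded operators. -/
def adjSubalgebra : Subalgebra ℂ (E →L[ℂ] E) where
  carrier := {S | ∃ S', IsAdjPair A S S'}
  mul_mem' := by
    rintro S T ⟨S', hS⟩ ⟨T', hT⟩
    exact ⟨_, hS.comp hT⟩
  add_mem' := by
    rintro S T ⟨S', hS⟩ ⟨T', hT⟩
    exact ⟨_, hS.add hT⟩
  algebraMap_mem' c := ⟨star c • 1, by
    rw [Algebra.algebraMap_eq_smul_one]
    exact IsAdjPair.smul (fun x y => rfl) c⟩

variable (E) in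
/-- The C⋆-algebra of adjointable operators on `E`, with the operator norm; it is what makes the
continuous functional calculus available. -/
abbrev AdjOp : Type _ := adjSubalgebra A E

namespace AdjOp

variable {A}

instance : Star (AdjOp A E) := ⟨fun S => ⟨S.2.choose, S.1, S.2.choose_spec.symm⟩⟩

theorem isAdjPair (S : AdjOp A E) : IsAdjPair A (S : E →L[ℂ] E) (star S : AdjOp A E) :=
  S.2.choose_spec

theorem star_eq_of_isAdjPair {S S' : AdjOp A E}
    (h : IsAdjPair A (S : E →L[ℂ] E) (S' : E →L[ℂ] E)) : star S = S' :=
  Subtype.ext (S.isAdjPair.unique h)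

instance : StarRing (AdjOp A E) where
  star_involutive S := star_eq_of_isAdjPair S.isAdjPair.symm
  star_mul S T := star_eq_of_isAdjPair (S.isAdjPair.comp T.isAdjPair)
  star_add S T := star_eq_of_isAdjPair (S.isAdjPair.add T.isAdjPair)

instance : StarModule ℂ (AdjOp A E) where
  star_smul c S := star_eq_of_isAdjPair (S.isAdjPair.smul c)

theorem isSelfAdjoint_iff {S : AdjOp A E} :
    IsSelfAdjoint S ↔ IsAdjPair A (S : E →L[ℂ] E) (S : E →L[ℂ] E) :=
  ⟨fun h => by simpa only [h.star_eq] using S.isAdjPair, star_eq_of_isAdjPair⟩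

variable [StarOrderedRing A]

instance : CStarRing (AdjOp A E) where
  norm_mul_self_le S := by
    rw [← pow_two]
    exact S.isAdjPair.norm_sq_le

variable [CompleteSpace E]

instance : CompleteSpace (AdjOp A E) := by
  refine Metric.complete_of_cauchySeq_tendsto fun u hu => ?_
  have hlim {v : ℕ → AdjOp A E} (hv : CauchySeq v) :
      ∃ T : E →L[ℂ] E, Tendsto (fun n => (v n : E →L[ℂ] E)) atTop (𝓝 T) :=
    cauchySeq_tendsto_of_complete (uniformContinuous_subtype_val.comp_cauchySeq hv)
  obtain ⟨S, hS⟩ := hlim hu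
  obtain ⟨S', hS'⟩ := hlim
    ((starₗᵢ ℂ : AdjOp A E ≃ₗᵢ⋆[ℂ] AdjOp A E).isometry.uniformContinuous.comp_cauchySeq hu)
  have hadj : IsAdjPair A S S' := IsAdjPair.tendsto (fun n => (u n).isAdjPair)
    (fun x => ((ContinuousLinearMap.apply ℂ E x).continuous.tendsto _).comp hS)
    (fun x => ((ContinuousLinearMap.apply ℂ E x).continuous.tendsto _).comp hS')
  exact ⟨⟨S, S', hadj⟩, tendsto_subtype_rng.2 hS⟩

instance : CStarAlgebra (AdjOp A E) where

end AdjOp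

end AdjPair

/-! ### Positive contractions -/

namespace AdjOp

open HilbertCMod

variable {A E : Type*} [NonUnitalCStarAlgebra A] [PartialOrder A] [StarOrderedRing A]
    [NormedAddCommGroup E] [NormedSpace ℂ E] [SMul Aᵐᵒᵖ E] [HilbertCMod A E] [CompleteSpace E]

theorem cfc_sqrt_neg_conj {S : AdjOp A E} (hS : IsSelfAdjoint S) :
    cfc (fun t : ℝ => √(-t)) S * S * cfc (fun t : ℝ => √(-t)) S =
      -(cfc (fun t : ℝ => √(-t) ^ 2) S * cfc (fun t : ℝ => √(-t) ^ 2) S) := by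
  conv_lhs => enter [1, 2]; rw [← cfc_id' ℝ S]
  rw [← cfc_mul _ _ S, ← cfc_mul _ _ S, ← cfc_mul _ _ S, ← cfc_neg]
  refine cfc_congr fun t _ => ?_
  rcases le_total 0 t with ht | ht
  · simp only [Real.sqrt_eq_zero_of_nonpos (neg_nonpos.2 ht)]
    ring
  · have hsq : √(-t) ^ 2 = -t := Real.sq_sqrt (neg_nonneg.2 ht)
    simp only [hsq]
    linear_combination t * hsq

theorem spectrum_nonneg {S : AdjOp A E} (hS : IsSelfAdjoint S)
    (hpos : ∀ x, 0 ≤ (inner A x (S.1 x) : A)) {t : ℝ} (ht : t ∈ spectrum ℝ S) : 0 ≤ t := by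
  set n := cfc (fun t : ℝ => √(-t)) S
  set m := cfc (fun t : ℝ => √(-t) ^ 2) S
  have hn : IsSelfAdjoint n := cfc_predicate _ S
  have hm : IsSelfAdjoint m := cfc_predicate _ S
  have hconj : n * S * n = -(m * m) := cfc_sqrt_neg_conj hS
  have hinner (x : E) : (inner A (n.1 x) (S.1 (n.1 x)) : A) = -inner A (m.1 x) (m.1 x) := by
    rw [isSelfAdjoint_iff.1 hn, isSelfAdjoint_iff.1 hm,
      show n.1 (S.1 (n.1 x)) = (n * S * n).1 x from rfl, hconj]
    exact inner_neg_right _ _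
  have hm_zero : m = 0 := Subtype.ext (ContinuousLinearMap.ext fun x =>
    inner_self_eq_zero (A := A) _ (le_antisymm
      (neg_nonneg.1 ((hpos (n.1 x)).trans_eq (hinner x))) (HilbertCMod.inner_self_nonneg _)))
  have hvanish : √(-t) ^ 2 = 0 :=
    (cfc_eq_cfc_iff_eqOn (R := ℝ)).1 (hm_zero.trans (cfc_const_zero ℝ S).symm) ht
  rw [sq_eq_zero_iff, Real.sqrt_eq_zero'] at hvanish
  linarith

theorem spectrum_le_one {S : AdjOp A E} (hS : ‖S‖ ≤ 1) {t : ℝ} (ht : t ∈ spectrum ℝ S) :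
    t ≤ 1 := by
  have hball := mem_closedBall_zero_iff.1 (spectrum.subset_closedBall_norm_mul S ht)
  have hone : ‖(1 : AdjOp A E)‖ ≤ 1 := ContinuousLinearMap.norm_id_le
  calc t ≤ ‖t‖ := Real.le_norm_self t
    _ ≤ ‖S‖ * ‖(1 : AdjOp A E)‖ := hball
    _ ≤ 1 := mul_le_one₀ hS (norm_nonneg _) hone

/-- The operators `0 ≤ S ≤ 1`, with positivity tested on vectors. -/
structure IsPosContraction (S : AdjOp A E) : Prop where
  isSelfAdjoint : IsSelfAdjoint S
  nonneg (x : E) : 0 ≤ (inner A x (S.1 x) : A)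
  norm_le : ‖S‖ ≤ 1

theorem pow_mul_one_sub_pow_le {t : ℝ} (ht : t ∈ Set.Icc 0 1) (s N : ℕ) :
    t ^ s * (1 - t) ^ N ≤ Real.exp 1 * s.factorial / (N + 1) ^ s := by
  obtain ⟨ht0, ht1⟩ := ht
  have hdecay : (1 - t) ^ N ≤ Real.exp 1 * Real.exp (-((N + 1) * t)) :=
    calc (1 - t) ^ N ≤ Real.exp (-t) ^ N :=
          pow_le_pow_left₀ (by linarith) (Real.one_sub_le_exp_neg t) N
      _ = Real.exp (N * -t) := (Real.exp_nat_mul _ _).symm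
      _ ≤ Real.exp (1 + -((N + 1) * t)) := Real.exp_le_exp.2 (by linarith)
      _ = Real.exp 1 * Real.exp (-((N + 1) * t)) := Real.exp_add _ _
  have hgrowth : ((N + 1) * t) ^ s ≤ Real.exp ((N + 1) * t) * s.factorial :=
    (div_le_iff₀ (by positivity)).1 (Real.pow_div_factorial_le_exp _ (by positivity) s)
  rw [le_div_iff₀ (by positivity)]
  calc t ^ s * (1 - t) ^ N * (N + 1) ^ s = ((N + 1) * t) ^ s * (1 - t) ^ N := by rw [mul_pow]; ring
    _ ≤ (Real.exp ((N + 1) * t) * s.factorial) * (Real.exp 1 * Real.exp (-((N + 1) * t))) :=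
        mul_le_mul hgrowth hdecay (pow_nonneg (by linarith) _) (by positivity)
    _ = Real.exp 1 * s.factorial * (Real.exp ((N + 1) * t) * Real.exp (-((N + 1) * t))) := by ring
    _ = Real.exp 1 * s.factorial := by rw [← Real.exp_add, add_neg_cancel, Real.exp_zero, mul_one]

namespace IsPosContraction

variable {S : AdjOp A E}

theorem mem_Icc (h : IsPosContraction S) {t : ℝ} (ht : t ∈ spectrum ℝ S) : t ∈ Set.Icc 0 1 :=
  ⟨spectrum_nonneg h.isSelfAdjoint h.nonneg ht, spectrum_le_one h.norm_le ht⟩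

theorem norm_pow_mul_one_sub_pow_le_of_forall (h : IsPosContraction S) {s N : ℕ} {c : ℝ}
    (hc : 0 ≤ c) (hle : ∀ t ∈ Set.Icc (0 : ℝ) 1, t ^ s * (1 - t) ^ N ≤ c) :
    ‖S ^ s * (1 - S) ^ N‖ ≤ c := by
  have hS := h.isSelfAdjoint
  have hcfc : S ^ s * (1 - S) ^ N = cfc (fun t : ℝ => t ^ s * (1 - t) ^ N) S := by
    rw [cfc_mul _ _ S, cfc_pow _ _ S, cfc_pow _ _ S, cfc_sub _ _ S, cfc_id' ℝ S,
      cfc_const_one ℝ S]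
  rw [hcfc]
  refine norm_cfc_le hc fun t ht => ?_
  have hIcc := h.mem_Icc ht
  rw [Real.norm_of_nonneg (mul_nonneg (pow_nonneg hIcc.1 _) (pow_nonneg (sub_nonneg.2 hIcc.2) _))]
  exact hle t hIcc

theorem norm_pow_mul_one_sub_pow_le (h : IsPosContraction S) (s N : ℕ) :
    ‖S ^ s * (1 - S) ^ N‖ ≤ Real.exp 1 * s.factorial / (N + 1) ^ s :=
  h.norm_pow_mul_one_sub_pow_le_of_forall (by positivity) fun _ ht => pow_mul_one_sub_pow_le ht s N

theorem norm_one_sub_pow_le (h : IsPosContraction S) (N : ℕ) : ‖(1 - S) ^ N‖ ≤ 1 := by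
  rw [← one_mul ((1 - S) ^ N), ← pow_zero S]
  refine h.norm_pow_mul_one_sub_pow_le_of_forall zero_le_one fun t ht => ?_
  rw [pow_zero, one_mul]
  exact pow_le_one₀ (sub_nonneg.2 ht.2) (sub_le_self 1 ht.1)

theorem exists_sqrt_two_sub (h : IsPosContraction S) :
    ∃ R : AdjOp A E, IsSelfAdjoint R ∧ R * R = 2 - S ∧ Commute R S := by
  have hS := h.isSelfAdjoint
  refine ⟨cfc (fun t : ℝ => √(2 - t)) S, cfc_predicate _ S, ?_, ?_⟩
  · have htwo_sub : cfc (fun t : ℝ => 2 - t) S = 2 - S := by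
      rw [cfc_sub _ _ S, cfc_id' ℝ S, cfc_const _ S]
      congr 1
      exact map_ofNat (algebraMap ℝ (AdjOp A E)) 2
    rw [← cfc_mul _ _ S, ← htwo_sub]
    exact cfc_congr fun t ht => Real.mul_self_sqrt (by linarith [(h.mem_Icc ht).2])
  · simpa only [cfc_id' ℝ S] using cfc_commute_cfc (fun t : ℝ => √(2 - t)) (fun t => t) S

end IsPosContraction

end AdjOp

/-! ### Matrices as operators on the standard module -/

section MatrixUnit

variable {A C : Type*} [NonUnitalCStarAlgebra A] [PartialOrder A] [StarOrderedRing A]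
    [NonUnitalCStarAlgebra C] [PartialOrder C] [StarOrderedRing C]

theorem matrixUnit_apply (i j : ℕ) (a : A) (x : StdModule A) :
    matrixUnit i j a x = StdModule.single i (a * x j) := rfl

theorem matrixUnit_apply_apply (i j : ℕ) (a : A) (x : StdModule A) (n : ℕ) :
    matrixUnit i j a x n = if n = i then a * x j else 0 := StdModule.single_apply _ _ _

theorem norm_matrixUnit_le (i j : ℕ) (a : A) : ‖matrixUnit i j a‖ ≤ ‖a‖ :=
  LinearMap.mkContinuous_norm_le _ (norm_nonneg _) _

variable (A) in
/-- The operator `a ↦ E_{ij}(a)` that places `a` in the entry `(i, j)`. -/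
def matrixUnitCLM (i j : ℕ) : A →L[ℂ] StdModule A →L[ℂ] StdModule A :=
  LinearMap.mkContinuous
    { toFun := matrixUnit i j
      map_add' := fun a b => by
        ext1 x
        simp only [_root_.add_apply, matrixUnit_apply, add_mul, ← StdModule.singleCLM_apply,
          map_add]
      map_smul' := fun c a => by
        ext1 x
        simp only [_root_.smul_apply, matrixUnit_apply, smul_mul_assoc,
          ← StdModule.singleCLM_apply, map_smul, RingHom.id_apply] } 1
    fun a => (norm_matrixUnit_le i j a).trans_eq (one_mul _).symm

theorem matrixUnitCLM_apply (i j : ℕ) (a : A) : matrixUnitCLM A i j a = matrixUnit i j a := rfl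

theorem matrixUnit_zero (i j : ℕ) : matrixUnit i j (0 : A) = 0 := map_zero (matrixUnitCLM A i j)

theorem matrixUnit_add (i j : ℕ) (a b : A) :
    matrixUnit i j (a + b) = matrixUnit i j a + matrixUnit i j b :=
  map_add (matrixUnitCLM A i j) a b

theorem matrixUnit_smul (i j : ℕ) (c : ℂ) (a : A) :
    matrixUnit i j (c • a) = c • matrixUnit i j a := map_smul (matrixUnitCLM A i j) c a

theorem matrixUnit_mul (i j k l : ℕ) (a b : A) :
    matrixUnit i j a * matrixUnit k l b = if j = k then matrixUnit i l (a * b) else 0 := by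
  ext x n
  rw [mul_apply_eq_comp, matrixUnit_apply_apply, matrixUnit_apply_apply]
  by_cases h : j = k
  · rw [if_pos h, if_pos h, matrixUnit_apply_apply, mul_assoc]
  · rw [if_neg h, if_neg h, mul_zero, ite_self]
    exact (StdModule.zero_apply n).symm

theorem isAdjPair_matrixUnit (i j : ℕ) (a : A) :
    IsAdjPair A (matrixUnit i j a) (matrixUnit j i (star a)) := fun x y => by
  rw [matrixUnit_apply, matrixUnit_apply, StdModule.inner_single_left,
    StdModule.inner_single_right, star_mul, mul_assoc]

/-- The operator on `H_A` given by a finite matrix, placed in the upper left corner. -/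
def cornerOp {m : ℕ} (N : CStarMatrix (Fin m) (Fin m) A) : StdModule A →L[ℂ] StdModule A :=
  ∑ i : Fin m, ∑ j : Fin m, matrixUnit (i : ℕ) (j : ℕ) (N i j)

theorem cornerOp_mul {m : ℕ} (N M : CStarMatrix (Fin m) (Fin m) A) :
    cornerOp (N * M) = cornerOp N * cornerOp M := by
  have hentry (i j l : Fin m) :
      ∑ k : Fin m, matrixUnit (i : ℕ) (j : ℕ) (N i j) * matrixUnit (k : ℕ) (l : ℕ) (M k l) =
        matrixUnit (i : ℕ) (l : ℕ) (N i j * M j l) := by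
    simp only [matrixUnit_mul, Fin.val_inj, Finset.sum_ite_eq, Finset.mem_univ, if_true]
  calc cornerOp (N * M)
      = ∑ i : Fin m, ∑ j : Fin m, ∑ l : Fin m, matrixUnit (i : ℕ) (l : ℕ) (N i j * M j l) := by
        simp only [cornerOp, CStarMatrix.mul_apply, ← matrixUnitCLM_apply, map_sum]
        exact Finset.sum_congr rfl fun i _ => Finset.sum_comm
    _ = cornerOp N * cornerOp M := by
        simp only [cornerOp, Finset.sum_mul]
        refine Finset.sum_congr rfl fun i _ => Finset.sum_congr rfl fun j _ => ?_
        simp only [Finset.mul_sum, ← hentry]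
        exact Finset.sum_comm

theorem isAdjPair_cornerOp {m : ℕ} (N : CStarMatrix (Fin m) (Fin m) A) :
    IsAdjPair A (cornerOp N) (cornerOp (star N)) := by
  rw [show cornerOp (star N) = ∑ i : Fin m, ∑ j : Fin m, matrixUnit (j : ℕ) (i : ℕ) (star (N i j))
    from Finset.sum_comm]
  exact IsAdjPair.sum _ fun i _ => IsAdjPair.sum _ fun j _ => isAdjPair_matrixUnit _ _ _

/-- The representation of finite matrices on the standard module. It is isometric, which is how
norms of finite matrices over different algebras are compared. -/
def cornerHom (m : ℕ) : CStarMatrix (Fin m) (Fin m) A →⋆ₙₐ[ℂ] AdjOp A (StdModule A) where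
  toFun N := ⟨cornerOp N, cornerOp (star N), isAdjPair_cornerOp N⟩
  map_smul' c N := Subtype.ext <| by
    change cornerOp (c • N) = c • cornerOp N
    simp only [cornerOp, CStarMatrix.smul_apply, matrixUnit_smul, Finset.smul_sum]
  map_zero' := Subtype.ext <| by
    change cornerOp 0 = 0
    simp only [cornerOp, CStarMatrix.zero_apply, matrixUnit_zero, Finset.sum_const_zero]
  map_add' N M := Subtype.ext <| by
    change cornerOp (N + M) = cornerOp N + cornerOp M
    simp only [cornerOp, CStarMatrix.add_apply, matrixUnit_add, Finset.sum_add_distrib]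
  map_mul' N M := Subtype.ext (cornerOp_mul N M)
  map_star' N := (AdjOp.star_eq_of_isAdjPair (isAdjPair_cornerOp N)).symm

theorem cornerOp_single_apply {m : ℕ} (N : CStarMatrix (Fin m) (Fin m) A) (k l : Fin m) (a : A) :
    cornerOp N (StdModule.single (l : ℕ) a) (k : ℕ) = N k l * a := by
  simp only [cornerOp, _root_.sum_apply, StdModule.sum_apply, matrixUnit_apply_apply,
    StdModule.single_apply, Fin.val_inj, Finset.sum_ite_irrel, Finset.sum_const_zero,
    Finset.sum_ite_eq, Finset.mem_univ, if_true, mul_ite, mul_zero, Finset.sum_ite_eq']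

theorem cornerHom_injective (m : ℕ) : Function.Injective (cornerHom (A := A) m) := by
  rw [injective_iff_map_eq_zero]
  intro N hN
  have hop : cornerOp N = 0 := congrArg Subtype.val hN
  ext k l
  refine (CStarRing.mul_star_self_eq_zero_iff _).1 ?_
  rw [← cornerOp_single_apply, hop]
  exact StdModule.zero_apply _

theorem norm_cornerOp {m : ℕ} (N : CStarMatrix (Fin m) (Fin m) A) : ‖cornerOp N‖ = ‖N‖ :=
  NonUnitalStarAlgHom.norm_map (cornerHom m) (cornerHom_injective m) N

theorem sum_fin_fin_ite_mem {G : Type*} [AddCommMonoid G] {s : Finset (ℕ × ℕ)} {m : ℕ}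
    (hm : ∀ p ∈ s, p.1 < m ∧ p.2 < m) (g : ℕ × ℕ → G) :
    ∑ i : Fin m, ∑ j : Fin m, (if ((i : ℕ), (j : ℕ)) ∈ s then g (i, j) else 0) = ∑ p ∈ s, g p := by
  rw [Fin.sum_univ_eq_sum_range
    (fun i => ∑ j : Fin m, if (i, (j : ℕ)) ∈ s then g (i, j) else 0)]
  simp only [fun i : ℕ => Fin.sum_univ_eq_sum_range
    (fun j => if (i, j) ∈ s then g (i, j) else 0) m]
  rw [← Finset.sum_product' (Finset.range m) (Finset.range m)
    (fun i j => if (i, j) ∈ s then g (i, j) else 0), ← Finset.sum_filter]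
  refine Finset.sum_congr ?_ fun _ _ => rfl
  ext p
  simp only [Finset.mem_filter, Finset.mem_product, Finset.mem_range]
  exact ⟨fun h => h.2, fun h => ⟨hm p h, h⟩⟩

theorem cornerOp_eq_sum {s : Finset (ℕ × ℕ)} {m : ℕ} (hm : ∀ p ∈ s, p.1 < m ∧ p.2 < m)
    (f : ℕ × ℕ → A) {N : CStarMatrix (Fin m) (Fin m) A}
    (hN : ∀ i j, N i j = if ((i : ℕ), (j : ℕ)) ∈ s then f (i, j) else 0) :
    cornerOp N = ∑ p ∈ s, matrixUnit p.1 p.2 (f p) := by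
  rw [← sum_fin_fin_ite_mem hm]
  refine Finset.sum_congr rfl fun i _ => Finset.sum_congr rfl fun j _ => ?_
  rw [hN, apply_ite (matrixUnit (i : ℕ) (j : ℕ)), matrixUnit_zero]

theorem norm_sum_matrixUnit_map_le (φ : A →⋆ₙₐ[ℂ] C) (s : Finset (ℕ × ℕ)) (f : ℕ × ℕ → A) :
    ‖∑ p ∈ s, matrixUnit p.1 p.2 (φ (f p))‖ ≤ ‖∑ p ∈ s, matrixUnit p.1 p.2 (f p)‖ := by
  obtain ⟨m, hm⟩ : ∃ m, ∀ p ∈ s, p.1 < m ∧ p.2 < m := by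
    refine ⟨s.sup (fun p => max p.1 p.2) + 1, fun p hp => ?_⟩
    have hle := Finset.le_sup (f := fun p : ℕ × ℕ => max p.1 p.2) hp
    constructor <;> grind
  let N : CStarMatrix (Fin m) (Fin m) A :=
    CStarMatrix.ofMatrix (Matrix.of fun i j => if ((i : ℕ), (j : ℕ)) ∈ s then f (i, j) else 0)
  have hφN (i j) : CStarMatrix.mapₙₐ φ N i j =
      if ((i : ℕ), (j : ℕ)) ∈ s then φ (f (i, j)) else 0 := by
    change φ (if ((i : ℕ), (j : ℕ)) ∈ s then f (i, j) else 0) = _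
    rw [apply_ite φ, map_zero]
  calc ‖∑ p ∈ s, matrixUnit p.1 p.2 (φ (f p))‖ = ‖CStarMatrix.mapₙₐ φ N‖ := by
        rw [← cornerOp_eq_sum hm (fun p => φ (f p)) hφN, norm_cornerOp]
    _ ≤ ‖N‖ := NonUnitalStarAlgHom.norm_apply_le (CStarMatrix.mapₙₐ φ) N
    _ = ‖∑ p ∈ s, matrixUnit p.1 p.2 (f p)‖ := by
        rw [← cornerOp_eq_sum hm f (N := N) fun _ _ => rfl, norm_cornerOp]

namespace StdModule

/-- The operator `H_A → H_C` that applies a ⋆-homomorphism to the entries of a sequence. -/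
def map (φ : A →⋆ₙₐ[ℂ] C) : StdModule A →L[ℂ] StdModule C :=
  LinearMap.mkContinuous
    { toFun := fun x => ⟨fun n => φ (x n), by
        refine ((summable x x).map φ (map_continuous φ)).congr fun n => ?_
        rw [Function.comp_apply, map_mul, map_star]⟩
      map_add' := fun x y => StdModule.ext fun n => map_add φ (x n) (y n)
      map_smul' := fun c x => StdModule.ext fun n => map_smul φ c (x n) } 1
    fun x => by
      rw [one_mul]
      refine norm_le_of_forall_norm_trunc_le (norm_nonneg _) fun s =>
        (le_of_sq_le_sq ?_ (norm_nonneg _)).trans (norm_trunc_le s x)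
      rw [norm_trunc_sq, norm_trunc_sq]
      refine le_trans (le_of_eq ?_) (NonUnitalStarAlgHom.norm_apply_le φ _)
      simp only [map_sum, map_mul, map_star]
      rfl

theorem map_apply (φ : A →⋆ₙₐ[ℂ] C) (x : StdModule A) (n : ℕ) : map φ x n = φ (x n) := rfl

theorem inner_map (φ : A →⋆ₙₐ[ℂ] C) (x y : StdModule A) :
    (inner C (map φ x) (map φ y) : C) = φ (inner A x y) := by
  have hsum := (hasSum_inner x y).map φ (map_continuous φ)
  refine (hasSum_inner _ _).unique (hsum.congr_fun fun n => ?_)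
  rw [Function.comp_apply, _root_.map_mul, map_star]
  rfl

end StdModule

end MatrixUnit

/-! ### The graph of the closed derivation -/

namespace ClosedStarDerivation

variable {A B : Type*} [NonUnitalCStarAlgebra A] [NonUnitalCStarAlgebra B]
    {ρ : A →⋆ₙₐ[ℂ] B} (D : ClosedStarDerivation ρ)

/-- The graph of the closed derivation `δ : A_δ → B`. -/
def graph : Submodule ℂ (A × B) := D.ext.graph

theorem mem_graph (a : D.diffAlg) : ((a : A), D.dExt a) ∈ D.graph := D.ext.mem_graph a

theorem exists_of_mem_graph {a : A} {b : B} (h : (a, b) ∈ D.graph) :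
    ∃ h : a ∈ D.diffAlg, D.dExt ⟨a, h⟩ = b := by
  obtain ⟨⟨y, hy⟩, hya, hyb⟩ := D.ext.mem_graph_iff.1 h
  change y = a at hya
  subst hya
  exact ⟨hy, hyb⟩

theorem mem_diffAlg_of_mem_graph {a : A} {b : B} (h : (a, b) ∈ D.graph) : a ∈ D.diffAlg :=
  (D.exists_of_mem_graph h).1

theorem dExt_eq_of_mem_graph {a : A} {b : B} (h : (a, b) ∈ D.graph) (ha : a ∈ D.diffAlg) :
    D.dExt ⟨a, ha⟩ = b := (D.exists_of_mem_graph h).2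

variable [PartialOrder A] [StarOrderedRing A] [PartialOrder B] [StarOrderedRing B]

theorem graph_eq_closure : D.graph = D.pmap.graph.topologicalClosure :=
  D.isClosable_pmap.graph_closure_eq_closure_graph.symm

theorem isClosed_graph : IsClosed (D.graph : Set (A × B)) := by
  rw [graph_eq_closure]
  exact Submodule.isClosed_topologicalClosure _

theorem dom_mem_graph (a : D.dom) : ((a : A), D.δ a) ∈ D.graph := by
  rw [graph_eq_closure]
  exact Submodule.le_topologicalClosure _ (D.pmap.mem_graph a)

theorem mem_closure_iff_mem_graph {p : A × B} :
    p ∈ closure (Set.range fun a : D.dom => ((a : A), D.δ a)) ↔ p ∈ D.graph := by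
  have hrange : (Set.range fun a : D.dom => ((a : A), D.δ a)) = (D.pmap.graph : Set (A × B)) := by
    ext p
    exact (LinearPMap.mem_graph_iff' D.pmap).symm
  rw [graph_eq_closure, ← SetLike.mem_coe, Submodule.topologicalClosure_coe, hrange]

theorem mul_mem_graph {p q : A × B} (hp : p ∈ D.graph) (hq : q ∈ D.graph) :
    (p.1 * q.1, p.2 * ρ q.1 + ρ p.1 * q.2) ∈ D.graph := by
  rw [← mem_closure_iff_mem_graph] at hp hq ⊢
  have hρ : Continuous ρ := map_continuous ρ
  refine map_mem_closure₂ (f := fun p q : A × B => (p.1 * q.1, p.2 * ρ q.1 + ρ p.1 * q.2))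
    (by fun_prop) hp hq ?_
  rintro _ ⟨a, rfl⟩ _ ⟨b, rfl⟩
  exact ⟨a * b, Prod.ext rfl (D.map_mul a b)⟩

theorem star_mem_graph {p : A × B} (hp : p ∈ D.graph) : (star p.1, -star p.2) ∈ D.graph := by
  rw [← mem_closure_iff_mem_graph] at hp ⊢
  refine map_mem_closure (f := fun p : A × B => (star p.1, -star p.2)) (by fun_prop) hp ?_
  rintro _ ⟨a, rfl⟩
  exact ⟨star a, Prod.ext rfl (D.map_star a)⟩

/-- The relation `δ(x) = y` between sequences `x ∈ H_A` and `y ∈ H_B`. -/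
def StdGraph (x : StdModule A) (y : StdModule B) : Prop := ∀ n, (x n, y n) ∈ D.graph

variable {D}

theorem exists_stdGraph {x : StdModule A} (hx : x ∈ D.diffStd) : ∃ y, D.StdGraph x y :=
  ⟨⟨_, hx.choose_spec⟩, fun n => D.mem_graph ⟨x n, hx.choose n⟩⟩

namespace StdGraph

variable {x x' : StdModule A} {y y' : StdModule B}

theorem mem_diffStd (h : D.StdGraph x y) : x ∈ D.diffStd := by
  refine ⟨fun n => D.mem_diffAlg_of_mem_graph (h n), ?_⟩
  rw [show (fun n => D.dExt ⟨x n, D.mem_diffAlg_of_mem_graph (h n)⟩) = y from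
    funext fun n => D.dExt_eq_of_mem_graph (h n) _]
  exact y.2

theorem incl_dStd (h : D.StdGraph x y) (hx : x ∈ D.diffStd) (n : ℕ) :
    D.incl (D.dStd ⟨x, hx⟩ n) = y n :=
  D.dExt_eq_of_mem_graph (h n) _

theorem zero : D.StdGraph 0 0 := fun _ => zero_mem _

theorem add (h : D.StdGraph x y) (h' : D.StdGraph x' y') : D.StdGraph (x + x') (y + y') :=
  fun n => add_mem (h n) (h' n)

theorem op_smul (h : D.StdGraph x y) {a : A} {b : B} (hab : (a, b) ∈ D.graph) :
    D.StdGraph (x <• a) (y <• ρ a + StdModule.map ρ x <• b) :=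
  fun n => D.mul_mem_graph (h n) hab

theorem of_tendsto {ι : Type*} {l : Filter ι} [l.NeBot] {u : ι → StdModule A} {v : ι → StdModule B}
    (h : ∀ i, D.StdGraph (u i) (v i)) (hu : Tendsto u l (𝓝 x)) (hv : Tendsto v l (𝓝 y)) :
    D.StdGraph x y := fun n =>
  D.isClosed_graph.mem_of_tendsto
    ((((StdModule.continuous_eval n).tendsto _).comp hu).prodMk_nhds
      (((StdModule.continuous_eval n).tendsto _).comp hv)) (Eventually.of_forall fun i => h i n)

theorem inner (h : D.StdGraph x y) (h' : D.StdGraph x' y') : ((inner A x x' : A),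
    (inner B (StdModule.map ρ x) y' - inner B y (StdModule.map ρ x') : B)) ∈ D.graph := by
  have hsum := (StdModule.hasSum_inner x x').prodMk
    ((StdModule.hasSum_inner (StdModule.map ρ x) y').sub
      (StdModule.hasSum_inner y (StdModule.map ρ x')))
  refine D.isClosed_graph.mem_of_tendsto hsum (Eventually.of_forall fun s =>
    Submodule.sum_mem _ fun n _ => ?_)
  convert D.mul_mem_graph (D.star_mem_graph (h n)) (h' n) using 2
  simp only [StdModule.map_apply]
  rw [neg_mul, neg_add_eq_sub, show ρ (star (x n)) = star (ρ (x n)) from StarHomClass.map_star ρ _]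

end StdGraph

/-! ### Differentiable matrices -/

variable (A B) in
/-- Triples `(T, R, S)` with `T` on `H_A` and `R`, `S` on `H_B`. For a matrix `M` over `A_δ` the
relevant triple is `(M, ρ(M), δ(M))`. -/
abbrev OpTriple : Type _ := (StdModule A →L[ℂ] StdModule A) ×
  (StdModule B →L[ℂ] StdModule B) × (StdModule B →L[ℂ] StdModule B)

variable (D)

/-- The linear map `M ↦ (M, ρ(M), δ(M))` on finite matrices over `𝒜`. -/
def tripleMap : ((ℕ × ℕ) →₀ D.dom) →ₗ[ℂ] OpTriple A B :=
  Finsupp.lsum ℂ fun p =>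
    { toFun := fun a => (matrixUnit p.1 p.2 (a : A), matrixUnit p.1 p.2 (ρ a),
        matrixUnit p.1 p.2 (D.δ a))
      map_add' := fun a b => by
        simp only [NonUnitalStarSubalgebra.coe_add, map_add, matrixUnit_add, Prod.mk_add_mk]
      map_smul' := fun c a => by
        simp only [NonUnitalStarSubalgebra.coe_smul, map_smul, matrixUnit_smul, Prod.smul_mk,
          RingHom.id_apply] }

theorem tripleMap_single (p : ℕ × ℕ) (a : D.dom) : D.tripleMap (Finsupp.single p a) =
    (matrixUnit p.1 p.2 (a : A), matrixUnit p.1 p.2 (ρ a), matrixUnit p.1 p.2 (D.δ a)) :=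
  Finsupp.lsum_single _ _ _ _

theorem tripleMap_apply (M : (ℕ × ℕ) →₀ D.dom) : D.tripleMap M =
    (D.matOp M, M.sum fun p a => matrixUnit p.1 p.2 (ρ a), D.matOpD M) := by
  rw [tripleMap, Finsupp.lsum_apply, Finsupp.sum]
  refine Prod.ext ?_ (Prod.ext ?_ ?_)
  · exact Prod.fst_sum
  · exact (congrArg Prod.fst Prod.snd_sum).trans Prod.fst_sum
  · exact (congrArg Prod.snd Prod.snd_sum).trans Prod.snd_sum

theorem norm_tripleMap_le (M : (ℕ × ℕ) →₀ D.dom) :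
    ‖(D.tripleMap M).2.1‖ ≤ ‖(D.tripleMap M).1‖ := by
  rw [tripleMap_apply]
  exact norm_sum_matrixUnit_map_le ρ M.support fun p => (M p : A)

/-- The closure of the set of the triples `(M, ρ(M), δ(M))` with `M` a finite matrix over `𝒜`: it
is the graph of `δ` on `𝒦(H_A)_δ`, together with the operator `ρ(M)` needed in the Leibniz rule. -/
def triples : Submodule ℂ (OpTriple A B) := (LinearMap.range D.tripleMap).topologicalClosure

theorem isClosed_triples : IsClosed (D.triples : Set (OpTriple A B)) :=
  Submodule.isClosed_topologicalClosure _

theorem tripleMap_mem_triples (M : (ℕ × ℕ) →₀ D.dom) : D.tripleMap M ∈ D.triples :=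
  Submodule.le_topologicalClosure _ ⟨M, rfl⟩

theorem exists_tendsto_tripleMap {t : OpTriple A B} (h : t ∈ D.triples) :
    ∃ M : ℕ → (ℕ × ℕ) →₀ D.dom, Tendsto (fun k => D.tripleMap (M k)) atTop (𝓝 t) := by
  obtain ⟨u, hu, hlim⟩ := mem_closure_iff_seq_limit.1 h
  choose M hM using hu
  exact ⟨M, hlim.congr fun k => (hM k).symm⟩

theorem isDiffCompact_of_mem_triples {t : OpTriple A B} (h : t ∈ D.triples) :
    D.IsDiffCompact t.1 := by
  obtain ⟨M, hlim⟩ := D.exists_tendsto_tripleMap h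
  simp only [tripleMap_apply] at hlim
  exact ⟨M, (continuous_fst.tendsto _).comp hlim,
    (((continuous_snd.comp continuous_snd).tendsto _).comp hlim).cauchySeq⟩

theorem exists_triple_of_isDiffCompact {T : StdModule A →L[ℂ] StdModule A}
    (h : D.IsDiffCompact T) : ∃ R S, (T, R, S) ∈ D.triples := by
  obtain ⟨M, hM, hδM⟩ := h
  obtain ⟨S, hS⟩ := cauchySeq_tendsto_of_complete hδM
  have hmem (k : ℕ) := D.tripleMap_mem_triples (M k)
  have hle (m n : ℕ) := D.norm_tripleMap_le (M m - M n)
  simp only [map_sub, Prod.snd_sub, Prod.fst_sub] at hle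
  simp only [tripleMap_apply] at hmem hle
  have hρM : CauchySeq fun k => (M k).sum fun p a => matrixUnit p.1 p.2 (ρ a) := by
    refine Metric.cauchySeq_iff.2 fun ε hε => ?_
    refine (Metric.cauchySeq_iff.1 hM.cauchySeq ε hε).imp fun N hN m hm n hn => ?_
    have hdist := hN m hm n hn
    rw [dist_eq_norm] at hdist ⊢
    exact (hle m n).trans_lt hdist
  obtain ⟨R, hR⟩ := cauchySeq_tendsto_of_complete hρM
  exact ⟨R, S, D.isClosed_triples.mem_of_tendsto (hM.prodMk_nhds (hR.prodMk_nhds hS))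
    (Eventually.of_forall hmem)⟩

theorem stdGraph_tripleMap (M : (ℕ × ℕ) →₀ D.dom) {x : StdModule A} {y : StdModule B}
    (hx : D.StdGraph x y) : D.StdGraph ((D.tripleMap M).1 x)
      ((D.tripleMap M).2.2 (StdModule.map ρ x) + (D.tripleMap M).2.1 y) := by
  induction M using Finsupp.induction_linear with
  | zero =>
    simp only [map_zero, Prod.fst_zero, Prod.snd_zero, _root_.zero_apply, add_zero]
    exact StdGraph.zero
  | add M N hM hN =>
    convert hM.add hN using 1
    · rw [map_add]; rfl
    · rw [map_add, Prod.snd_add, Prod.snd_add, Prod.fst_add, _root_.add_apply, _root_.add_apply]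
      abel
  | single p a =>
    rw [tripleMap_single]
    intro n
    rw [StdModule.add_apply]
    simp only [matrixUnit_apply_apply]
    split_ifs
    · exact D.mul_mem_graph (D.dom_mem_graph a) (hx p.2)
    · rw [add_zero]; exact zero_mem _

theorem stdGraph_of_mem_triples {T : StdModule A →L[ℂ] StdModule A}
    {R S : StdModule B →L[ℂ] StdModule B} (h : (T, R, S) ∈ D.triples) {x : StdModule A}
    {y : StdModule B} (hx : D.StdGraph x y) :
    D.StdGraph (T x) (S (StdModule.map ρ x) + R y) := by
  obtain ⟨M, hlim⟩ := D.exists_tendsto_tripleMap h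
  have hcont : Continuous fun t : OpTriple A B =>
      (t.1 x, t.2.2 (StdModule.map ρ x) + t.2.1 y) := by fun_prop
  have happly := (hcont.tendsto _).comp hlim
  exact StdGraph.of_tendsto (fun k => D.stdGraph_tripleMap (M k) hx)
    ((continuous_fst.tendsto _).comp happly) ((continuous_snd.tendsto _).comp happly)

/-- The product of triples in which the last component obeys the Leibniz rule
`δ(MN) = δ(M) ρ(N) + ρ(M) δ(N)`. -/
def tripleMul (s t : OpTriple A B) : OpTriple A B :=
  (s.1 * t.1, s.2.1 * t.2.1, s.2.2 * t.2.1 + s.2.1 * t.2.2)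

theorem tripleMul_single_mem (p q : ℕ × ℕ) (a b : D.dom) :
    tripleMul (D.tripleMap (Finsupp.single p a)) (D.tripleMap (Finsupp.single q b)) ∈
      LinearMap.range D.tripleMap := by
  rw [tripleMap_single, tripleMap_single]
  simp only [tripleMul, matrixUnit_mul]
  split_ifs with hpq
  · refine ⟨Finsupp.single (p.1, q.2) (a * b), ?_⟩
    rw [tripleMap_single, D.map_mul, matrixUnit_add]
    exact Prod.ext rfl (Prod.ext (congrArg (matrixUnit p.1 q.2) (_root_.map_mul ρ (a : A) b)) rfl)
  · rw [add_zero]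
    exact zero_mem _

theorem tripleMul_tripleMap_mem (M N : (ℕ × ℕ) →₀ D.dom) :
    tripleMul (D.tripleMap M) (D.tripleMap N) ∈ LinearMap.range D.tripleMap := by
  induction M using Finsupp.induction_linear with
  | zero =>
    simp only [tripleMul, map_zero, Prod.fst_zero, Prod.snd_zero, zero_mul, add_zero]
    exact zero_mem _
  | add M M' hM hM' =>
    convert add_mem hM hM' using 1
    simp only [tripleMul, map_add, Prod.fst_add, Prod.snd_add, add_mul, Prod.mk_add_mk]
    congr 2
    abel
  | single p a =>
    induction N using Finsupp.induction_linear with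
    | zero =>
      simp only [tripleMul, map_zero, Prod.fst_zero, Prod.snd_zero, mul_zero, add_zero]
      exact zero_mem _
    | add N N' hN hN' =>
      convert add_mem hN hN' using 1
      simp only [tripleMul, map_add, Prod.fst_add, Prod.snd_add, mul_add, Prod.mk_add_mk]
      congr 2
      abel
    | single q b => exact D.tripleMul_single_mem p q a b

theorem tripleMul_mem_triples {s t : OpTriple A B} (hs : s ∈ D.triples) (ht : t ∈ D.triples) :
    tripleMul s t ∈ D.triples := by
  refine map_mem_closure₂ (by unfold tripleMul; fun_prop) hs ht ?_
  rintro _ ⟨M, rfl⟩ _ ⟨N, rfl⟩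
  exact D.tripleMul_tripleMap_mem M N

end ClosedStarDerivation

/-! ### The operator `W ⊗ 1` -/

namespace InteriorTensor

open HilbertCMod

variable {A C X : Type*} [NonUnitalCStarAlgebra A] [PartialOrder A] [StarOrderedRing A]
    [NonUnitalCStarAlgebra C] [PartialOrder C] [StarOrderedRing C]
    [NormedAddCommGroup X] [NormedSpace ℂ X] [SMul Aᵐᵒᵖ X] [HilbertCMod A X]
    (φ : A →⋆ₙₐ[ℂ] C) (W : Adjointable A X (StdModule A))

/-- The map `ξ ⊗ ω ↦ (φ(W(ξ)ₙ) ω)ₙ` on the algebraic tensor product. -/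
def preAmp : PreTensor X φ →ₗ[ℂ] StdModule C :=
  TensorProduct.lift (LinearMap.mk₂ ℂ (fun ξ ω => StdModule.map φ (W.toCLM ξ) <• ω)
    (fun ξ η ω => by rw [map_add, map_add, HilbertCMod.add_op_smul])
    (fun c ξ ω => by rw [map_smul, map_smul, HilbertCMod.smul_op_smul])
    (fun ξ ω θ => HilbertCMod.op_smul_add _ _ _)
    (fun c ξ ω => HilbertCMod.op_smul_smul _ _ _))

theorem preAmp_tmul (ξ : X) (ω : C) :
    preAmp φ W (PreTensor.tmul φ ξ ω) = StdModule.map φ (W.toCLM ξ) <• ω := rfl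

variable {W}

theorem inner_preAmp (hW : ∀ ξ η, (inner A (W.toCLM ξ) (W.toCLM η) : A) = inner A ξ η)
    (x y : PreTensor X φ) :
    (inner C (preAmp φ W x) (preAmp φ W y) : C) = PreTensor.sesq φ x y := by
  induction x using PreTensor.induction_on with
  | zero => rw [map_zero, map_zero, HilbertCMod.inner_zero_left, LinearMap.zero_apply]
  | add x x' hx hx' =>
    rw [map_add, map_add, HilbertCMod.inner_add_left, LinearMap.add_apply, hx, hx']
  | tmul ξ ω =>
    induction y using PreTensor.induction_on with
    | zero => rw [map_zero, map_zero, HilbertCMod.inner_zero_right]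
    | add y y' hy hy' => rw [map_add, map_add, HilbertCMod.inner_add_right, hy, hy']
    | tmul η θ =>
      rw [preAmp_tmul, preAmp_tmul, HilbertCMod.inner_smul_left, HilbertCMod.inner_smul_right,
        StdModule.inner_map, hW]
      rfl

/-- The continuous extension of `ξ ⊗ ω ↦ (φ(W(ξ)ₙ) ω)ₙ` for an isometry `W`. -/
def ampCLM (hW : ∀ ξ η, (inner A (W.toCLM ξ) (W.toCLM η) : A) = inner A ξ η) :
    InteriorTensor X φ →L[ℂ] StdModule C :=
  ((preAmp φ W).mkContinuous 1 fun z => by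
    refine le_of_sq_le_sq ?_ (by positivity)
    rw [norm_sq_eq (A := C), inner_preAmp φ hW, one_mul, pow_two]
    exact PreTensor.norm_sesq_le φ z z).extend (ι φ)

variable (hW : ∀ ξ η, (inner A (W.toCLM ξ) (W.toCLM η) : A) = inner A ξ η)

theorem ampCLM_ι (z : PreTensor X φ) : ampCLM φ hW (ι φ z) = preAmp φ W z :=
  ContinuousLinearMap.extend_eq _ (denseRange_ι φ) (isUniformInducing_ι φ) z

theorem ampCLM_tmul (ξ : X) (ω : C) :
    ampCLM φ hW (tmul φ ξ ω) = StdModule.map φ (W.toCLM ξ) <• ω := ampCLM_ι φ hW _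

theorem inner_ampCLM (x y : InteriorTensor X φ) :
    (inner C (ampCLM φ hW x) (ampCLM φ hW y) : C) = inner C x y := by
  have hcont := (ampCLM φ hW).continuous
  induction x using induction_ι with
  | hc =>
    exact isClosed_eq ((continuous_inner_left (A := C) _).comp hcont)
      ((continuous_inner φ).comp (continuous_id.prodMk continuous_const))
  | h x =>
    induction y using induction_ι with
    | hc =>
      exact isClosed_eq ((continuous_inner_right (A := C) _).comp hcont)
        ((continuous_inner φ).comp (continuous_const.prodMk continuous_id))
    | h y => rw [ampCLM_ι, ampCLM_ι, inner_preAmp φ hW, inner_ι]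

variable {ζ : ℕ → X} (hζ : ∀ η n, W.toCLM η n = inner A (ζ n) η)

include hζ in
theorem inner_tmul_eq_star_mul_ampCLM (n : ℕ) (ω : C) (z : InteriorTensor X φ) :
    (inner C (tmul φ (ζ n) ω) z : C) = star ω * ampCLM φ hW z n := by
  induction z using induction_ι with
  | hc =>
    exact isClosed_eq (continuous_inner_right _)
      (continuous_const.mul ((StdModule.continuous_eval n).comp (ampCLM φ hW).continuous))
  | h z =>
    rw [ampCLM_ι, tmul, inner_ι, PreTensor.sesq_tmul_left]
    congr 1
    induction z using PreTensor.induction_on with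
    | zero => rw [map_zero, map_zero, StdModule.zero_apply]
    | add x y hx hy => rw [map_add, map_add, StdModule.add_apply, hx, hy]
    | tmul η θ =>
      rw [PreTensor.contract_tmul, preAmp_tmul, StdModule.op_smul_apply, StdModule.map_apply, hζ]

/-- The adjointable operator `W ⊗ 1` for an isometry `W` given by a frame. -/
def amp : Adjointable C (InteriorTensor X φ) (StdModule C) :=
  Adjointable.ofCoords (ampCLM φ hW) (fun n => (creation φ (ζ n)).toCLM.toLinearMap)
    (inner_tmul_eq_star_mul_ampCLM φ hW hζ)

theorem amp_tmul (ξ : X) (ω : C) :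
    (amp φ hW hζ).toCLM (tmul φ ξ ω) = StdModule.map φ (W.toCLM ξ) <• ω := ampCLM_tmul φ hW ξ ω

theorem amp_adj_amp (z : InteriorTensor X φ) :
    (amp φ hW hζ).adj ((amp φ hW hζ).toCLM z) = z :=
  ext_inner (A := C) fun w => by
    rw [← (amp φ hW hζ).inner_adj]
    exact inner_ampCLM φ hW w z

theorem creation_adj_amp_adj (ξ : X) (y : StdModule C) :
    (creation φ ξ).adj ((amp φ hW hζ).adj y) = inner C (StdModule.map φ (W.toCLM ξ)) y :=
  ext_inner (A := C) fun ω => by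
    rw [← (creation φ ξ).inner_adj, ← (amp φ hW hζ).inner_adj, creation_apply, amp_tmul,
      HilbertCMod.inner_smul_left]
    rfl

end InteriorTensor

/-! ### The Graßmann connection of an absorption triple -/

namespace ClosedStarDerivation

open HilbertCMod

variable {A B : Type*} [NonUnitalCStarAlgebra A] [PartialOrder A] [StarOrderedRing A]
    [NonUnitalCStarAlgebra B] [PartialOrder B] [StarOrderedRing B]
    {ρ : A →⋆ₙₐ[ℂ] B} (D : ClosedStarDerivation ρ)

theorem incl_injective : Function.Injective D.incl := Subtype.val_injective

theorem stdGraph_dStd (x : D.diffStd) :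
    D.StdGraph (x : StdModule A) (StdModule.map D.incl (D.dStd x)) := fun n =>
  D.mem_graph ⟨x.1 n, x.2.choose n⟩

theorem dStd_op_smul {x : StdModule A} (hx : x ∈ D.diffStd) (a : D.diffAlg)
    (hxa : x <• (a : A) ∈ D.diffStd) :
    D.dStd ⟨x <• (a : A), hxa⟩ = D.dStd ⟨x, hx⟩ <• D.rho a + StdModule.map D.rho x <• D.d a :=
  StdModule.ext fun n => D.incl_injective
    (((D.stdGraph_dStd ⟨x, hx⟩).op_smul (D.mem_graph a)).incl_dStd hxa n)

theorem op_smul_mem_diffStd {x : StdModule A} (hx : x ∈ D.diffStd) (a : D.diffAlg) :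
    x <• (a : A) ∈ D.diffStd :=
  ((D.stdGraph_dStd ⟨x, hx⟩).op_smul (D.mem_graph a)).mem_diffStd

theorem inner_mem_diffAlg {x y : StdModule A} (hx : x ∈ D.diffStd) (hy : y ∈ D.diffStd) :
    (inner A x y : A) ∈ D.diffAlg :=
  D.mem_diffAlg_of_mem_graph ((D.stdGraph_dStd ⟨x, hx⟩).inner (D.stdGraph_dStd ⟨y, hy⟩))

theorem d_inner {x y : StdModule A} (hx : x ∈ D.diffStd) (hy : y ∈ D.diffStd) :
    D.d ⟨inner A x y, D.inner_mem_diffAlg hx hy⟩ =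
      inner D.Forms (StdModule.map D.rho x) (D.dStd ⟨y, hy⟩) -
        star (inner D.Forms (StdModule.map D.rho y) (D.dStd ⟨x, hx⟩)) := by
  apply D.incl_injective
  rw [HilbertCMod.star_inner, _root_.map_sub, ← StdModule.inner_map, ← StdModule.inner_map]
  exact D.dExt_eq_of_mem_graph ((D.stdGraph_dStd ⟨x, hx⟩).inner (D.stdGraph_dStd ⟨y, hy⟩)) _

theorem single_mem_diffStd (n : ℕ) (a : D.dom) : StdModule.single n (a : A) ∈ D.diffStd := by
  have hgraph : D.StdGraph (StdModule.single n (a : A)) (StdModule.single n (D.δ a)) := fun k => by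
    rw [StdModule.single_apply, StdModule.single_apply]
    split_ifs
    · exact D.dom_mem_graph a
    · exact zero_mem _
  exact hgraph.mem_diffStd

theorem dense_diffStd : Dense (D.diffStd : Set (StdModule A)) := fun x => by
  rw [← Submodule.topologicalClosure_coe]
  have hsingle (n : ℕ) (a : A) : StdModule.single n a ∈ D.diffStd.topologicalClosure :=
    map_mem_closure (StdModule.singleCLM A n).continuous (D.dense_dom a)
      fun b hb => D.single_mem_diffStd n ⟨b, hb⟩
  exact D.diffStd.isClosed_topologicalClosure.mem_of_tendsto (StdModule.hasSum_single x)
    (Eventually.of_forall fun s => Submodule.sum_mem _ fun n _ => hsingle n _)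

variable {X : Type*} [NormedAddCommGroup X] [NormedSpace ℂ X] [SMul Aᵐᵒᵖ X] [HilbertCMod A X]
    {W : Adjointable A X (StdModule A)} {K : Adjointable A (StdModule A) (StdModule A)}

theorem op_smul_mem_grassmannDomain (η : D.grassmannDomain W K) (a : D.diffAlg) :
    (η : X) <• (a : A) ∈ D.grassmannDomain W K := by
  obtain ⟨x, hx, hxη⟩ := η.2
  refine ⟨x <• (a : A), D.op_smul_mem_diffStd hx a, ?_⟩
  rw [← hxη]
  change W.adj (K.toCLM (K.toCLM (x <• (a : A)))) = W.adj (K.toCLM (K.toCLM x)) <• (a : A)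
  rw [K.map_op_smul, K.map_op_smul, W.adj_op_smul]

variable {D}

namespace IsAbsorption

variable {ζ : ℕ → X} (h : D.IsAbsorption W K ζ)

include h

theorem adj_apply (ξ : X) : W.adj (W.toCLM ξ) = ξ := DFunLike.congr_fun h.isometry ξ

theorem inner_apply (ξ η : X) : (inner A (W.toCLM ξ) (W.toCLM η) : A) = inner A ξ η := by
  rw [W.inner_adj, h.adj_apply]

theorem commute_apply (x : StdModule A) :
    K.toCLM (W.toCLM (W.adj x)) = W.toCLM (W.adj (K.toCLM x)) := DFunLike.congr_fun h.commute x

theorem dense_grassmannDomain : Dense (D.grassmannDomain W K : Set X) := by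
  have hsq : DenseRange ((W.adj ∘L K.toCLM ∘L W.toCLM) ∘ (W.adj ∘L K.toCLM ∘L W.toCLM)) :=
    h.dense.comp h.dense (ContinuousLinearMap.continuous _)
  have hrange : DenseRange (W.adj ∘L K.toCLM ∘L K.toCLM) := by
    refine hsq.mono ?_
    rintro _ ⟨x, rfl⟩
    refine ⟨W.toCLM x, ?_⟩
    simp only [ContinuousLinearMap.comp_apply, Function.comp_apply]
    rw [h.commute_apply, h.adj_apply]
  exact hrange.dense_image (ContinuousLinearMap.continuous _) D.dense_diffStd

theorem apply_mem_diffStd (ξ : D.grassmannDomain W K) : W.toCLM ξ ∈ D.diffStd := by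
  obtain ⟨x, hx, hxξ⟩ := ξ.2
  obtain ⟨R, S, hRS⟩ := D.exists_triple_of_isDiffCompact h.diffCompact
  obtain ⟨y, hy⟩ := exists_stdGraph hx
  rw [← hxξ]
  exact (D.stdGraph_of_mem_triples hRS hy).mem_diffStd

theorem inner_mem_diffAlg (ξ η : D.grassmannDomain W K) :
    (inner A (ξ : X) (η : X) : A) ∈ D.diffAlg := by
  rw [← h.inner_apply]
  exact D.inner_mem_diffAlg (h.apply_mem_diffStd ξ) (h.apply_mem_diffStd η)

/-- The operator `W ⊗ 1 : X ⊗̂_A Ω_δ(A) → H_{Ω_δ(A)}`. -/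
def amp : Adjointable D.Forms (InteriorTensor X D.rho) (StdModule D.Forms) :=
  InteriorTensor.amp D.rho h.inner_apply h.frame

theorem amp_tmul (ξ : X) (ω : D.Forms) : h.amp.toCLM (InteriorTensor.tmul D.rho ξ ω) =
    StdModule.map D.rho (W.toCLM ξ) <• ω :=
  InteriorTensor.amp_tmul D.rho h.inner_apply h.frame ξ ω

theorem amp_adj_amp (z : InteriorTensor X D.rho) : h.amp.adj (h.amp.toCLM z) = z :=
  InteriorTensor.amp_adj_amp D.rho h.inner_apply h.frame z

/-- The Graßmann connection `∇_δ = (W⋆ ⊗ 1) δ W`. -/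
def grassmannConnection : D.grassmannDomain W K →ₗ[ℂ] InteriorTensor X D.rho :=
  h.amp.adj.toLinearMap ∘ₗ D.dStd ∘ₗ
    LinearMap.codRestrict D.diffStd (W.toCLM.toLinearMap ∘ₗ Submodule.subtype _)
      h.apply_mem_diffStd

theorem grassmannConnection_apply (ξ : D.grassmannDomain W K) : h.grassmannConnection ξ =
    h.amp.adj (D.dStd ⟨W.toCLM ξ, h.apply_mem_diffStd ξ⟩) := rfl

theorem creation_adj_grassmannConnection (ξ : X) (η : D.grassmannDomain W K) :
    (InteriorTensor.creation D.rho ξ).adj (h.grassmannConnection η) =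
      inner D.Forms (StdModule.map D.rho (W.toCLM ξ))
        (D.dStd ⟨W.toCLM η, h.apply_mem_diffStd η⟩) :=
  InteriorTensor.creation_adj_amp_adj D.rho h.inner_apply h.frame ξ _

theorem d_inner_eq_grassmannConnection (ξ η : D.grassmannDomain W K) :
    D.d ⟨inner A (ξ : X) (η : X), h.inner_mem_diffAlg ξ η⟩ =
      (InteriorTensor.creation D.rho (ξ : X)).adj (h.grassmannConnection η) -
        star ((InteriorTensor.creation D.rho (η : X)).adj (h.grassmannConnection ξ)) := by
  have hinner := D.d_inner (h.apply_mem_diffStd ξ) (h.apply_mem_diffStd η)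
  simp only [h.inner_apply] at hinner
  rw [hinner, creation_adj_grassmannConnection, creation_adj_grassmannConnection]

theorem grassmannConnection_op_smul (η : D.grassmannDomain W K) (a : D.diffAlg) :
    h.grassmannConnection ⟨(η : X) <• (a : A), D.op_smul_mem_grassmannDomain η a⟩ =
      h.grassmannConnection η <• D.rho a + InteriorTensor.tmul D.rho (η : X) (D.d a) := by
  have hWη := h.apply_mem_diffStd η
  calc h.grassmannConnection ⟨(η : X) <• (a : A), D.op_smul_mem_grassmannDomain η a⟩
      = h.amp.adj (D.dStd ⟨W.toCLM η <• (a : A), D.op_smul_mem_diffStd hWη a⟩) := by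
        simp only [grassmannConnection_apply, W.map_op_smul]
    _ = h.amp.adj (D.dStd ⟨W.toCLM η, hWη⟩) <• D.rho a +
          h.amp.adj (h.amp.toCLM (InteriorTensor.tmul D.rho (η : X) (D.d a))) := by
        rw [D.dStd_op_smul hWη, map_add, h.amp.adj_op_smul, h.amp_tmul]
    _ = h.grassmannConnection η <• D.rho a + InteriorTensor.tmul D.rho (η : X) (D.d a) := by
        rw [h.amp_adj_amp, grassmannConnection_apply]

end IsAbsorption

end ClosedStarDerivation

/-! ### Blocks of the standard module -/

namespace StdModule

open HilbertCMod

variable {A : Type*} [NonUnitalCStarAlgebra A] [PartialOrder A] [StarOrderedRing A]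

/-- The operator `x ↦ (x_{e(n)})ₙ`. -/
def pull (e : ℕ → ℕ) (he : Function.Injective e) : StdModule A →L[ℂ] StdModule A :=
  LinearMap.mkContinuous
    { toFun := fun x => ⟨fun n => x (e n), (summable x x).comp_injective he⟩
      map_add' := fun x y => rfl
      map_smul' := fun c x => rfl } 1
    fun x => by
      rw [one_mul]
      refine norm_le_of_forall_norm_trunc_le (norm_nonneg _) fun s => ?_
      refine le_trans (le_of_eq ?_) (norm_trunc_le (s.map ⟨e, he⟩) x)
      rw [← sq_eq_sq₀ (norm_nonneg _) (norm_nonneg _), norm_trunc_sq, norm_trunc_sq,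
        Finset.sum_map]
      rfl

theorem norm_pull_le (e : ℕ → ℕ) (he : Function.Injective e) : ‖pull (A := A) e he‖ ≤ 1 :=
  LinearMap.mkContinuous_norm_le _ zero_le_one _

/-- The operator that cuts out the `m`-th block of a sequence indexed by pairs, where pairs of
natural numbers are encoded by `Nat.pair`; its adjoint embeds `H_A` as the `m`-th block. -/
def block (A : Type*) [NonUnitalCStarAlgebra A] [PartialOrder A] [StarOrderedRing A] (m : ℕ) :
    Adjointable A (StdModule A) (StdModule A) :=
  Adjointable.ofCoords (pull (Nat.pair m) fun _ _ h => (Nat.pair_eq_pair.1 h).2)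
    (fun n => (singleCLM A (Nat.pair m n)).toLinearMap)
    fun _ _ _ => inner_single_left _ _ _

theorem block_apply (m : ℕ) (x : StdModule A) (n : ℕ) :
    (block A m).toCLM x n = x (Nat.pair m n) := rfl

theorem block_adj_apply (m : ℕ) (y : StdModule A) (k n : ℕ) :
    (block A m).adj y (Nat.pair k n) = if k = m then y n else 0 := by
  have hsum : HasSum (fun l => single (Nat.pair m l) (y l)) ((block A m).adj y) :=
    Adjointable.hasSum_ofCoords_adj _ _ _ y
  refine (hsum.map (evalCLM A (Nat.pair k n)) (evalCLM A _).continuous).unique ?_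
  refine (hasSum_ite_eq n _).congr_fun fun l => ?_
  rw [Function.comp_apply, evalCLM_apply, single_apply]
  by_cases hl : l = n
  · simp only [hl, Nat.pair_eq_pair, and_true, if_true]
  · simp only [hl, Ne.symm hl, Nat.pair_eq_pair, and_false, if_false]

theorem ext_pair {x y : StdModule A} (h : ∀ m n, x (Nat.pair m n) = y (Nat.pair m n)) : x = y :=
  ext fun p => by rw [← Nat.pair_unpair p]; exact h _ _

theorem block_sum_adj {s : Finset ℕ} {m : ℕ} (hm : m ∈ s) (y : ℕ → StdModule A) :
    (block A m).toCLM (∑ k ∈ s, (block A k).adj (y k)) = y m := by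
  ext n
  rw [block_apply, sum_apply]
  simp only [block_adj_apply]
  rw [Finset.sum_ite_eq, if_pos hm]

theorem norm_block_le (m : ℕ) : ‖(block A m).toCLM‖ ≤ 1 :=
  norm_pull_le (Nat.pair m) fun _ _ h => (Nat.pair_eq_pair.1 h).2

theorem norm_block_adj_le (m : ℕ) : ‖(block A m).adj‖ ≤ 1 := by
  rw [← (IsAdjPair.of_adjointable (block A m)).norm_eq]
  exact norm_block_le m

/-- The operator on `H_A` with `(m, k)`-block `T` and all other blocks equal to `0`. -/
def blockUnit (m k : ℕ) :
    (StdModule A →L[ℂ] StdModule A) →L[ℂ] (StdModule A →L[ℂ] StdModule A) :=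
  ContinuousLinearMap.mulLeftRight ℂ _ (block A m).adj (block A k).toCLM

theorem blockUnit_apply (m k : ℕ) (T : StdModule A →L[ℂ] StdModule A) :
    blockUnit m k T = (block A m).adj * T * (block A k).toCLM := rfl

theorem norm_blockUnit_le (m k : ℕ) : ‖blockUnit (A := A) m k‖ ≤ 1 :=
  (ContinuousLinearMap.opNorm_mulLeftRight_apply_apply_le ..).trans
    (mul_le_one₀ (norm_block_adj_le m) (norm_nonneg _) (norm_block_le k))

theorem blockUnit_matrixUnit (m k i j : ℕ) (a : A) :
    blockUnit m k (matrixUnit i j a) = matrixUnit (Nat.pair m i) (Nat.pair k j) a := by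
  refine ContinuousLinearMap.ext fun x => ext_pair fun p q => ?_
  rw [blockUnit_apply, mul_apply_eq_comp, mul_apply_eq_comp, block_adj_apply,
    matrixUnit_apply_apply, matrixUnit_apply_apply, block_apply]
  simp only [Nat.pair_eq_pair, ite_and]

end StdModule

namespace ClosedStarDerivation

variable {A B : Type*} [NonUnitalCStarAlgebra A] [PartialOrder A] [StarOrderedRing A]
    [NonUnitalCStarAlgebra B] [PartialOrder B] [StarOrderedRing B]

variable (A B) in
/-- The map that applies `StdModule.blockUnit` to the three components of a triple. -/
def tripleBlock (m k : ℕ) : OpTriple A B →L[ℂ] OpTriple A B :=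
  (StdModule.blockUnit m k).prodMap
    ((StdModule.blockUnit m k).prodMap (StdModule.blockUnit m k))

theorem norm_tripleBlock_snd_le (m k : ℕ) (t : OpTriple A B) :
    ‖(tripleBlock A B m k t).2‖ ≤ ‖t.2‖ := by
  have hle (T : StdModule B →L[ℂ] StdModule B) : ‖StdModule.blockUnit m k T‖ ≤ ‖T‖ := by
    simpa only [one_mul] using
      ContinuousLinearMap.le_of_opNorm_le _ (StdModule.norm_blockUnit_le m k) T
  exact max_le_max (hle _) (hle _)

variable {ρ : A →⋆ₙₐ[ℂ] B} (D : ClosedStarDerivation ρ)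

theorem tripleBlock_mem_triples {t : OpTriple A B} (ht : t ∈ D.triples) (m k : ℕ) :
    tripleBlock A B m k t ∈ D.triples := by
  refine map_mem_closure (tripleBlock A B m k).continuous ht ?_
  rintro _ ⟨M, rfl⟩
  rw [SetLike.mem_coe]
  induction M using Finsupp.induction_linear with
  | zero => rw [map_zero, map_zero]; exact zero_mem _
  | add M N hM hN => rw [map_add, map_add]; exact add_mem hM hN
  | single p a =>
    refine ⟨Finsupp.single (Nat.pair m p.1, Nat.pair k p.2) a, ?_⟩
    rw [tripleMap_single, tripleMap_single]
    exact Prod.ext (StdModule.blockUnit_matrixUnit ..).symm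
      (Prod.ext (StdModule.blockUnit_matrixUnit ..).symm (StdModule.blockUnit_matrixUnit ..).symm)

end ClosedStarDerivation

/-! ### Decay of the derivatives of powers -/

section PowDeriv

variable {R : Type*} [Ring R]

/-- The derivative of `(1 - P) ^ N` in the direction `S` for the variable `P`. -/
def powDeriv (P S : R) : ℕ → R
  | 0 => 0
  | N + 1 => (1 - P) * powDeriv P S N - S * (1 - P) ^ N

theorem powDeriv_eq_sum (P S : R) (N : ℕ) : powDeriv P S N =
    -∑ i ∈ Finset.range N, (1 - P) ^ i * S * (1 - P) ^ (N - 1 - i) := by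
  induction N with
  | zero => rw [powDeriv, Finset.sum_range_zero, neg_zero]
  | succ N ih =>
    rw [powDeriv, ih, Finset.sum_range_succ', pow_zero, one_mul, mul_neg, Finset.mul_sum,
      neg_add, ← sub_eq_add_neg]
    congr 2
    refine Finset.sum_congr rfl fun i _ => ?_
    rw [pow_succ', show N + 1 - 1 - (i + 1) = N - 1 - i by omega]
    simp only [mul_assoc]

end PowDeriv

theorem div_succ_pow_mul_div_succ_pow_le (C : ℝ) (i j s : ℕ) :
    C / ((i : ℝ) + 1) ^ s * (C / ((j : ℝ) + 1) ^ s) ≤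
      2 ^ s * C ^ 2 / (((i + j + 1 : ℕ) : ℝ) + 1) ^ s := by
  have hle : ((i + j + 1 : ℕ) : ℝ) + 1 ≤ 2 * (((i : ℝ) + 1) * (j + 1)) := by
    push_cast
    nlinarith [mul_nonneg i.cast_nonneg (α := ℝ) j.cast_nonneg]
  rw [div_mul_div_comm, ← mul_pow, ← sq, div_le_div_iff₀ (by positivity) (by positivity)]
  calc C ^ 2 * (((i + j + 1 : ℕ) : ℝ) + 1) ^ s
      ≤ C ^ 2 * (2 * (((i : ℝ) + 1) * (j + 1))) ^ s := by gcongr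
    _ = 2 ^ s * C ^ 2 * (((i : ℝ) + 1) * (j + 1)) ^ s := by rw [mul_pow]; ring

section NormedRing

variable {R : Type*} [NormedRing R] {P Q : R} {C : ℝ} {s : ℕ} (hPQ : Commute P Q)
    (hC : ∀ N : ℕ, ‖Q * (1 - P) ^ N‖ ≤ C / ((N : ℝ) + 1) ^ (s + 1))

include hC in
theorem norm_mul_one_sub_pow_le (N : ℕ) : ‖Q * (1 - P) ^ N‖ ≤ C / ((N : ℝ) + 1) ^ s := by
  have hC0 : 0 ≤ C := by simpa using (norm_nonneg _).trans (hC 0)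
  refine (hC N).trans (div_le_div_of_nonneg_left hC0 (by positivity) ?_)
  exact pow_le_pow_right₀ (le_add_of_nonneg_left N.cast_nonneg) s.le_succ

include hPQ hC

theorem norm_mul_powDeriv_mul_le (S : R) (N : ℕ) :
    ‖Q * powDeriv P S N * Q‖ ≤ 2 ^ (s + 1) * C ^ 2 * ‖S‖ / ((N : ℝ) + 1) ^ s := by
  have hterm (i : ℕ) (hi : i ∈ Finset.range N) :
      ‖Q * ((1 - P) ^ i * S * (1 - P) ^ (N - 1 - i)) * Q‖ ≤
        2 ^ (s + 1) * C ^ 2 * ‖S‖ / ((N : ℝ) + 1) ^ (s + 1) := by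
    obtain ⟨j, rfl⟩ : ∃ j, N = i + j + 1 :=
      ⟨N - 1 - i, by have := Finset.mem_range.1 hi; omega⟩
    have hcomm : (1 - P) ^ j * Q = Q * (1 - P) ^ j :=
      (((Commute.one_left Q).sub_left hPQ).pow_left j).eq
    calc ‖Q * ((1 - P) ^ i * S * (1 - P) ^ (i + j + 1 - 1 - i)) * Q‖
        = ‖Q * (1 - P) ^ i * S * (Q * (1 - P) ^ j)‖ := by
          rw [show i + j + 1 - 1 - i = j by omega, ← hcomm]
          simp only [mul_assoc]
      _ ≤ C / ((i : ℝ) + 1) ^ (s + 1) * ‖S‖ * (C / ((j : ℝ) + 1) ^ (s + 1)) :=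
          norm_mul_le_of_le (norm_mul_le_of_le (hC i) le_rfl) (hC j)
      _ = C / ((i : ℝ) + 1) ^ (s + 1) * (C / ((j : ℝ) + 1) ^ (s + 1)) * ‖S‖ := by ring
      _ ≤ 2 ^ (s + 1) * C ^ 2 / (((i + j + 1 : ℕ) : ℝ) + 1) ^ (s + 1) * ‖S‖ := by
          gcongr ?_ * _
          exact div_succ_pow_mul_div_succ_pow_le C i j (s + 1)
      _ = _ := by ring
  rw [powDeriv_eq_sum, mul_neg, neg_mul, norm_neg, Finset.mul_sum, Finset.sum_mul]
  calc ‖∑ i ∈ Finset.range N, Q * ((1 - P) ^ i * S * (1 - P) ^ (N - 1 - i)) * Q‖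
      ≤ N * (2 ^ (s + 1) * C ^ 2 * ‖S‖ / ((N : ℝ) + 1) ^ (s + 1)) := by
        simpa only [Finset.sum_const, Finset.card_range, nsmul_eq_mul] using
          norm_sum_le_of_le _ hterm
    _ ≤ (N + 1) * (2 ^ (s + 1) * C ^ 2 * ‖S‖ / ((N : ℝ) + 1) ^ (s + 1)) := by gcongr; linarith
    _ = 2 ^ (s + 1) * C ^ 2 * ‖S‖ / ((N : ℝ) + 1) ^ s := by field_simp; ring

theorem norm_deriv_mul_one_sub_pow_mul_le (S d : R) (N : ℕ) :
    ‖d * ((1 - P) ^ N * Q) + Q * (powDeriv P S N * Q + (1 - P) ^ N * d)‖ ≤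
      (2 * C * ‖d‖ + 2 ^ (s + 1) * C ^ 2 * ‖S‖) / ((N : ℝ) + 1) ^ s := by
  have hpow := norm_mul_one_sub_pow_le hC N
  have hcomm : (1 - P) ^ N * Q = Q * (1 - P) ^ N :=
    (((Commute.one_left Q).sub_left hPQ).pow_left N).eq
  rw [hcomm, mul_add, ← mul_assoc Q, ← mul_assoc Q]
  calc _ ≤ ‖d‖ * (C / ((N : ℝ) + 1) ^ s) + (2 ^ (s + 1) * C ^ 2 * ‖S‖ / ((N : ℝ) + 1) ^ s +
        C / ((N : ℝ) + 1) ^ s * ‖d‖) :=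
        norm_add_le_of_le (norm_mul_le_of_le le_rfl hpow) (norm_add_le_of_le
          (norm_mul_powDeriv_mul_le hPQ hC S N) (norm_mul_le_of_le hpow le_rfl))
    _ = _ := by ring

end NormedRing

namespace ClosedStarDerivation

variable {A B : Type*} [NonUnitalCStarAlgebra A] [PartialOrder A] [StarOrderedRing A]
    [NonUnitalCStarAlgebra B] [PartialOrder B] [StarOrderedRing B]
    {ρ : A →⋆ₙₐ[ℂ] B} (D : ClosedStarDerivation ρ)

theorem exists_triple_pow {G : StdModule A →L[ℂ] StdModule A} {P S : StdModule B →L[ℂ] StdModule B}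
    (h : (G, P, S) ∈ D.triples) (k : ℕ) : ∃ d, (G ^ (k + 1), P ^ (k + 1), d) ∈ D.triples := by
  induction k with
  | zero => exact ⟨S, by rwa [zero_add, pow_one, pow_one]⟩
  | succ k ih =>
    obtain ⟨d, hd⟩ := ih
    rw [pow_succ G, pow_succ P]
    exact ⟨_, D.tripleMul_mem_triples hd h⟩

theorem one_sub_pow_mul_mem_triples {G T : StdModule A →L[ℂ] StdModule A}
    {P S Q d : StdModule B →L[ℂ] StdModule B} (hG : (G, P, S) ∈ D.triples)
    (hT : (T, Q, d) ∈ D.triples) (N : ℕ) :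
    ((1 - G) ^ N * T, (1 - P) ^ N * Q, powDeriv P S N * Q + (1 - P) ^ N * d) ∈ D.triples := by
  induction N with
  | zero => simpa only [pow_zero, one_mul, powDeriv, zero_mul, zero_add] using hT
  | succ N ih =>
    convert sub_mem ih (D.tripleMul_mem_triples hG ih) using 1
    simp only [tripleMul, Prod.mk_sub_mk, powDeriv, pow_succ', sub_mul, one_mul, mul_add,
      mul_assoc, Prod.mk.injEq, true_and]
    abel

/-- The operators `T N` lie in `𝒦(H_A)_δ` and both `ρ(T N)` and `δ(T N)` are of order
`(N + 1) ^ (-s)`. -/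
def HasDecay (T : ℕ → StdModule A →L[ℂ] StdModule A) (s : ℕ) : Prop :=
  ∃ (t : ℕ → OpTriple A B) (c : ℝ), ∀ N, t N ∈ D.triples ∧ (t N).1 = T N ∧
    ‖(t N).2‖ ≤ c / ((N : ℝ) + 1) ^ s

variable {D} in
theorem HasDecay.mul_right {T : ℕ → StdModule A →L[ℂ] StdModule A} {s : ℕ} (h : D.HasDecay T s)
    {t : OpTriple A B} (ht : t ∈ D.triples) : D.HasDecay (fun N => T N * t.1) s := by
  obtain ⟨u, c, hu⟩ := h
  refine ⟨fun N => tripleMul (u N) t, c * ‖t.2.1‖ + c * ‖t.2.2‖, fun N =>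
    ⟨D.tripleMul_mem_triples (hu N).1 ht, congrArg (· * t.1) (hu N).2.1, ?_⟩⟩
  have hρ := (norm_fst_le (u N).2).trans (hu N).2.2
  have hδ := (norm_snd_le (u N).2).trans (hu N).2.2
  have hc : 0 ≤ c / ((N : ℝ) + 1) ^ s := (norm_nonneg _).trans (hu N).2.2
  rw [add_div, mul_div_right_comm, mul_div_right_comm]
  refine norm_prod_le_iff.2 ⟨(norm_mul_le_of_le hρ le_rfl).trans ?_, ?_⟩
  · exact le_add_of_nonneg_right (mul_nonneg hc (norm_nonneg _))
  · rw [add_comm]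
    exact (norm_add_le_of_le (norm_mul_le_of_le hδ le_rfl)
      (norm_mul_le_of_le hρ le_rfl)).trans_eq (add_comm _ _)

theorem hasDecay_mul_one_sub_pow_mul {G T : StdModule A →L[ℂ] StdModule A}
    {P S Q d : StdModule B →L[ℂ] StdModule B} (hG : (G, P, S) ∈ D.triples)
    (hT : (T, Q, d) ∈ D.triples) (hPQ : Commute P Q) {C : ℝ} {s : ℕ}
    (hC : ∀ N : ℕ, ‖Q * (1 - P) ^ N‖ ≤ C / ((N : ℝ) + 1) ^ (s + 1)) :
    D.HasDecay (fun N => T * ((1 - G) ^ N * T)) s := by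
  refine ⟨_, max (C * ‖Q‖) (2 * C * ‖d‖ + 2 ^ (s + 1) * C ^ 2 * ‖S‖), fun N =>
    ⟨D.tripleMul_mem_triples hT (D.one_sub_pow_mul_mem_triples hG hT N), rfl, ?_⟩⟩
  refine norm_prod_le_iff.2 ⟨?_, ?_⟩
  · calc ‖Q * ((1 - P) ^ N * Q)‖ ≤ C / ((N : ℝ) + 1) ^ s * ‖Q‖ := by
          rw [← mul_assoc]
          exact norm_mul_le_of_le (norm_mul_one_sub_pow_le hC N) le_rfl
      _ = C * ‖Q‖ / ((N : ℝ) + 1) ^ s := by ring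
      _ ≤ _ := div_le_div_of_nonneg_right (le_max_left _ _) (by positivity)
  · exact (norm_deriv_mul_one_sub_pow_mul_le hPQ hC S d N).trans
      (div_le_div_of_nonneg_right (le_max_right _ _) (by positivity))

end ClosedStarDerivation

/-! ### The operators `Φ⋆ Φ` and `Φ Φ⋆` -/

namespace Adjointable

open HilbertCMod

variable {A E F : Type*} [NonUnitalCStarAlgebra A] [PartialOrder A]
    [NormedAddCommGroup E] [NormedSpace ℂ E] [SMul Aᵐᵒᵖ E] [HilbertCMod A E]
    [NormedAddCommGroup F] [NormedSpace ℂ F] [SMul Aᵐᵒᵖ F] [HilbertCMod A F]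

/-- The operator `Φ⋆ Φ`. -/
def gram (Φ : Adjointable A E F) : AdjOp A E :=
  ⟨Φ.adj ∘L Φ.toCLM, Φ.adj ∘L Φ.toCLM,
    (IsAdjPair.of_adjointable Φ).symm.comp (IsAdjPair.of_adjointable Φ)⟩

/-- `Φ S = S' Φ`. -/
def Intertwines (Φ : Adjointable A E F) (S : AdjOp A E) (S' : AdjOp A F) : Prop :=
  ∀ x, Φ.toCLM (S.1 x) = S'.1 (Φ.toCLM x)

namespace Intertwines

variable {Φ : Adjointable A E F} {S T : AdjOp A E} {S' T' : AdjOp A F}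

theorem one : Φ.Intertwines 1 1 := fun _ => rfl

theorem mul (h : Φ.Intertwines S S') (k : Φ.Intertwines T T') : Φ.Intertwines (S * T) (S' * T') :=
  fun x => (h (T.1 x)).trans (congrArg S'.1 (k x))

theorem add (h : Φ.Intertwines S S') (k : Φ.Intertwines T T') : Φ.Intertwines (S + T) (S' + T') :=
  fun x => (map_add Φ.toCLM _ _).trans (congrArg₂ (· + ·) (h x) (k x))

theorem sub (h : Φ.Intertwines S S') (k : Φ.Intertwines T T') : Φ.Intertwines (S - T) (S' - T') :=
  fun x => (map_sub Φ.toCLM _ _).trans (congrArg₂ (· - ·) (h x) (k x))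

theorem pow (h : Φ.Intertwines S S') (n : ℕ) : Φ.Intertwines (S ^ n) (S' ^ n) := by
  induction n with
  | zero => rw [pow_zero, pow_zero]; exact one
  | succ n ih => rw [pow_succ, pow_succ]; exact ih.mul h

theorem gram (Φ : Adjointable A E F) : Φ.Intertwines Φ.gram Φ.flip.gram := fun _ => rfl

end Intertwines

theorem isSelfAdjoint_gram (Φ : Adjointable A E F) : IsSelfAdjoint Φ.gram :=
  AdjOp.isSelfAdjoint_iff.2
    ((IsAdjPair.of_adjointable Φ).symm.comp (IsAdjPair.of_adjointable Φ))

theorem comp_one_sub_gram_pow_comp_adj (Φ : Adjointable A E F) (N : ℕ) :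
    Φ.toCLM ∘L ((1 - Φ.gram) ^ N).1 ∘L Φ.adj = (Φ.flip.gram * (1 - Φ.flip.gram) ^ N).1 := by
  have hcommute : Commute Φ.flip.gram ((1 - Φ.flip.gram) ^ N) :=
    ((Commute.one_right _).sub_right (Commute.refl _)).pow_right _
  rw [hcommute.eq]
  exact ContinuousLinearMap.ext fun x =>
    (Intertwines.one.sub (Intertwines.gram Φ)).pow N (Φ.adj x)

variable [StarOrderedRing A]

theorem norm_adj (Φ : Adjointable A E F) : ‖Φ.adj‖ = ‖Φ.toCLM‖ :=
  (IsAdjPair.of_adjointable Φ).norm_eq.symm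

theorem isPosContraction_gram {Φ : Adjointable A E F} (h : ‖Φ.toCLM‖ ≤ 1) :
    AdjOp.IsPosContraction Φ.gram where
  isSelfAdjoint := Φ.isSelfAdjoint_gram
  nonneg _ := (HilbertCMod.inner_self_nonneg _).trans_eq (Φ.inner_adj _ _)
  norm_le := (ContinuousLinearMap.opNorm_comp_le _ _).trans
    (mul_le_one₀ (Φ.norm_adj.trans_le h) (norm_nonneg _) h)

variable [CompleteSpace E] [CompleteSpace F] {Φ : Adjointable A E F}

theorem norm_one_sub_gram_pow_comp_adj_sq_le (h : ‖Φ.toCLM‖ ≤ 1) (N : ℕ) :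
    ‖((1 - Φ.gram) ^ N).1 ∘L Φ.adj‖ ^ 2 ≤ Real.exp 1 * (1 / ((N : ℝ) + 1)) := by
  have hpow : IsAdjPair A ((1 - Φ.gram) ^ N).1 ((1 - Φ.gram) ^ N).1 :=
    AdjOp.isSelfAdjoint_iff.1 (((IsSelfAdjoint.one _).sub Φ.isSelfAdjoint_gram).pow N)
  have hcomp : (Φ.toCLM ∘L ((1 - Φ.gram) ^ N).1) ∘L (((1 - Φ.gram) ^ N).1 ∘L Φ.adj) =
      (Φ.flip.gram ^ 1 * (1 - Φ.flip.gram) ^ (N + N)).1 := by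
    rw [pow_one, ← comp_one_sub_gram_pow_comp_adj, pow_add]
    rfl
  calc ‖((1 - Φ.gram) ^ N).1 ∘L Φ.adj‖ ^ 2
      ≤ ‖(Φ.flip.gram ^ 1 * (1 - Φ.flip.gram) ^ (N + N)).1‖ := by
        rw [← hcomp]
        exact (hpow.comp (IsAdjPair.of_adjointable Φ).symm).norm_sq_le
    _ ≤ Real.exp 1 * (Nat.factorial 1 : ℕ) / ((N + N : ℕ) + 1) ^ 1 :=
        (isPosContraction_gram (Φ := Φ.flip)
          (Φ.norm_adj.trans_le h)).norm_pow_mul_one_sub_pow_le 1 (N + N)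
    _ = Real.exp 1 * (1 / (((N + N : ℕ) : ℝ) + 1)) := by
        rw [Nat.factorial_one, Nat.cast_one, pow_one, mul_div_assoc]
    _ ≤ Real.exp 1 * (1 / ((N : ℝ) + 1)) := by gcongr; exact le_add_self

theorem tendsto_one_sub_gram_pow (h : ‖Φ.toCLM‖ ≤ 1) (hd : DenseRange Φ.adj) (η : E) :
    Tendsto (fun N : ℕ => ((1 - Φ.gram) ^ N).1 η) atTop (𝓝 0) := by
  have hbound : Tendsto (fun N : ℕ => Real.exp 1 * (1 / ((N : ℝ) + 1))) atTop (𝓝 0) := by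
    simpa only [mul_zero] using tendsto_one_div_add_atTop_nhds_zero_nat.const_mul (Real.exp 1)
  have hnorm : Tendsto (fun N => ‖((1 - Φ.gram) ^ N).1 ∘L Φ.adj‖) atTop (𝓝 0) :=
    squeeze_zero (fun _ => norm_nonneg _)
      (fun N => Real.le_sqrt_of_sq_le (norm_one_sub_gram_pow_comp_adj_sq_le h N))
      (by simpa only [Real.sqrt_zero] using hbound.sqrt)
  have hrange (x : F) : Tendsto (fun N => ((1 - Φ.gram) ^ N).1 (Φ.adj x)) atTop (𝓝 0) :=
    squeeze_zero_norm (fun N => (((1 - Φ.gram) ^ N).1 ∘L Φ.adj).le_opNorm x)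
      (by simpa only [zero_mul] using hnorm.mul_const ‖x‖)
  have hequi : Equicontinuous fun (N : ℕ) (η : E) => ((1 - Φ.gram) ^ N).1 η :=
    (LipschitzWith.uniformEquicontinuous _ 1 fun N => ContinuousLinearMap.lipschitzWith_of_opNorm_le
      ((isPosContraction_gram h).norm_one_sub_pow_le N)).equicontinuous
  exact (hequi.isClosed_setOfPred_tendsto continuous_const).closure_subset_iff.2
    (Set.range_subset_iff.2 hrange) (hd η)

theorem denseRange_gram_pow (h : ‖Φ.toCLM‖ ≤ 1) (hd : DenseRange Φ.adj) (n : ℕ) :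
    DenseRange ((Φ.gram ^ n).1) := by
  have hgram : DenseRange Φ.gram.1 := fun η => by
    have htendsto : Tendsto (fun N : ℕ => η - ((1 - Φ.gram) ^ N).1 η) atTop (𝓝 η) := by
      simpa only [sub_zero] using (tendsto_one_sub_gram_pow h hd η).const_sub η
    refine mem_closure_of_tendsto htendsto (Eventually.of_forall fun N => ?_)
    have hgeom := mul_neg_geom_sum (1 - Φ.gram) N
    rw [sub_sub_cancel] at hgeom
    exact ⟨(∑ i ∈ Finset.range N, (1 - Φ.gram) ^ i).1 η,
      congrArg (fun S : AdjOp A E => S.1 η) hgeom⟩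
  induction n with
  | zero =>
    rw [pow_zero]
    exact Function.surjective_id.denseRange
  | succ n ih =>
    rw [pow_succ]
    exact ih.comp hgram (ContinuousLinearMap.continuous _)

end Adjointable

/-! ### The isometry into the standard module -/

namespace Adjointable

open HilbertCMod

variable {A X : Type*} [NonUnitalCStarAlgebra A] [PartialOrder A] [StarOrderedRing A]
    [NormedAddCommGroup X] [NormedSpace ℂ X] [SMul Aᵐᵒᵖ X] [HilbertCMod A X]
    (Φ : Adjointable A X (StdModule A)) (R : AdjOp A X)

/-- The operators `(1 - G) ^ m * R` for `G = Φ⋆ Φ`; the isometry has the blocks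
`Φ (1 - G) ^ m R`. -/
def coef (m : ℕ) : AdjOp A X := (1 - Φ.gram) ^ m * R

/-- The sum of the blocks of the isometry with index in `s`. -/
def partialIsom (s : Finset ℕ) : X →L[ℂ] StdModule A :=
  ∑ m ∈ s, (StdModule.block A m).adj ∘L Φ.toCLM ∘L (Φ.coef R m).1

/-- The adjoint of `partialIsom`. -/
def partialIsomAdj (s : Finset ℕ) : StdModule A →L[ℂ] X :=
  ∑ m ∈ s, ((star (Φ.coef R m)).1 ∘L Φ.adj) ∘L (StdModule.block A m).toCLM

theorem isAdjPair_partialIsom (s : Finset ℕ) :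
    IsAdjPair A (Φ.partialIsom R s) (Φ.partialIsomAdj R s) :=
  IsAdjPair.sum _ fun m _ => (IsAdjPair.of_adjointable (StdModule.block A m)).symm.comp
    ((IsAdjPair.of_adjointable Φ).comp (Φ.coef R m).isAdjPair)

theorem block_partialIsom {s : Finset ℕ} {m : ℕ} (hm : m ∈ s) (η : X) :
    (StdModule.block A m).toCLM (Φ.partialIsom R s η) = Φ.toCLM ((Φ.coef R m).1 η) := by
  rw [partialIsom, _root_.sum_apply]
  exact StdModule.block_sum_adj hm fun k => Φ.toCLM ((Φ.coef R k).1 η)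

theorem partialIsomAdj_comp_partialIsom (s : Finset ℕ) :
    Φ.partialIsomAdj R s ∘L Φ.partialIsom R s =
      (∑ m ∈ s, star (Φ.coef R m) * (Φ.gram * Φ.coef R m)).1 := by
  refine ContinuousLinearMap.ext fun η => ?_
  rw [ContinuousLinearMap.comp_apply, partialIsomAdj, _root_.sum_apply,
    AddSubmonoidClass.coe_finsetSum, _root_.sum_apply]
  refine Finset.sum_congr rfl fun m hm => ?_
  rw [ContinuousLinearMap.comp_apply, Φ.block_partialIsom R hm]
  rfl

/-- `R` is a selfadjoint square root of `2 - G`, where `G = Φ⋆ Φ`, commuting with `G`. It makes the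
blocks `Φ (1 - G) ^ m R` add up to an isometry, since `∑ (2 - G) G (1 - G) ^ (2 * m) = 1`. -/
structure IsRoot : Prop where
  isSelfAdjoint : IsSelfAdjoint R
  mul_self : R * R = 2 - Φ.gram
  commute : Commute R Φ.gram

variable {Φ R}

namespace IsRoot

theorem commute_one_sub (hR : Φ.IsRoot R) : Commute R (1 - Φ.gram) :=
  (Commute.one_right R).sub_right hR.commute

theorem star_coef (hR : Φ.IsRoot R) (m : ℕ) : star (Φ.coef R m) = R * (1 - Φ.gram) ^ m := by
  rw [coef, star_mul, hR.isSelfAdjoint.star_eq,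
    (((IsSelfAdjoint.one _).sub Φ.isSelfAdjoint_gram).pow m).star_eq]

theorem star_coef_mul_coef (hR : Φ.IsRoot R) (m : ℕ) :
    star (Φ.coef R m) * (Φ.gram * Φ.coef R m) =
      (1 - (1 - Φ.gram) ^ 2) * ((1 - Φ.gram) ^ 2) ^ m := by
  have hgram : Commute ((1 - Φ.gram) ^ m) Φ.gram :=
    ((Commute.one_left _).sub_left (Commute.refl _)).pow_left m
  have hcommute : Commute R ((1 - Φ.gram) ^ m * Φ.gram * (1 - Φ.gram) ^ m) :=
    ((hR.commute_one_sub.pow_right m).mul_right hR.commute).mul_right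
      (hR.commute_one_sub.pow_right m)
  calc star (Φ.coef R m) * (Φ.gram * Φ.coef R m)
      = R * ((1 - Φ.gram) ^ m * Φ.gram * (1 - Φ.gram) ^ m * R) := by
        rw [hR.star_coef, coef]; simp only [mul_assoc]
    _ = (2 - Φ.gram) * ((1 - Φ.gram) ^ m * Φ.gram * (1 - Φ.gram) ^ m) := by
        rw [← hcommute.eq, ← mul_assoc, hR.mul_self]
    _ = (2 - Φ.gram) * Φ.gram * ((1 - Φ.gram) ^ 2) ^ m := by
        rw [hgram.eq, mul_assoc Φ.gram, ← pow_add, ← two_mul, pow_mul, mul_assoc]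
    _ = (1 - (1 - Φ.gram) ^ 2) * ((1 - Φ.gram) ^ 2) ^ m := by
        congr 1
        rw [sq]
        simp only [mul_sub, sub_mul, one_mul, mul_one, two_mul]
        abel

theorem partialIsomAdj_comp_partialIsom_range (hR : Φ.IsRoot R) (M : ℕ) :
    Φ.partialIsomAdj R (Finset.range M) ∘L Φ.partialIsom R (Finset.range M) =
      (1 - (1 - Φ.gram) ^ (2 * M)).1 := by
  rw [partialIsomAdj_comp_partialIsom, Finset.sum_congr rfl fun m _ => hR.star_coef_mul_coef m,
    ← Finset.mul_sum, mul_neg_geom_sum, pow_mul]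

theorem partialIsomAdj_comp_partialIsom_Ico (hR : Φ.IsRoot R) {L M : ℕ} (hLM : L ≤ M) :
    Φ.partialIsomAdj R (Finset.Ico L M) ∘L Φ.partialIsom R (Finset.Ico L M) =
      ((1 - Φ.gram) ^ (2 * L) - (1 - Φ.gram) ^ (2 * M)).1 := by
  rw [partialIsomAdj_comp_partialIsom, Finset.sum_congr rfl fun m _ => hR.star_coef_mul_coef m,
    ← Finset.mul_sum, Finset.sum_Ico_eq_sub _ hLM, mul_sub, mul_neg_geom_sum, mul_neg_geom_sum,
    sub_sub_sub_cancel_left, pow_mul, pow_mul]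

theorem norm_partialIsom_sub_sq (hR : Φ.IsRoot R) {L M : ℕ} (hLM : L ≤ M) (η : X) :
    ‖Φ.partialIsom R (Finset.range M) η - Φ.partialIsom R (Finset.range L) η‖ ^ 2 =
      ‖(inner A η (((1 - Φ.gram) ^ (2 * L)).1 η) : A) -
        inner A η (((1 - Φ.gram) ^ (2 * M)).1 η)‖ := by
  have hsub : Φ.partialIsom R (Finset.range M) η - Φ.partialIsom R (Finset.range L) η =
      Φ.partialIsom R (Finset.Ico L M) η := by
    rw [partialIsom, partialIsom, partialIsom, ← _root_.sub_apply, Finset.sum_Ico_eq_sub _ hLM]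
  rw [hsub, norm_sq_eq (A := A), Φ.isAdjPair_partialIsom, ← HilbertCMod.inner_sub_right,
    ← ContinuousLinearMap.comp_apply, hR.partialIsomAdj_comp_partialIsom_Ico hLM]
  rfl

variable [CompleteSpace X] (hR : Φ.IsRoot R) (h : ‖Φ.toCLM‖ ≤ 1) (hd : DenseRange Φ.adj)

include h hd in
theorem tendsto_inner_one_sub_gram_pow (η η' : X) :
    Tendsto (fun M : ℕ => (inner A η (((1 - Φ.gram) ^ (2 * M)).1 η') : A)) atTop (𝓝 0) := by
  have hlim := tendsto_inner (A := A) (tendsto_const_nhds (x := η))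
    ((tendsto_one_sub_gram_pow h hd η').comp (tendsto_id.const_mul_atTop' two_pos))
  rw [HilbertCMod.inner_zero_right] at hlim
  exact hlim

include hR h hd in
theorem cauchySeq_partialIsom (η : X) : CauchySeq fun M => Φ.partialIsom R (Finset.range M) η := by
  rw [Metric.cauchySeq_iff']
  intro ε hε
  obtain ⟨L, hL⟩ := Metric.cauchySeq_iff'.1
    (tendsto_inner_one_sub_gram_pow h hd η η).cauchySeq (ε ^ 2) (by positivity)
  refine ⟨L, fun M hM => lt_of_pow_lt_pow_left₀ 2 hε.le ?_⟩
  rw [dist_eq_norm, hR.norm_partialIsom_sub_sq hM, ← dist_eq_norm, dist_comm]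
  exact hL M hM

/-- The pointwise limit of the operators `partialIsom`. -/
def isomCLM : X →L[ℂ] StdModule A :=
  continuousLinearMapOfTendsto (fun M => Φ.partialIsom R (Finset.range M))
    (tendsto_pi_nhds.2 fun η =>
      (cauchySeq_tendsto_of_complete (hR.cauchySeq_partialIsom h hd η)).choose_spec)

theorem tendsto_partialIsom (η : X) :
    Tendsto (fun M => Φ.partialIsom R (Finset.range M) η) atTop (𝓝 (hR.isomCLM h hd η)) :=
  (cauchySeq_tendsto_of_complete (hR.cauchySeq_partialIsom h hd η)).choose_spec

theorem inner_isomCLM (η η' : X) :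
    (inner A (hR.isomCLM h hd η) (hR.isomCLM h hd η') : A) = inner A η η' := by
  refine tendsto_nhds_unique (tendsto_inner (hR.tendsto_partialIsom h hd η)
    (hR.tendsto_partialIsom h hd η')) ?_
  have hlim := (tendsto_inner_one_sub_gram_pow h hd η η').const_sub (inner A η η')
  rw [sub_zero] at hlim
  refine hlim.congr fun M => ?_
  rw [Φ.isAdjPair_partialIsom, ← ContinuousLinearMap.comp_apply,
    hR.partialIsomAdj_comp_partialIsom_range, ← HilbertCMod.inner_sub_right]
  rfl

theorem isomCLM_apply_pair (η : X) (m n : ℕ) :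
    hR.isomCLM h hd η (Nat.pair m n) = Φ.toCLM ((Φ.coef R m).1 η) n := by
  refine tendsto_nhds_unique (((StdModule.continuous_eval _).tendsto _).comp
    (hR.tendsto_partialIsom h hd η)) (tendsto_const_nhds.congr' ?_)
  refine (eventually_gt_atTop m).mono fun M hM => ?_
  rw [← Φ.block_partialIsom R (Finset.mem_range.2 hM)]
  rfl

theorem norm_isomCLM_sub_sq (η : X) (M : ℕ) :
    ‖hR.isomCLM h hd η - Φ.partialIsom R (Finset.range M) η‖ ^ 2 =
      ‖(inner A η (((1 - Φ.gram) ^ (2 * M)).1 η) : A)‖ := by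
  refine tendsto_nhds_unique (((hR.tendsto_partialIsom h hd η).sub_const _).norm.pow 2) ?_
  have hlim := ((tendsto_inner_one_sub_gram_pow h hd η η).const_sub
    (inner A η (((1 - Φ.gram) ^ (2 * M)).1 η))).norm
  rw [sub_zero] at hlim
  exact hlim.congr' ((eventually_ge_atTop M).mono fun L hL =>
    (hR.norm_partialIsom_sub_sq hL η).symm)

/-- The isometry `X → H_A` with the blocks `Φ (1 - G) ^ m R`, where `G = Φ⋆ Φ`. -/
def isom : Adjointable A X (StdModule A) :=
  ofCoords (hR.isomCLM h hd)
    (fun p => ((star (Φ.coef R p.unpair.1)).1 ∘L Φ.adj ∘L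
      StdModule.singleCLM A p.unpair.2).toLinearMap)
    fun p a η => by
      rw [← Nat.pair_unpair p, hR.isomCLM_apply_pair h hd, Nat.pair_unpair p]
      refine ((Φ.coef R _).isAdjPair.symm _ _).trans ?_
      exact (Φ.inner_adj_left _ _).trans (StdModule.inner_single_left _ _ _)

theorem isom_adj_comp :
    (hR.isom h hd).adj ∘L (hR.isom h hd).toCLM = ContinuousLinearMap.id ℂ X :=
  ContinuousLinearMap.ext fun η => ext_inner (A := A) fun z =>
    ((hR.isom h hd).inner_adj z _).symm.trans (hR.inner_isomCLM h hd z η)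

end IsRoot

end Adjointable

/-! ### The analysis operator of a summable sequence -/

theorem exists_pos_mul_mul_le_geometric (n : ℕ → ℕ → ℝ) : ∃ c : ℕ → ℝ, (∀ i, 0 < c i) ∧
    ∀ i j, c i * c j * n i j ≤ (1 : ℝ) / 2 / 2 ^ i * ((1 : ℝ) / 2 / 2 ^ j) := by
  set s : ℕ → ℝ := fun m =>
    1 + ∑ k ∈ Finset.range (m + 1), ∑ l ∈ Finset.range (m + 1), |n k l|
  have hone (m : ℕ) : 1 ≤ s m := le_add_of_nonneg_right
    (Finset.sum_nonneg fun k _ => Finset.sum_nonneg fun l _ => abs_nonneg _)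
  have hpos (m : ℕ) : 0 < s m := zero_lt_one.trans_le (hone m)
  have hle {m i j : ℕ} (hi : i ≤ m) (hj : j ≤ m) : n i j ≤ s m :=
    calc n i j ≤ |n i j| := le_abs_self _
      _ ≤ ∑ l ∈ Finset.range (m + 1), |n i l| := Finset.single_le_sum
          (f := fun l => |n i l|) (fun l _ => abs_nonneg _) (Finset.mem_range_succ_iff.2 hj)
      _ ≤ ∑ k ∈ Finset.range (m + 1), ∑ l ∈ Finset.range (m + 1), |n k l| :=
          Finset.single_le_sum (f := fun k => ∑ l ∈ Finset.range (m + 1), |n k l|)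
            (fun k _ => Finset.sum_nonneg fun l _ => abs_nonneg _) (Finset.mem_range_succ_iff.2 hi)
      _ ≤ s m := le_add_of_nonneg_left zero_le_one
  have hmul (i j : ℕ) : n i j ≤ s i * s j := by
    rcases le_total i j with hij | hij
    · exact (hle hij le_rfl).trans (le_mul_of_one_le_left (hpos j).le (hone i))
    · exact (hle le_rfl hij).trans (le_mul_of_one_le_right (hpos i).le (hone j))
  refine ⟨fun i => (1 : ℝ) / 2 / 2 ^ i / s i, fun i => div_pos (by positivity) (hpos i),
    fun i j => ?_⟩
  calc (1 : ℝ) / 2 / 2 ^ i / s i * ((1 : ℝ) / 2 / 2 ^ j / s j) * n i j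
      = (1 : ℝ) / 2 / 2 ^ i * ((1 : ℝ) / 2 / 2 ^ j) * (n i j / (s i * s j)) := by
        rw [div_mul_div_comm, div_mul_eq_mul_div, mul_div_assoc]
    _ ≤ (1 : ℝ) / 2 / 2 ^ i * ((1 : ℝ) / 2 / 2 ^ j) * 1 := by
        gcongr
        exact (div_le_one (mul_pos (hpos i) (hpos j))).2 (hmul i j)
    _ = (1 : ℝ) / 2 / 2 ^ i * ((1 : ℝ) / 2 / 2 ^ j) := mul_one _

theorem hasSum_geometric_mul_geometric :
    HasSum (fun p : ℕ × ℕ => (1 : ℝ) / 2 / 2 ^ p.1 * ((1 : ℝ) / 2 / 2 ^ p.2)) 1 := by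
  have hgeo := hasSum_geometric_two' 1
  simpa only [one_mul] using hgeo.mul hgeo
    (hgeo.summable.mul_of_nonneg hgeo.summable (fun _ => by positivity) fun _ => by positivity)

theorem tendsto_sum_range_range_of_hasSum {G : Type*} [AddCommMonoid G] [TopologicalSpace G]
    {f : ℕ × ℕ → G} {a : G} (h : HasSum f a) :
    Tendsto (fun N => ∑ i ∈ Finset.range N, ∑ j ∈ Finset.range N, f (i, j)) atTop (𝓝 a) := by
  have hsquares : Tendsto (fun N : ℕ => Finset.range N ×ˢ Finset.range N) atTop atTop := by
    refine tendsto_atTop_finset_of_monotone (fun M N hMN => Finset.product_subset_product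
      (Finset.range_mono hMN) (Finset.range_mono hMN)) fun p => ⟨max p.1 p.2 + 1, ?_⟩
    simp only [Finset.mem_product, Finset.mem_range]
    omega
  exact (Tendsto.comp h hsquares).congr fun N => Finset.sum_product _ _ _

namespace Adjointable

open HilbertCMod

variable {A X : Type*} [NonUnitalCStarAlgebra A] [PartialOrder A] [StarOrderedRing A]
    [NormedAddCommGroup X] [NormedSpace ℂ X] [SMul Aᵐᵒᵖ X] [HilbertCMod A X]
    (ξ : ℕ → X)

theorem norm_singleCLM_comp_innerCLM_le (n : ℕ) :
    ‖StdModule.singleCLM A n ∘L innerCLM A (ξ n)‖ ≤ ‖ξ n‖ := by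
  refine ContinuousLinearMap.opNorm_le_bound _ (norm_nonneg _) fun y => ?_
  rw [ContinuousLinearMap.comp_apply, StdModule.singleCLM_apply, StdModule.norm_single]
  exact norm_inner_le _ _

variable {ξ} (hξ : Summable fun n => ‖ξ n‖)

include hξ in
theorem summable_singleCLM_comp_innerCLM :
    Summable fun n => StdModule.singleCLM A n ∘L innerCLM A (ξ n) :=
  hξ.of_norm_bounded (norm_singleCLM_comp_innerCLM_le ξ)

include hξ in
theorem tsum_singleCLM_comp_innerCLM_apply (η : X) (n : ℕ) :
    (∑' n, StdModule.singleCLM A n ∘L innerCLM A (ξ n)) η n = (inner A (ξ n) η : A) := by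
  have hsum := (summable_singleCLM_comp_innerCLM (A := A) hξ).hasSum.map
    (StdModule.evalCLM A n ∘L ContinuousLinearMap.apply ℂ _ η) (ContinuousLinearMap.continuous _)
  refine hsum.unique ((hasSum_ite_eq n (inner A (ξ n) η : A)).congr_fun fun k => ?_)
  change StdModule.single k (inner A (ξ k) η : A) n = _
  rw [StdModule.single_apply]
  rcases eq_or_ne n k with rfl | hnk
  · rw [if_pos rfl]
  · rw [if_neg hnk, if_neg hnk.symm]

variable [CompleteSpace X]

/-- The operator `η ↦ (⟪ξₙ, η⟫)ₙ`. -/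
def analysis : Adjointable A X (StdModule A) :=
  ofCoords (∑' n, StdModule.singleCLM A n ∘L innerCLM A (ξ n))
    (fun n => (opSMulCLM (ξ n)).toLinearMap) fun n a z => by
      rw [tsum_singleCLM_comp_innerCLM_apply hξ]
      exact HilbertCMod.inner_smul_left _ _ _

theorem analysis_apply (η : X) (n : ℕ) : (analysis hξ).toCLM η n = (inner A (ξ n) η : A) :=
  tsum_singleCLM_comp_innerCLM_apply hξ η n

theorem hasSum_analysis : HasSum (fun n => StdModule.singleCLM A n ∘L innerCLM A (ξ n))
    (analysis (A := A) hξ).toCLM := (summable_singleCLM_comp_innerCLM hξ).hasSum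

theorem analysis_adj_single (n : ℕ) (a : A) :
    (analysis hξ).adj (StdModule.single n a) = ξ n <• a :=
  ext_inner (A := A) fun z => by
    rw [← inner_adj, StdModule.inner_single_right, analysis_apply, star_inner,
      HilbertCMod.inner_smul_right]

theorem norm_analysis_le {c : ℝ} (h : HasSum (fun n => ‖ξ n‖) c) :
    ‖(analysis (A := A) h.summable).toCLM‖ ≤ c :=
  tsum_of_norm_bounded h (norm_singleCLM_comp_innerCLM_le ξ)

theorem denseRange_analysis_adj
    (h : Dense (Submodule.span ℂ {x : X | ∃ (n : ℕ) (a : A), x = ξ n <• a} : Set X)) :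
    DenseRange (analysis (A := A) hξ).adj := by
  have hspan : Submodule.span ℂ {x : X | ∃ (n : ℕ) (a : A), x = ξ n <• a} ≤
      LinearMap.range (analysis (A := A) hξ).adj.toLinearMap := by
    refine Submodule.span_le.2 ?_
    rintro _ ⟨n, a, rfl⟩
    exact ⟨StdModule.single n a, analysis_adj_single hξ n a⟩
  exact h.mono hspan

theorem gram_flip_analysis_single_apply (j : ℕ) (a : A) (i : ℕ) :
    (analysis hξ).flip.gram.1 (StdModule.single j a) i = (inner A (ξ i) (ξ j) : A) * a := by
  change (analysis hξ).toCLM ((analysis hξ).adj (StdModule.single j a)) i = _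
  rw [analysis_adj_single, analysis_apply, HilbertCMod.inner_smul_right]

theorem gram_analysis_mem_compactOperators :
    (analysis (A := A) hξ).gram.1 ∈ compactOperators A X X := by
  have hsum := (hasSum_analysis (A := A) hξ).map
    (ContinuousLinearMap.compL ℂ X (StdModule A) X (analysis (A := A) hξ).adj)
    (ContinuousLinearMap.continuous _)
  refine (Submodule.isClosed_topologicalClosure _).mem_of_tendsto hsum (Eventually.of_forall
    fun s => Submodule.sum_mem _ fun n _ => Submodule.le_topologicalClosure _
      (Submodule.subset_span ⟨ξ n, ξ n, ContinuousLinearMap.ext fun z => ?_⟩))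
  exact analysis_adj_single hξ n _

end Adjointable

/-! ### The Gram matrix as a differentiable compact operator -/

namespace StdModule

variable {A : Type*} [NonUnitalCStarAlgebra A] [PartialOrder A] [StarOrderedRing A]

theorem clm_ext_single {F : Type*} [NormedAddCommGroup F] [NormedSpace ℂ F]
    {S T : StdModule A →L[ℂ] F} (h : ∀ n a, S (single n a) = T (single n a)) : S = T :=
  ContinuousLinearMap.ext fun x => ((hasSum_single x).map S S.continuous).unique
    (((hasSum_single x).map T T.continuous).congr_fun fun n => h n (x n))

theorem single_apply_of_hasSum_matrixUnit {f : ℕ × ℕ → A} {T : StdModule A →L[ℂ] StdModule A}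
    (h : HasSum (fun p : ℕ × ℕ => matrixUnit p.1 p.2 (f p)) T) (j : ℕ) (a : A) (i : ℕ) :
    T (single j a) i = f (i, j) * a := by
  have hsum := h.map (evalCLM A i ∘L ContinuousLinearMap.apply ℂ _ (single j a))
    (ContinuousLinearMap.continuous _)
  refine hsum.unique ((hasSum_ite_eq (i, j) (f (i, j) * a)).congr_fun fun ⟨k, l⟩ => ?_)
  change matrixUnit k l (f (k, l)) (single j a) i = _
  rw [matrixUnit_apply_apply, single_apply]
  by_cases hk : i = k
  · by_cases hl : l = j
    · subst hk hl
      simp only [if_true]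
    · simp [hl]
  · simp [hk, Ne.symm hk]

end StdModule

section GramPositive

open HilbertCMod

variable {A B X : Type*} [NonUnitalCStarAlgebra A] [PartialOrder A]
    [NonUnitalCStarAlgebra B] [PartialOrder B] [StarOrderedRing B]
    [NormedAddCommGroup X] [NormedSpace ℂ X] [SMul Aᵐᵒᵖ X] [HilbertCMod A X]
    {φ : A →⋆ₙₐ[ℂ] B} {ξ : ℕ → X} {P : StdModule B →L[ℂ] StdModule B}

theorem isAdjPair_of_hasSum_gram
    (h : HasSum (fun p : ℕ × ℕ => matrixUnit p.1 p.2 (φ (inner A (ξ p.1) (ξ p.2)))) P) :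
    IsAdjPair B P P := by
  have hlim (x : StdModule B) := ((ContinuousLinearMap.apply ℂ (StdModule B) x).continuous.tendsto
    _).comp (tendsto_sum_range_range_of_hasSum h)
  refine IsAdjPair.tendsto (fun N => ?_) hlim hlim
  have hpair := IsAdjPair.sum (Finset.range N) fun i _ => IsAdjPair.sum (Finset.range N)
    fun j _ => isAdjPair_matrixUnit i j (φ (inner A (ξ i) (ξ j)))
  simp only [← map_star, star_inner] at hpair
  exact Eq.subst (motive := IsAdjPair B _) Finset.sum_comm hpair

variable [StarOrderedRing A]

theorem inner_nonneg_of_hasSum_gram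
    (h : HasSum (fun p : ℕ × ℕ => matrixUnit p.1 p.2 (φ (inner A (ξ p.1) (ξ p.2)))) P)
    (x : StdModule B) : 0 ≤ (inner B x (P x) : B) := by
  have hlim := ((continuous_inner_right (A := B) x).tendsto _).comp
    (((ContinuousLinearMap.apply ℂ (StdModule B) x).continuous.tendsto _).comp
      (tendsto_sum_range_range_of_hasSum h))
  refine ge_of_tendsto hlim (Eventually.of_forall fun N => ?_)
  refine (gram_form_nonneg φ (fun i : Fin N => ξ i) fun i => x i).trans_eq ?_
  change _ = inner B x ((∑ i ∈ Finset.range N, ∑ j ∈ Finset.range N,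
    matrixUnit i j (φ (inner A (ξ i) (ξ j)))) x)
  simp only [_root_.sum_apply, HilbertCMod.inner_sum_right, matrixUnit_apply,
    StdModule.inner_single_right, Finset.sum_range, mul_assoc]

theorem exists_isPosContraction_of_hasSum_gram
    (h : HasSum (fun p : ℕ × ℕ => matrixUnit p.1 p.2 (φ (inner A (ξ p.1) (ξ p.2)))) P)
    (hP : ‖P‖ ≤ 1) : ∃ P' : AdjOp B (StdModule B), P'.1 = P ∧ P'.IsPosContraction :=
  ⟨⟨P, P, isAdjPair_of_hasSum_gram h⟩, rfl, AdjOp.isSelfAdjoint_iff.2 (isAdjPair_of_hasSum_gram h),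
    inner_nonneg_of_hasSum_gram h, hP⟩

end GramPositive

namespace ClosedStarDerivation

variable {A B X : Type*} [NonUnitalCStarAlgebra A] [PartialOrder A] [StarOrderedRing A]
    [NonUnitalCStarAlgebra B] [PartialOrder B] [StarOrderedRing B]
    [NormedAddCommGroup X] [NormedSpace ℂ X] [SMul Aᵐᵒᵖ X] [HilbertCMod A X]
    {ρ : A →⋆ₙₐ[ℂ] B} (D : ClosedStarDerivation ρ)

theorem norm_tripleMap_single_le (p : ℕ × ℕ) (a : D.dom) :
    ‖D.tripleMap (Finsupp.single p a)‖ ≤ ‖(a : A)‖ + ‖D.δ a‖ := by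
  have hρ := NonUnitalStarAlgHom.norm_apply_le ρ (a : A)
  rw [tripleMap_single]
  exact norm_prod_le_iff.2
    ⟨(norm_matrixUnit_le _ _ _).trans (le_add_of_nonneg_right (norm_nonneg _)),
      norm_prod_le_iff.2
        ⟨(norm_matrixUnit_le _ _ _).trans (hρ.trans (le_add_of_nonneg_right (norm_nonneg _))),
          (norm_matrixUnit_le _ _ _).trans (le_add_of_nonneg_left (norm_nonneg _))⟩⟩

theorem exists_triple_of_norm_le_geometric {f : ℕ × ℕ → D.dom}
    (hf : ∀ p, ‖(f p : A)‖ + ‖D.δ (f p)‖ ≤ (1 : ℝ) / 2 / 2 ^ p.1 * ((1 : ℝ) / 2 / 2 ^ p.2)) :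
    ∃ t ∈ D.triples, ‖t‖ ≤ 1 ∧ HasSum (fun p : ℕ × ℕ => matrixUnit p.1 p.2 (f p : A)) t.1 ∧
      HasSum (fun p : ℕ × ℕ => matrixUnit p.1 p.2 (ρ (f p))) t.2.1 := by
  have hle (p : ℕ × ℕ) := (D.norm_tripleMap_single_le p (f p)).trans (hf p)
  have hsum := (hasSum_geometric_mul_geometric.summable.of_norm_bounded hle).hasSum
  refine ⟨_, D.isClosed_triples.mem_of_tendsto hsum (Eventually.of_forall fun s =>
    Submodule.sum_mem _ fun p _ => D.tripleMap_mem_triples _),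
    tsum_of_norm_bounded hasSum_geometric_mul_geometric hle, ?_, ?_⟩
  · exact (hsum.map (ContinuousLinearMap.fst ℂ _ _) (ContinuousLinearMap.continuous _)).congr_fun
      fun p => (congrArg (fun t : OpTriple A B => t.1) (D.tripleMap_single p (f p))).symm
  · exact (hsum.map (ContinuousLinearMap.fst ℂ _ _ ∘L ContinuousLinearMap.snd ℂ _ _)
      (ContinuousLinearMap.continuous _)).congr_fun
      fun p => (congrArg (fun t : OpTriple A B => t.2.1) (D.tripleMap_single p (f p))).symm

theorem exists_triple_gram_analysis [CompleteSpace X] {ξ : ℕ → X} (hξ : Summable fun n => ‖ξ n‖)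
    (hdom : ∀ i j, (inner A (ξ i) (ξ j) : A) ∈ D.dom)
    (hle : ∀ i j, ‖(inner A (ξ i) (ξ j) : A)‖ + ‖D.δ ⟨inner A (ξ i) (ξ j), hdom i j⟩‖ ≤
      (1 : ℝ) / 2 / 2 ^ i * ((1 : ℝ) / 2 / 2 ^ j)) :
    ∃ (P : AdjOp B (StdModule B)) (S : StdModule B →L[ℂ] StdModule B), P.IsPosContraction ∧
      ((Adjointable.analysis (A := A) hξ).flip.gram.1, P.1, S) ∈ D.triples := by
  obtain ⟨⟨T, P, S⟩, hmem, hnorm, hT, hP⟩ := D.exists_triple_of_norm_le_geometric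
    (f := fun p => ⟨inner A (ξ p.1) (ξ p.2), hdom p.1 p.2⟩) fun p => hle p.1 p.2
  obtain ⟨P', rfl, hpos⟩ := exists_isPosContraction_of_hasSum_gram hP
    (((norm_fst_le (P, S)).trans (norm_snd_le (T, P, S))).trans hnorm)
  have hgram : (Adjointable.analysis (A := A) hξ).flip.gram.1 = T :=
    StdModule.clm_ext_single fun j a => StdModule.ext fun i => by
      rw [Adjointable.gram_flip_analysis_single_apply,
        StdModule.single_apply_of_hasSum_matrixUnit hT]
  exact ⟨P', S, hpos, hgram ▸ hmem⟩

end ClosedStarDerivation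

/-! ### Existence of absorption triples -/

section Compact

variable {A E F G H : Type*} [NonUnitalCStarAlgebra A] [PartialOrder A] [StarOrderedRing A]
    [NormedAddCommGroup E] [NormedSpace ℂ E] [SMul Aᵐᵒᵖ E] [HilbertCMod A E]
    [NormedAddCommGroup F] [NormedSpace ℂ F] [SMul Aᵐᵒᵖ F] [HilbertCMod A F]
    [NormedAddCommGroup G] [NormedSpace ℂ G] [SMul Aᵐᵒᵖ G] [HilbertCMod A G]
    [NormedAddCommGroup H] [NormedSpace ℂ H] [SMul Aᵐᵒᵖ H] [HilbertCMod A H]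

theorem rankOne_apply (x : F) (y z : E) : rankOne A x y z = x <• (inner A y z : A) := rfl

theorem comp_mem_compactOperators (W : Adjointable A F G) {S : H →L[ℂ] E}
    {S' : E →L[ℂ] H} (hS : IsAdjPair A S S') {T : E →L[ℂ] F} (hT : T ∈ compactOperators A E F) :
    W.toCLM ∘L T ∘L S ∈ compactOperators A H G := by
  refine map_mem_closure (f := fun T : E →L[ℂ] F => W.toCLM ∘L T ∘L S) (by fun_prop) hT
    fun T hT => ?_
  rw [SetLike.mem_coe] at hT ⊢
  induction hT using Submodule.span_induction with
  | mem T hT =>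
    obtain ⟨x, y, rfl⟩ := hT
    refine Submodule.subset_span ⟨W.toCLM x, S' y, ContinuousLinearMap.ext fun z => ?_⟩
    rw [ContinuousLinearMap.comp_apply, ContinuousLinearMap.comp_apply, rankOne_apply,
      rankOne_apply, W.map_op_smul, hS.symm]
  | zero => simp
  | add T T' _ _ hT hT' =>
    beta_reduce
    rw [ContinuousLinearMap.add_comp, ContinuousLinearMap.comp_add]
    exact add_mem hT hT'
  | smul c T _ hT =>
    beta_reduce
    rw [ContinuousLinearMap.smul_comp, ContinuousLinearMap.comp_smul]
    exact Submodule.smul_mem _ c hT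

end Compact

namespace AdjOp

open HilbertCMod

variable {A E : Type*} [NonUnitalCStarAlgebra A] [PartialOrder A]
    [NormedAddCommGroup E] [NormedSpace ℂ E] [SMul Aᵐᵒᵖ E] [HilbertCMod A E] {S : AdjOp A E}

theorem IsPosContraction.inner_pow_nonneg (h : IsPosContraction S) (n : ℕ) (x : E) :
    0 ≤ (inner A x ((S ^ n).1 x) : A) := by
  induction n using Nat.twoStepInduction generalizing x with
  | zero => exact HilbertCMod.inner_self_nonneg x
  | one => rw [pow_one]; exact h.nonneg x
  | more n ih _ =>
    refine (ih (S.1 x)).trans_eq ?_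
    rw [isSelfAdjoint_iff.1 h.isSelfAdjoint, pow_succ, pow_succ']
    rfl

end AdjOp

namespace Adjointable

open HilbertCMod

variable {A E F : Type*} [NonUnitalCStarAlgebra A] [PartialOrder A]
    [NormedAddCommGroup E] [NormedSpace ℂ E] [SMul Aᵐᵒᵖ E] [HilbertCMod A E]
    [NormedAddCommGroup F] [NormedSpace ℂ F] [SMul Aᵐᵒᵖ F] [HilbertCMod A F]

variable (W : Adjointable A E F) (S T : AdjOp A E)

/-- The operator `W S W⋆`. -/
def conj : Adjointable A F F where
  toCLM := W.toCLM ∘L S.1 ∘L W.adj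
  adj := W.toCLM ∘L (star S).1 ∘L W.adj
  inner_adj := (IsAdjPair.of_adjointable W).comp
    (S.isAdjPair.comp (IsAdjPair.of_adjointable W).symm)

variable {S} in
theorem adj_conj (hS : IsSelfAdjoint S) : (W.conj S).adj = (W.conj S).toCLM := by
  change W.toCLM ∘L (star S).1 ∘L W.adj = _
  rw [hS.star_eq, conj]

theorem inner_conj_nonneg (hS : ∀ x, 0 ≤ (inner A x (S.1 x) : A)) (x : F) :
    0 ≤ (inner A x ((W.conj S).toCLM x) : A) :=
  (hS (W.adj x)).trans_eq (W.inner_adj_left _ _)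

theorem conj_mul_mem_compactOperators [StarOrderedRing A] {S : AdjOp A E}
    (hS : S.1 ∈ compactOperators A E E) (T : AdjOp A E) :
    (W.conj (S * T)).toCLM ∈ compactOperators A F F :=
  comp_mem_compactOperators W (T.isAdjPair.comp (IsAdjPair.of_adjointable W).symm) hS

variable {W} (hW : W.adj ∘L W.toCLM = ContinuousLinearMap.id ℂ E)
include hW

theorem conj_comp_range : (W.conj S).toCLM ∘L (W.toCLM ∘L W.adj) = (W.conj S).toCLM :=
  ContinuousLinearMap.ext fun x =>
    congrArg (fun y => W.toCLM (S.1 y)) (DFunLike.congr_fun hW (W.adj x))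

theorem range_comp_conj : (W.toCLM ∘L W.adj) ∘L (W.conj S).toCLM = (W.conj S).toCLM :=
  ContinuousLinearMap.ext fun x =>
    congrArg W.toCLM (DFunLike.congr_fun hW (S.1 (W.adj x)))

theorem conj_comp_conj :
    (W.conj S).toCLM ∘L (W.conj T).toCLM = (W.toCLM ∘L S.1) ∘L (T.1 ∘L W.adj) :=
  ContinuousLinearMap.ext fun x =>
    congrArg (fun y => W.toCLM (S.1 y)) (DFunLike.congr_fun hW (T.1 (W.adj x)))

theorem adj_comp_conj_comp : W.adj ∘L (W.conj S).toCLM ∘L W.toCLM = S.1 :=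
  ContinuousLinearMap.ext fun x => by
    refine (DFunLike.congr_fun hW (S.1 (W.adj (W.toCLM x)))).trans ?_
    exact congrArg S.1 (DFunLike.congr_fun hW x)

end Adjointable

namespace Adjointable.IsRoot

open HilbertCMod

variable {A X : Type*} [NonUnitalCStarAlgebra A] [PartialOrder A] [StarOrderedRing A]
    [NormedAddCommGroup X] [NormedSpace ℂ X] [SMul Aᵐᵒᵖ X] [HilbertCMod A X]
    {Φ : Adjointable A X (StdModule A)} {R : AdjOp A X} (hR : Φ.IsRoot R)

section Tendsto

variable [CompleteSpace X] (h : ‖Φ.toCLM‖ ≤ 1) (hd : DenseRange Φ.adj)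

include h in
theorem norm_one_sub_gram_pow_two_mul_apply_le {n : ℕ} (hn : n ≠ 0) (M : ℕ) (y : X) :
    ‖((1 - Φ.gram) ^ (2 * M)).1 ((Φ.gram ^ n).1 y)‖ ≤
      Real.exp 1 * n.factorial / (M + 1) * ‖y‖ := by
  have hcomm : Commute ((1 - Φ.gram) ^ (2 * M)) (Φ.gram ^ n) :=
    ((Commute.one_left _).sub_left (Commute.refl _)).pow_pow _ _
  have hle : (M : ℝ) + 1 ≤ (((2 * M : ℕ) : ℝ) + 1) ^ n := by
    refine le_trans ?_ (le_self_pow₀ (le_add_of_nonneg_left (Nat.cast_nonneg _)) hn)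
    gcongr
    exact Nat.le_mul_of_pos_left M two_pos
  change ‖((1 - Φ.gram) ^ (2 * M) * Φ.gram ^ n).1 y‖ ≤ _
  rw [hcomm.eq]
  refine ContinuousLinearMap.le_of_opNorm_le _
    (((isPosContraction_gram h).norm_pow_mul_one_sub_pow_le n (2 * M)).trans ?_) y
  exact div_le_div_of_nonneg_left (by positivity) (by positivity) hle

theorem norm_partialIsom_comp_gram_pow_sub_le {n : ℕ} (hn : n ≠ 0) (M : ℕ) :
    ‖Φ.partialIsom R (Finset.range M) ∘L (Φ.gram ^ n).1 -
        (hR.isom h hd).toCLM ∘L (Φ.gram ^ n).1‖ ≤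
      √(‖(Φ.gram ^ n).1‖ * (Real.exp 1 * n.factorial / (M + 1))) := by
  refine ContinuousLinearMap.opNorm_le_bound _ (Real.sqrt_nonneg _) fun y => ?_
  refine le_of_sq_le_sq ?_ (by positivity)
  rw [mul_pow, Real.sq_sqrt (by positivity), _root_.sub_apply, norm_sub_rev]
  calc _ = ‖(inner A ((Φ.gram ^ n).1 y)
          (((1 - Φ.gram) ^ (2 * M)).1 ((Φ.gram ^ n).1 y)) : A)‖ := hR.norm_isomCLM_sub_sq h hd _ M
    _ ≤ ‖(Φ.gram ^ n).1 y‖ * ‖((1 - Φ.gram) ^ (2 * M)).1 ((Φ.gram ^ n).1 y)‖ := norm_inner_le _ _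
    _ ≤ (‖(Φ.gram ^ n).1‖ * ‖y‖) * (Real.exp 1 * n.factorial / (M + 1) * ‖y‖) :=
        mul_le_mul (ContinuousLinearMap.le_opNorm _ _)
          (norm_one_sub_gram_pow_two_mul_apply_le h hn M y) (norm_nonneg _) (by positivity)
    _ = _ := by ring

theorem tendsto_partialIsom_comp_gram_pow {n : ℕ} (hn : n ≠ 0) :
    Tendsto (fun M => Φ.partialIsom R (Finset.range M) ∘L (Φ.gram ^ n).1) atTop
      (𝓝 ((hR.isom h hd).toCLM ∘L (Φ.gram ^ n).1)) := by
  have hdiv : Tendsto (fun M : ℕ => Real.exp 1 * n.factorial / ((M : ℝ) + 1)) atTop (𝓝 0) :=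
    (tendsto_natCast_atTop_atTop.atTop_add tendsto_const_nhds).const_div_atTop _
  have hbound := (hdiv.const_mul ‖(Φ.gram ^ n).1‖).sqrt
  rw [mul_zero, Real.sqrt_zero] at hbound
  exact tendsto_iff_norm_sub_tendsto_zero.2 (squeeze_zero (fun _ => norm_nonneg _)
    (hR.norm_partialIsom_comp_gram_pow_sub_le h hd hn) hbound)

theorem tendsto_gram_pow_comp_partialIsomAdj {n : ℕ} (hn : n ≠ 0) :
    Tendsto (fun M => (Φ.gram ^ n).1 ∘L Φ.partialIsomAdj R (Finset.range M)) atTop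
      (𝓝 ((Φ.gram ^ n).1 ∘L (hR.isom h hd).adj)) := by
  have hlim := hR.tendsto_partialIsom_comp_gram_pow h hd hn
  rw [tendsto_iff_norm_sub_tendsto_zero] at hlim ⊢
  have hpow := AdjOp.isSelfAdjoint_iff.1 (Φ.isSelfAdjoint_gram.pow n)
  exact hlim.congr fun M => (((Φ.isAdjPair_partialIsom R _).comp hpow).sub
    ((IsAdjPair.of_adjointable (hR.isom h hd)).comp hpow)).norm_eq

end Tendsto

include hR

theorem coef_mul_gram_pow_mul_star_coef (m k n : ℕ) :
    Φ.coef R m * Φ.gram ^ n * (Φ.gram ^ n * star (Φ.coef R k)) =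
      Φ.gram ^ n * ((1 - Φ.gram) ^ (m + k) * Φ.gram ^ n) * (2 - Φ.gram) := by
  have hsub : Commute (1 - Φ.gram) (Φ.gram ^ n) :=
    ((Commute.one_left _).sub_left (Commute.refl _)).pow_right n
  have hRpow : Commute R (Φ.gram ^ n * (Φ.gram ^ n * (1 - Φ.gram) ^ k)) :=
    (hR.commute.pow_right n).mul_right
      ((hR.commute.pow_right n).mul_right (hR.commute_one_sub.pow_right k))
  calc Φ.coef R m * Φ.gram ^ n * (Φ.gram ^ n * star (Φ.coef R k))
      = (1 - Φ.gram) ^ m *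
          (R * (Φ.gram ^ n * (Φ.gram ^ n * (1 - Φ.gram) ^ k))) * R := by
        rw [hR.star_coef, (hR.commute_one_sub.pow_right k).eq, coef]
        simp only [mul_assoc]
    _ = (1 - Φ.gram) ^ m * Φ.gram ^ n * (Φ.gram ^ n * (1 - Φ.gram) ^ k) * (R * R) := by
        rw [hRpow.eq]
        simp only [mul_assoc]
    _ = Φ.gram ^ n * ((1 - Φ.gram) ^ (m + k) * Φ.gram ^ n) * (2 - Φ.gram) := by
        rw [(hsub.pow_left m).eq, ← (hsub.pow_left k).eq, hR.mul_self, pow_add]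
        simp only [mul_assoc]

theorem comp_coef_comp_adj (m k n : ℕ) :
    Φ.toCLM ∘L (Φ.coef R m * Φ.gram ^ n * (Φ.gram ^ n * star (Φ.coef R k))).1 ∘L Φ.adj =
      Φ.flip.gram.1 ^ n * ((1 - Φ.flip.gram.1) ^ (m + k) * Φ.flip.gram.1 ^ n) *
        (Φ.flip.gram.1 + Φ.flip.gram.1 - Φ.flip.gram.1 * Φ.flip.gram.1) := by
  have hgram := Intertwines.gram Φ
  have hintertwines := ((hgram.pow n).mul
    (((Intertwines.one.sub hgram).pow (m + k)).mul (hgram.pow n))).mul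
      ((Intertwines.one.add Intertwines.one).sub hgram)
  have hfactor : (1 + 1 - Φ.flip.gram) * Φ.flip.gram =
      Φ.flip.gram + Φ.flip.gram - Φ.flip.gram * Φ.flip.gram := by
    rw [sub_mul, add_mul, one_mul]
  rw [hR.coef_mul_gram_pow_mul_star_coef, ← one_add_one_eq_two]
  refine ContinuousLinearMap.ext fun x => (hintertwines (Φ.adj x)).trans ?_
  exact congrArg (fun S : AdjOp A (StdModule A) => (Φ.flip.gram ^ n *
    ((1 - Φ.flip.gram) ^ (m + k) * Φ.flip.gram ^ n) * S).1 x) hfactor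

theorem partialIsom_comp_partialIsomAdj (s : Finset ℕ) (n : ℕ) :
    (Φ.partialIsom R s ∘L (Φ.gram ^ n).1) ∘L ((Φ.gram ^ n).1 ∘L Φ.partialIsomAdj R s) =
      ∑ m ∈ s, ∑ k ∈ s, StdModule.blockUnit m k
        (Φ.flip.gram.1 ^ n * ((1 - Φ.flip.gram.1) ^ (m + k) * Φ.flip.gram.1 ^ n) *
          (Φ.flip.gram.1 + Φ.flip.gram.1 - Φ.flip.gram.1 * Φ.flip.gram.1)) := by
  simp only [← hR.comp_coef_comp_adj]
  simp only [partialIsom, partialIsomAdj, ContinuousLinearMap.finsetSum_comp,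
    ContinuousLinearMap.comp_finsetSum]
  exact Finset.sum_comm

end Adjointable.IsRoot

theorem summable_one_div_succ_sq_mul_one_div_succ_sq :
    Summable fun p : ℕ × ℕ => 1 / ((p.1 : ℝ) + 1) ^ 2 * (1 / ((p.2 : ℝ) + 1) ^ 2) := by
  have hsq : Summable fun n : ℕ => 1 / ((n : ℝ) + 1) ^ 2 := by
    simpa only [Nat.cast_add, Nat.cast_one] using
      (summable_nat_add_iff 1).2 (Real.summable_one_div_nat_pow.2 one_lt_two)
  exact hsq.mul_of_nonneg hsq (fun _ => by positivity) fun _ => by positivity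

theorem div_add_succ_pow_four_le {c : ℝ} (hc : 0 ≤ c) (m k : ℕ) :
    c / (((m + k : ℕ) : ℝ) + 1) ^ 4 ≤ c * (1 / ((m : ℝ) + 1) ^ 2 * (1 / ((k : ℝ) + 1) ^ 2)) := by
  rw [one_div_mul_one_div, mul_one_div, Nat.cast_add]
  refine div_le_div_of_nonneg_left hc (by positivity) ?_
  calc ((m : ℝ) + 1) ^ 2 * ((k : ℝ) + 1) ^ 2
      ≤ ((m : ℝ) + k + 1) ^ 2 * ((m : ℝ) + k + 1) ^ 2 := by
        gcongr
        · exact le_add_of_nonneg_right k.cast_nonneg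
        · exact le_add_of_nonneg_left m.cast_nonneg
    _ = ((m : ℝ) + k + 1) ^ 4 := by ring

namespace ClosedStarDerivation

open HilbertCMod

variable {A B X : Type*} [NonUnitalCStarAlgebra A] [PartialOrder A] [NonUnitalCStarAlgebra B]
    [NormedAddCommGroup X] [NormedSpace ℂ X] [SMul Aᵐᵒᵖ X] [HilbertCMod A X]
    {ρ : A →⋆ₙₐ[ℂ] B} (D : ClosedStarDerivation ρ)

theorem exists_scaled_generators {g : ℕ → X} (hg : ∀ n m, (inner A (g n) (g m) : A) ∈ D.dom)
    (hgen : Dense (Submodule.span ℂ {x : X | ∃ (n : ℕ) (a : A), x = g n <• a} : Set X)) :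
    ∃ (ξ : ℕ → X) (hdom : ∀ i j, (inner A (ξ i) (ξ j) : A) ∈ D.dom),
      (∀ i j, ‖(inner A (ξ i) (ξ j) : A)‖ + ‖D.δ ⟨inner A (ξ i) (ξ j), hdom i j⟩‖ ≤
        (1 : ℝ) / 2 / 2 ^ i * ((1 : ℝ) / 2 / 2 ^ j)) ∧
      Dense (Submodule.span ℂ {x : X | ∃ (n : ℕ) (a : A), x = ξ n <• a} : Set X) := by
  obtain ⟨c, hpos, hle⟩ := exists_pos_mul_mul_le_geometric
    fun i j => ‖(inner A (g i) (g j) : A)‖ + ‖D.δ ⟨inner A (g i) (g j), hg i j⟩‖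
  have hinner (i j : ℕ) : (inner A ((c i : ℂ) • g i) ((c j : ℂ) • g j) : A) =
      ((c i * c j : ℝ) : ℂ) • inner A (g i) (g j) := by
    rw [HilbertCMod.inner_smul_complex, HilbertCMod.inner_smul_complex_left, smul_smul,
      RCLike.star_def, Complex.conj_ofReal, mul_comm, Complex.ofReal_mul]
  have hdom (i j : ℕ) : (inner A ((c i : ℂ) • g i) ((c j : ℂ) • g j) : A) ∈ D.dom := by
    rw [hinner]
    exact SMulMemClass.smul_mem _ (hg i j)
  refine ⟨fun i => (c i : ℂ) • g i, hdom, fun i j => ?_, hgen.mono (Submodule.span_mono ?_)⟩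
  · have hsmul : (⟨inner A ((c i : ℂ) • g i) ((c j : ℂ) • g j), hdom i j⟩ : D.dom) =
        ((c i * c j : ℝ) : ℂ) • ⟨inner A (g i) (g j), hg i j⟩ := Subtype.ext (hinner i j)
    rw [hsmul, map_smul, hinner, norm_smul, norm_smul, Complex.norm_real,
      Real.norm_of_nonneg (mul_nonneg (hpos i).le (hpos j).le), ← mul_add]
    exact hle i j
  · rintro _ ⟨n, a, rfl⟩
    refine ⟨n, ((c n)⁻¹ : ℂ) • a, ?_⟩
    rw [HilbertCMod.op_smul_smul, HilbertCMod.smul_op_smul, smul_smul,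
      inv_mul_cancel₀ (Complex.ofReal_ne_zero.2 (hpos n).ne'), one_smul]

variable [StarOrderedRing A] [PartialOrder B] [StarOrderedRing B]

section Decay

variable {D}

theorem HasDecay.isDiffCompact {Y : ℕ → StdModule A →L[ℂ] StdModule A} (hY : D.HasDecay Y 4)
    {Q : StdModule A →L[ℂ] StdModule A}
    (hQ : Tendsto (fun M => ∑ m ∈ Finset.range M, ∑ k ∈ Finset.range M,
      StdModule.blockUnit m k (Y (m + k))) atTop (𝓝 Q)) : D.IsDiffCompact Q := by
  obtain ⟨t, c, ht⟩ := hY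
  have hc : 0 ≤ c := by simpa using (norm_nonneg _).trans (ht 0).2.2
  have hsum := ((summable_one_div_succ_sq_mul_one_div_succ_sq.mul_left c).of_norm_bounded
    (f := fun p : ℕ × ℕ => (tripleBlock A B p.1 p.2 (t (p.1 + p.2))).2) fun p =>
      (norm_tripleBlock_snd_le _ _ _).trans ((ht _).2.2.trans
        (div_add_succ_pow_four_le hc p.1 p.2))).hasSum
  refine D.isDiffCompact_of_mem_triples (D.isClosed_triples.mem_of_tendsto
    (hQ.prodMk_nhds (tendsto_sum_range_range_of_hasSum hsum)) (Eventually.of_forall fun M => ?_))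
  have hmem := Submodule.sum_mem D.triples (t := Finset.range M) fun m _ =>
    Submodule.sum_mem D.triples (t := Finset.range M) fun k _ =>
      D.tripleBlock_mem_triples (ht (m + k)).1 m k
  refine Set.mem_of_eq_of_mem ?_ hmem
  simp only [Prod.ext_iff, Prod.fst_sum, Prod.snd_sum, and_true, ← (ht _).2.1]
  rfl

theorem hasDecay_gram_blocks {G : StdModule A →L[ℂ] StdModule A} {P : AdjOp B (StdModule B)}
    {S : StdModule B →L[ℂ] StdModule B} (hP : P.IsPosContraction)
    (hG : (G, P.1, S) ∈ D.triples) (s : ℕ) :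
    D.HasDecay (fun N => G ^ (s + 1) * ((1 - G) ^ N * G ^ (s + 1)) * (G + G - G * G)) s := by
  obtain ⟨d, hd⟩ := D.exists_triple_pow hG s
  exact (D.hasDecay_mul_one_sub_pow_mul hG hd ((Commute.refl P.1).pow_right _)
    (hP.norm_pow_mul_one_sub_pow_le (s + 1))).mul_right
      (sub_mem (add_mem hG hG) (D.tripleMul_mem_triples hG hG))

end Decay

variable [CompleteSpace X] {Φ : Adjointable A X (StdModule A)} {R : AdjOp A X}
    {P : AdjOp B (StdModule B)} {S : StdModule B →L[ℂ] StdModule B}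

theorem isDiffCompact_conj_isom (hR : Φ.IsRoot R) (h : ‖Φ.toCLM‖ ≤ 1) (hd : DenseRange Φ.adj)
    (hP : P.IsPosContraction) (hmem : (Φ.flip.gram.1, P.1, S) ∈ D.triples) :
    D.IsDiffCompact (((hR.isom h hd).conj (Φ.gram ^ 5)).toCLM ∘L
      ((hR.isom h hd).conj (Φ.gram ^ 5)).toCLM) := by
  rw [Adjointable.conj_comp_conj _ _ (hR.isom_adj_comp h hd)]
  refine (hasDecay_gram_blocks hP hmem 4).isDiffCompact ?_
  have hlim := ((isBoundedBilinearMap_comp (𝕜 := ℂ)).continuous.tendsto _).comp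
    ((hR.tendsto_partialIsom_comp_gram_pow h hd (Nat.succ_ne_zero 4)).prodMk_nhds
      (hR.tendsto_gram_pow_comp_partialIsomAdj h hd (Nat.succ_ne_zero 4)))
  exact hlim.congr fun M => hR.partialIsom_comp_partialIsomAdj (Finset.range M) 5

theorem isAbsorption_isom {ζ : ℕ → X} (hR : Φ.IsRoot R) (h : ‖Φ.toCLM‖ ≤ 1)
    (hd : DenseRange Φ.adj) (hcompact : Φ.gram.1 ∈ compactOperators A X X)
    (hP : P.IsPosContraction) (hmem : (Φ.flip.gram.1, P.1, S) ∈ D.triples)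
    (hframe : ∀ η n, (hR.isom h hd).toCLM η n = inner A (ζ n) η) :
    D.IsAbsorption (hR.isom h hd) ((hR.isom h hd).conj (Φ.gram ^ 5)) ζ := by
  have hiso := hR.isom_adj_comp h hd
  have hpos := Adjointable.isPosContraction_gram h
  refine ⟨hiso, Adjointable.adj_conj _ (hpos.isSelfAdjoint.pow 5),
    Adjointable.inner_conj_nonneg _ _ (hpos.inner_pow_nonneg 5), ?_, ?_, ?_, ?_, hframe⟩
  · rw [Adjointable.conj_comp_range _ hiso, Adjointable.range_comp_conj _ hiso]
  · rw [Adjointable.adj_comp_conj_comp _ hiso]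
    exact Adjointable.denseRange_gram_pow h hd 5
  · rw [Adjointable.range_comp_conj _ hiso, pow_succ' Φ.gram 4]
    exact Adjointable.conj_mul_mem_compactOperators _ hcompact _
  · rw [← ContinuousLinearMap.comp_assoc, Adjointable.range_comp_conj _ hiso]
    exact D.isDiffCompact_conj_isom hR h hd hP hmem

theorem exists_absorption {g : ℕ → X} (hg : ∀ n m, (inner A (g n) (g m) : A) ∈ D.dom)
    (hgen : Dense (Submodule.span ℂ {x : X | ∃ (n : ℕ) (a : A), x = g n <• a} : Set X)) :
    ∃ (W : Adjointable A X (StdModule A)) (K : Adjointable A (StdModule A) (StdModule A))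
      (ζ : ℕ → X), D.IsAbsorption W K ζ := by
  obtain ⟨ξ, hdom, hle, hξgen⟩ := D.exists_scaled_generators hg hgen
  have hnorm (n : ℕ) : ‖ξ n‖ ≤ (1 : ℝ) / 2 / 2 ^ n := by
    refine le_of_sq_le_sq ?_ (by positivity)
    rw [HilbertCMod.norm_sq_eq (A := A), sq]
    exact (le_add_of_nonneg_right (norm_nonneg _)).trans (hle n n)
  have hgeo := hasSum_geometric_two' 1
  have hξ : Summable fun n => ‖ξ n‖ :=
    Summable.of_nonneg_of_le (fun _ => norm_nonneg _) hnorm hgeo.summable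
  have hΦ : ‖(Adjointable.analysis (A := A) hξ).toCLM‖ ≤ 1 :=
    (Adjointable.norm_analysis_le hξ.hasSum).trans (hasSum_le hnorm hξ.hasSum hgeo)
  have hd := Adjointable.denseRange_analysis_adj hξ hξgen
  obtain ⟨P, S, hP, hmem⟩ := D.exists_triple_gram_analysis hξ hdom hle
  obtain ⟨R, hRself, hRmul, hRcomm⟩ := (Adjointable.isPosContraction_gram hΦ).exists_sqrt_two_sub
  have hR : (Adjointable.analysis (A := A) hξ).IsRoot R := ⟨hRself, hRmul, hRcomm⟩
  refine ⟨_, _, fun p => (star ((Adjointable.analysis hξ).coef R p.unpair.1)).1 (ξ p.unpair.2),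
    D.isAbsorption_isom hR hΦ hd (Adjointable.gram_analysis_mem_compactOperators hξ) hP hmem
      fun η p => ?_⟩
  conv_lhs => rw [← Nat.pair_unpair p]
  refine (hR.isomCLM_apply_pair hΦ hd η _ _).trans ?_
  rw [Adjointable.analysis_apply]
  exact (((Adjointable.analysis hξ).coef R p.unpair.1).isAdjPair.symm _ _).symm

end ClosedStarDerivation

end

theorem mainTheorem3_general {A B X : Type*}
    [NonUnitalCStarAlgebra A] [PartialOrder A] [StarOrderedRing A]
    [NonUnitalCStarAlgebra B] [PartialOrder B] [StarOrderedRing B]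
    [NormedAddCommGroup X] [NormedSpace ℂ X] [CompleteSpace X] [SMul Aᵐᵒᵖ X] [HilbertCMod A X]
    (ρ : A →⋆ₙₐ[ℂ] B) (D : ClosedStarDerivation ρ)
    (g : ℕ → X) (hg : ∀ n m, inner A (g n) (g m) ∈ D.dom)
    (hgen : Dense (Submodule.span ℂ {x : X | ∃ (n : ℕ) (a : A), x = g n <• a} : Set X)) :
    (∃ (W : Adjointable A X (StdModule A)) (K : Adjointable A (StdModule A) (StdModule A))
      (ζ : ℕ → X), D.IsAbsorption W K ζ) ∧
    ∀ (W : Adjointable A X (StdModule A)) (K : Adjointable A (StdModule A) (StdModule A))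
      (ζ : ℕ → X), D.IsAbsorption W K ζ →
      Dense (D.grassmannDomain W K : Set X) ∧
      ∃ (hmod : ∀ (η : D.grassmannDomain W K) (a : D.diffAlg),
          (η : X) <• (a : A) ∈ D.grassmannDomain W K)
        (hW : ∀ ξ : D.grassmannDomain W K, W.toCLM ξ ∈ D.diffStd)
        (hin : ∀ ξ η : D.grassmannDomain W K, inner A (ξ : X) (η : X) ∈ D.diffAlg),
      ∃ W₁ : Adjointable D.Forms (InteriorTensor X D.rho) (StdModule D.Forms),
        (∀ (ξ : X) (ω : D.Forms) (n : ℕ),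
          W₁.toCLM (InteriorTensor.tmul D.rho ξ ω) n = D.rho (W.toCLM ξ n) * ω) ∧
      ∃ nabla : D.grassmannDomain W K →ₗ[ℂ] InteriorTensor X D.rho,
        (∀ ξ, nabla ξ = W₁.adj (D.dStd ⟨W.toCLM ξ, hW ξ⟩)) ∧
        (∀ ξ η : D.grassmannDomain W K,
          D.d ⟨inner A (ξ : X) (η : X), hin ξ η⟩ =
            (InteriorTensor.creation D.rho (ξ : X)).adj (nabla η) -
              star ((InteriorTensor.creation D.rho (η : X)).adj (nabla ξ))) ∧
        (∀ (η : D.grassmannDomain W K) (a : D.diffAlg),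
          nabla ⟨(η : X) <• (a : A), hmod η a⟩ =
            nabla η <• D.rho a + InteriorTensor.tmul D.rho (η : X) (D.d a)) := by
  refine ⟨D.exists_absorption hg hgen, fun W K ζ h => ⟨h.dense_grassmannDomain,
    D.op_smul_mem_grassmannDomain, h.apply_mem_diffStd, h.inner_mem_diffAlg, h.amp, ?_,
    h.grassmannConnection, h.grassmannConnection_apply, h.d_inner_eq_grassmannConnection,
    h.grassmannConnection_op_smul⟩⟩
  intro ξ ω n
  rw [h.amp_tmul]
  rfl

theorem mainTheorem3 {A B X : Type*}
    [NonUnitalCStarAlgebra A] [PartialOrder A] [StarOrderedRing A]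
    [NonUnitalCStarAlgebra B] [PartialOrder B] [StarOrderedRing B]
    [NormedAddCommGroup X] [NormedSpace ℂ X] [CompleteSpace X] [SMul Aᵐᵒᵖ X] [HilbertCMod A X]
    (ρ : A →⋆ₙₐ[ℂ] B) (hρ : Function.Injective ρ) (D : ClosedStarDerivation ρ)
    (g : ℕ → X) (hg : ∀ n m, inner A (g n) (g m) ∈ D.dom)
    (hgen : Dense (Submodule.span ℂ {x : X | ∃ (n : ℕ) (a : A), x = g n <• a} : Set X)) :
    (∃ (W : Adjointable A X (StdModule A)) (K : Adjointable A (StdModule A) (StdModule A))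
      (ζ : ℕ → X), D.IsAbsorption W K ζ) ∧
    ∀ (W : Adjointable A X (StdModule A)) (K : Adjointable A (StdModule A) (StdModule A))
      (ζ : ℕ → X), D.IsAbsorption W K ζ →
      -- `𝒳` is dense in `X`
      Dense (D.grassmannDomain W K : Set X) ∧
      -- `𝒳` is an `A_δ`-submodule, `W` maps `𝒳` to `H_{A_δ}`, and the inner products of elements
      -- of `𝒳` are in `A_δ`
      ∃ (hmod : ∀ (η : D.grassmannDomain W K) (a : D.diffAlg),
          (η : X) <• (a : A) ∈ D.grassmannDomain W K)
        (hW : ∀ ξ : D.grassmannDomain W K, W.toCLM ξ ∈ D.diffStd)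
        (hin : ∀ ξ η : D.grassmannDomain W K, inner A (ξ : X) (η : X) ∈ D.diffAlg),
      -- the operator `W ⊗ 1 : X ⊗̂_A Ω_δ(A) → H_{Ω_δ(A)}`, `ξ ⊗ ω ↦ W(ξ) ω`, is adjointable
      ∃ W₁ : Adjointable D.Forms (InteriorTensor X D.rho) (StdModule D.Forms),
        (∀ (ξ : X) (ω : D.Forms) (n : ℕ),
          W₁.toCLM (InteriorTensor.tmul D.rho ξ ω) n = D.rho (W.toCLM ξ n) * ω) ∧
      -- the Graßmann connection `∇ = (W⋆ ⊗ 1) δ W`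
      ∃ nabla : D.grassmannDomain W K →ₗ[ℂ] InteriorTensor X D.rho,
        (∀ ξ, nabla ξ = W₁.adj (D.dStd ⟨W.toCLM ξ, hW ξ⟩)) ∧
        -- the Hermitian identity
        (∀ ξ η : D.grassmannDomain W K,
          D.d ⟨inner A (ξ : X) (η : X), hin ξ η⟩ =
            (InteriorTensor.creation D.rho (ξ : X)).adj (nabla η) -
              star ((InteriorTensor.creation D.rho (η : X)).adj (nabla ξ))) ∧
        -- the Leibniz rule
        (∀ (η : D.grassmannDomain W K) (a : D.diffAlg),
          nabla ⟨(η : X) <• (a : A), hmod η a⟩ =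
            nabla η <• D.rho a + InteriorTensor.tmul D.rho (η : X) (D.d a)) :=
  mainTheorem3_general ρ D g hg hgen
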